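/- For every $n$, let $x_1,\dots,x_n$ be independent uniformly random points of the unit square $[0,1]^2$, and, independently of the points, colour every edge of the complete graph on $\{1,\dots,n\}$ independently and uniformly at random with one of $n-1$ colours. The length of a spanning tree is the sum of the Euclidean distances $|x_i-x_j|$ over its edges $\{i,j\}$, and a spanning tree is rainbow if its edges have pairwise distinct colours. Let $Z_{\mathrm{MST}}$ be the minimum length of a rainbow spanning tree (undefined if there is none) and let $Z^*_{\mathrm{MST}}$ be the minimum length of a spanning tree without the rainbow constraint. Then there are constants $c,C,c',C'>0$, independent of $n$, such that with probability tending to $1$ as $n\to\infty$ a rainbow spanning tree exists and $$c\sqrt n\le Z_{\mathrm{MST}}\le C\sqrt n ,$$ and with probability tending to $1$ as $n\to\infty$ a rainbow spanning tree exists and $$c'\sqrt n\le Z_{\mathrm{MST}}-Z^*_{\mathrm{MST}}\le C'\sqrt n .$$ -/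

import Mathlib

open MeasureTheory Filter
open scoped Topology

/-- The Euclidean plane. -/
abbrev Plane : Type := EuclideanSpace ℝ (Fin 2)

/-- The unit square `[0,1]²`. -/
def unitSquare : Set Plane := {p | ∀ k, p k ∈ Set.Icc (0 : ℝ) 1}

/-- The uniform distribution on the unit square: Lebesgue measure restricted to the square,
which has area one. -/
noncomputable def uniformSquare : Measure Plane := volume.restrict unitSquare

/-- The edges of the complete graph on `n` vertices. -/
abbrev KnEdge (n : ℕ) : Type := ↥(⊤ : SimpleGraph (Fin n)).edgeSet

/-- The possible outcomes: positions of the `n` points, and a colouring of the edges of the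
complete graph on them with `n - 1` colours. -/
abbrev Outcome (n : ℕ) : Type := (Fin n → Plane) × (KnEdge n → Fin (n - 1))

/-- The law of the model: the points are independent and uniform in the unit square, the colours
of the edges are independent and uniform, and the points are independent of the colours. -/
noncomputable def modelLaw (n : ℕ) : Measure (Outcome n) :=
  (Measure.pi fun _ : Fin n => uniformSquare).prod
    (Measure.pi fun _ : KnEdge n => ProbabilityTheory.uniformOn (Set.univ : Set (Fin (n - 1))))

/-- The Euclidean length of the edge `e` when the vertices are placed at the points `x`. -/
noncomputable def edgeLength {n : ℕ} (x : Fin n → Plane) (e : Sym2 (Fin n)) : ℝ :=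
  Sym2.lift ⟨fun i j => dist (x i) (x j), fun i j => dist_comm (x i) (x j)⟩ e

open Classical in
/-- The total length of the edges of the graph `T` when the vertices are placed at `x`. -/
noncomputable def totalLength {n : ℕ} (x : Fin n → Plane) (T : SimpleGraph (Fin n)) : ℝ :=
  ∑ e ∈ T.edgeFinset, edgeLength x e

/-- The edges of `T` have pairwise distinct colours. -/
def IsRainbow {n : ℕ} {κ : Type*} (χ : KnEdge n → κ) (T : SimpleGraph (Fin n)) : Prop :=
  Set.InjOn χ {e : KnEdge n | (e : Sym2 (Fin n)) ∈ T.edgeSet}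

/-- `z` is the minimum length of a spanning tree on the points `ω.1`. -/
def IsMSTLength {n : ℕ} (ω : Outcome n) (z : ℝ) : Prop :=
  IsLeast {l | ∃ T : SimpleGraph (Fin n), T.IsTree ∧ totalLength ω.1 T = l} z

/-- `z` is the minimum length of a rainbow spanning tree on the points `ω.1` with the edge
colours `ω.2`; no `z` has this property if there is no rainbow spanning tree. -/
def IsRainbowMSTLength {n : ℕ} (ω : Outcome n) (z : ℝ) : Prop :=
  IsLeast {l | ∃ T : SimpleGraph (Fin n), T.IsTree ∧ IsRainbow ω.2 T ∧ totalLength ω.1 T = l} z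

/-- The events `A n` of the model with `n` points occur with high probability. -/
def WithHighProbability (A : (n : ℕ) → Set (Outcome n)) : Prop :=
  Tendsto (fun n => modelLaw n (A n)) atTop (𝓝 1)

/-! The colours are independent of the points. Positions can therefore be fixed outside an
exceptional set of small probability, and the rest is counting over colourings (`freq`,
`le_modelLaw`).

Upper bound. Set z = ⌊√n⌋ vertices aside and let W be the others. Nested dyadic partitions of the
square guide the construction of a rainbow tree on W. It starts from singletons at level S, where
2^S is a small constant fraction of |W|. In each stage, edges between sibling cells reduce the
number of classes by the factor 9/16, and the scale becomes one level coarser. Different stages use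
disjoint sets of edges, so colours can be exposed stage by stage (`freq_diff_le_of_exposure`). There
are never fewer unused colours than classes, and a union bound over sets of representatives and sets
of colours shows that a greedy choice does not get stuck (`freq_forestEvent_diff_le`). Per stage the
edges become longer by √2 but fewer by 9/16, and 9√2/16 < 1, so the total length is a geometric sum
of order √n. Of order (9/8)^S classes remain. This is far below √n, which has order √2^S, and the z
reserved vertices leave a surplus of about √n colours; hence the classes can be joined by edges of
any length (`freq_forestEvent_connect_le`). Exactly z colours are then unused, and Hall's theorem
attaches the reserved vertices as leaves with these colours (`freq_forestEvent_diff_treeEvent_le`).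
The last two steps add O(√n) edges of length at most 2.

Lower bound. Divide the square into slightly more than n equal blocks. By a second moment argument,
linearly many blocks contain exactly two points, both in the middle. The edge of such a pair is
shorter than every other edge at its ends by order 1/√n. Among linearly many edges a linear number
of colours are repeats (`freq_card_image_gt_le`), so a rainbow tree misses linearly many of these
edges. Each missing one can be exchanged in (`exists_shorter_tree`), which yields an unconstrained
tree shorter by order √n.

Since lengths are nonnegative, these two bounds give all four inequalities. -/

/-- The proportion of the elements of a finite type that lie in `B`. -/
noncomputable def freq {Ω : Type*} [Fintype Ω] (B : Set Ω) : ℝ :=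
  (B.ncard : ℝ) / Fintype.card Ω

/-! ### Proportions in a finite set and Chebyshev's inequality -/

section Freq

variable {Ω : Type*} [Fintype Ω]

theorem freq_mono {A B : Set Ω} (h : A ⊆ B) : freq A ≤ freq B := by
  unfold freq
  gcongr
  exact B.toFinite

theorem freq_union_le (A B : Set Ω) : freq (A ∪ B) ≤ freq A + freq B := by
  unfold freq
  rw [← add_div]
  gcongr
  exact_mod_cast Set.ncard_union_le A B

theorem freq_empty : freq (∅ : Set Ω) = 0 := by simp [freq]

theorem freq_compl [Nonempty Ω] (A : Set Ω) : freq Aᶜ = 1 - freq A := by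
  unfold freq
  have h := Set.ncard_add_ncard_compl A
  rw [Nat.card_eq_fintype_card] at h
  have hc : (0 : ℝ) < Fintype.card Ω := by exact_mod_cast Fintype.card_pos
  rw [← h] at hc ⊢
  field_simp
  push_cast
  ring

theorem freq_biUnion_le {ι : Type*} (s : Finset ι) (B : ι → Set Ω) :
    freq {ω | ∃ i ∈ s, ω ∈ B i} ≤ ∑ i ∈ s, freq (B i) := by
  classical
  induction s using Finset.induction_on with
  | empty => simp [freq]
  | insert a s ha ih =>
    rw [Finset.sum_insert ha]
    refine le_trans (freq_mono ?_) ((freq_union_le (B a) {ω | ∃ i ∈ s, ω ∈ B i}).trans (by gcongr))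
    rintro ω ⟨i, hi, h⟩
    rcases Finset.mem_insert.1 hi with rfl | hi
    · exact Or.inl h
    · exact Or.inr ⟨i, hi, h⟩

theorem freq_biUnion_le_card_mul {ι : Type*} (s : Finset ι) (B : ι → Set Ω) {δ : ℝ}
    (h : ∀ i ∈ s, freq (B i) ≤ δ) : freq {ω | ∃ i ∈ s, ω ∈ B i} ≤ s.card * δ := by
  refine (freq_biUnion_le s B).trans ?_
  simpa using Finset.sum_le_card_nsmul s _ δ h

open Classical in
theorem freq_eq_sum (B : Set Ω) :
    freq B = (∑ ω, if ω ∈ B then (1 : ℝ) else 0) / Fintype.card Ω := by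
  unfold freq
  rw [Finset.sum_boole, ← Set.ncard_coe_finset]
  simp

/-- Chebyshev's inequality for the number of events that occur among a finite family of events of
equal probability that are almost pairwise independent. -/
theorem freq_abs_count_sub_ge_le {α : Type*} [DecidableEq α] (I : Finset α) (E : α → Set Ω)
    {p ε τ : ℝ} (hp : ∀ a ∈ I, freq (E a) = p)
    (hpair : ∀ a ∈ I, ∀ b ∈ I, a ≠ b → freq (E a ∩ E b) ≤ (1 + ε) * p ^ 2) (hε : 0 ≤ ε)
    (hτ : 0 < τ) (X : Ω → ℝ)
    (hX : ∀ ω, X ω = ∑ a ∈ I, Set.indicator (E a) (fun _ => (1 : ℝ)) ω) :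
    freq {ω | τ ≤ |X ω - I.card * p|} ≤ (I.card * p + ε * (I.card * p) ^ 2) / τ ^ 2 := by
  classical
  rcases isEmpty_or_nonempty Ω with h0 | h0
  -- Over an empty sample space every proportion is 0 / 0 = 0, which forces p = 0 as soon as there
  -- is an event.
  · have : ∀ B : Set Ω, freq B = 0 := fun B => by simp [freq]
    rcases I.eq_empty_or_nonempty with rfl | ⟨a, ha⟩
    · simp [this]
    · have : p = 0 := by rw [← hp a ha, this]
      simp [this, freq]
  have hc : (0 : ℝ) < Fintype.card Ω := by exact_mod_cast Fintype.card_pos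
  set c : ℝ := (Fintype.card Ω : ℝ) with hcdef
  have hfreq : ∀ B : Set Ω, ∑ ω, Set.indicator B (fun _ => (1 : ℝ)) ω = c * freq B := by
    intro B
    rw [freq_eq_sum, mul_div_cancel₀ _ hc.ne']
    simp [Set.indicator_apply]
  set e : ℝ := I.card * p with he
  have hsum1 : ∑ ω, X ω = c * e := by
    simp_rw [hX]
    rw [Finset.sum_comm]
    simp_rw [hfreq]
    rw [Finset.sum_congr rfl fun a ha => by rw [hp a ha]]
    simp [he]; ring
  have hsum2 : ∑ ω, X ω ^ 2 ≤ c * (e + (1 + ε) * e ^ 2) := by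
    have h1 : ∀ ω, X ω ^ 2 = ∑ a ∈ I, ∑ b ∈ I,
        Set.indicator (E a ∩ E b) (fun _ => (1 : ℝ)) ω := by
      intro ω
      rw [hX, sq, Finset.sum_mul_sum]
      refine Finset.sum_congr rfl fun a _ => Finset.sum_congr rfl fun b _ => ?_
      by_cases ha : ω ∈ E a <;> by_cases hb : ω ∈ E b <;> simp [ha, hb]
    simp_rw [h1]
    rw [Finset.sum_comm]
    have h2 : ∀ a ∈ I, ∑ ω, ∑ b ∈ I, Set.indicator (E a ∩ E b) (fun _ => (1 : ℝ)) ω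
        ≤ c * (p + I.card * ((1 + ε) * p ^ 2)) := by
      intro a ha
      rw [Finset.sum_comm]
      simp_rw [hfreq]
      rw [← Finset.mul_sum]
      gcongr
      -- The diagonal term contributes p; only the off-diagonal ones are covered by `hpair`.
      rw [← Finset.add_sum_erase I _ ha, Set.inter_self, hp a ha]
      gcongr
      refine (Finset.sum_le_card_nsmul _ _ ((1 + ε) * p ^ 2) fun b hb => ?_).trans ?_
      · exact hpair a ha b (Finset.mem_of_mem_erase hb) (Finset.ne_of_mem_erase hb).symm
      · rw [nsmul_eq_mul]
        gcongr
        exact Finset.erase_subset _ _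
    refine (Finset.sum_le_card_nsmul _ _ _ h2).trans (le_of_eq ?_)
    simp [he]; ring
  have hvar : ∑ ω, (X ω - e) ^ 2 ≤ c * (e + ε * e ^ 2) := by
    have : ∑ ω, (X ω - e) ^ 2 = ∑ ω, X ω ^ 2 - 2 * e * ∑ ω, X ω + c * e ^ 2 := by
      rw [Finset.mul_sum, ← Finset.sum_sub_distrib]
      have h3 : c * e ^ 2 = ∑ _ω : Ω, e ^ 2 := by simp [hcdef]
      rw [h3, ← Finset.sum_add_distrib]
      exact Finset.sum_congr rfl fun ω _ => by ring
    rw [this, hsum1]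
    nlinarith
  rw [le_div_iff₀ (by positivity), freq_eq_sum, div_mul_eq_mul_div, div_le_iff₀ hc]
  calc (∑ ω, if ω ∈ {ω | τ ≤ |X ω - e|} then (1 : ℝ) else 0) * τ ^ 2
      ≤ ∑ ω, (X ω - e) ^ 2 := by
        rw [Finset.sum_mul]
        refine Finset.sum_le_sum fun ω _ => ?_
        by_cases h : τ ≤ |X ω - e|
        · simp only [Set.mem_ofPred_eq, h, if_true, one_mul]
          rw [← sq_abs (X ω - e)]
          gcongr
        · simp only [Set.mem_ofPred_eq, h, if_false, zero_mul]
          positivity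
    _ ≤ _ := by rw [mul_comm (e + _)]; exact hvar

end Freq

/-! ### Uniformly random functions and exposure of coordinates -/

section Functions

variable {ι κ : Type*} [Fintype ι] [Fintype κ] [DecidableEq ι]

theorem freq_pi (B : ι → Finset κ) :
    freq {g : ι → κ | ∀ i, g i ∈ B i} = ∏ i, ((B i).card : ℝ) / Fintype.card κ := by
  classical
  unfold freq
  have : {g : ι → κ | ∀ i, g i ∈ B i} = (Fintype.piFinset B : Finset (ι → κ)) := by
    ext g; simp
  rw [this, Set.ncard_coe_finset, Fintype.card_piFinset]
  simp [Finset.prod_div_distrib]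

/-- The probability that a uniformly random function avoids the set `J` on `A`. -/
theorem freq_avoid [Nonempty κ] (A : Finset ι) (J : Finset κ) :
    freq {g : ι → κ | ∀ i ∈ A, g i ∉ J} = (1 - J.card / Fintype.card κ) ^ A.card := by
  classical
  have hc : (Fintype.card κ : ℝ) ≠ 0 := by exact_mod_cast Fintype.card_ne_zero
  have h : {g : ι → κ | ∀ i ∈ A, g i ∉ J}
      = {g : ι → κ | ∀ i, g i ∈ (if i ∈ A then Jᶜ else Finset.univ : Finset κ)} := by
    ext g
    refine forall_congr' fun i => ?_
    by_cases hi : i ∈ A <;> simp [hi]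
  rw [h, freq_pi, ← Finset.prod_const, ← Finset.prod_filter_mul_prod_filter_not _ (· ∈ A)]
  rw [Finset.prod_congr (g := fun _ => (1 : ℝ) - J.card / Fintype.card κ) rfl,
    Finset.prod_congr (s₁ := Finset.univ.filter (· ∉ A)) (g := fun _ => (1 : ℝ)) rfl]
  · simp
  · intro i hi
    simp [(Finset.mem_filter.1 hi).2, hc]
  · intro i hi
    simp only [(Finset.mem_filter.1 hi).2, if_true]
    rw [Finset.card_compl, Nat.cast_sub (Finset.card_le_univ J)]
    field_simp

/-- From 1 - u ≤ exp (-u); the division-free hypothesis suits the union bounds below, where `A` is a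
set of edges and `J` a set of colours. -/
theorem freq_avoid_le_exp [Nonempty κ] (A : Finset ι) (J : Finset κ) {t : ℝ}
    (ht : t * Fintype.card κ ≤ A.card * J.card) :
    freq {g : ι → κ | ∀ i ∈ A, g i ∉ J} ≤ Real.exp (-t) := by
  rw [freq_avoid]
  have hc : (0 : ℝ) < Fintype.card κ := by exact_mod_cast Fintype.card_pos
  have hJ : (J.card : ℝ) / Fintype.card κ ≤ 1 :=
    div_le_one_of_le₀ (by exact_mod_cast Finset.card_le_univ J) hc.le
  calc (1 - (J.card : ℝ) / Fintype.card κ) ^ A.card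
      ≤ Real.exp (-((J.card : ℝ) / Fintype.card κ)) ^ A.card := by
        apply pow_le_pow_left₀ (by linarith)
        linarith [Real.add_one_le_exp (-((J.card : ℝ) / Fintype.card κ))]
    _ = Real.exp (-(A.card * J.card / Fintype.card κ)) := by
        rw [← Real.exp_nat_mul]; ring_nf
    _ ≤ _ := by
        apply Real.exp_le_exp.2
        rw [neg_le_neg_iff, le_div_iff₀ hc]
        exact ht

open Classical in
/-- Exposing the coordinates in `D` first: if the event `A` only depends on the coordinates in `D`
and, whatever these are, the event `A'` fails with probability at most `δ` over the others,
then the event that `A` holds and `A'` fails has probability at most `δ`. -/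
theorem freq_diff_le_of_exposure [Nonempty κ] (D : Set ι) {A A' : Set (ι → κ)} {δ : ℝ}
    (hA : ∀ φ ψ : ι → κ, D.piecewise φ ψ ∈ A → φ ∈ A)
    (h : ∀ φ ∈ A, freq {ψ | D.piecewise φ ψ ∉ A'} ≤ δ) (hδ : 0 ≤ δ) : freq (A \ A') ≤ δ := by
  have hc : (0 : ℝ) < Fintype.card (ι → κ) := by exact_mod_cast Fintype.card_pos
  have hinv : ∀ φ ψ : ι → κ, D.piecewise (D.piecewise φ ψ) (D.piecewise ψ φ) = φ := by
    intro φ ψ; funext i; by_cases hi : i ∈ D <;> simp [hi]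
  -- Swapping the coordinates outside `D` between two functions is an involution on pairs, so gluing
  -- two independent uniform functions along `D` gives a uniform one.
  let e : (ι → κ) × (ι → κ) ≃ (ι → κ) × (ι → κ) :=
    { toFun := fun q => (D.piecewise q.1 q.2, D.piecewise q.2 q.1)
      invFun := fun q => (D.piecewise q.1 q.2, D.piecewise q.2 q.1)
      left_inv := fun q => by ext1 <;> simp [hinv]
      right_inv := fun q => by ext1 <;> simp [hinv] }
  let u : Set (ι → κ) → (ι → κ) → ℝ := fun B ω => if ω ∈ B then 1 else 0
  have h1 : ∑ q : (ι → κ) × (ι → κ), u (A \ A') (D.piecewise q.1 q.2) = (∑ ω, u (A \ A') ω) * Fintype.card (ι → κ) := by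
    have h0 : ∑ q : (ι → κ) × (ι → κ), u (A \ A') (D.piecewise q.1 q.2)
        = ∑ q : (ι → κ) × (ι → κ), u (A \ A') q.1 := Equiv.sum_comp e (fun q => u (A \ A') q.1)
    rw [h0, Fintype.sum_prod_type]
    simp [Finset.mul_sum, mul_comm]
  have h2 : ∑ q : (ι → κ) × (ι → κ), u (A \ A') (D.piecewise q.1 q.2) ≤ Fintype.card (ι → κ) * (δ * Fintype.card (ι → κ)) := by
    rw [Fintype.sum_prod_type]
    refine (Finset.sum_le_card_nsmul Finset.univ _ (δ * Fintype.card (ι → κ)) fun φ _ => ?_).trans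
      (by simp)
    by_cases hφ : φ ∈ A
    · have := h φ hφ
      rw [freq_eq_sum, div_le_iff₀ hc] at this
      refine le_trans (Finset.sum_le_sum fun ψ _ => ?_) this
      simp only [u, Set.mem_ofPred_eq, Set.mem_sdiff]
      by_cases h' : D.piecewise φ ψ ∈ A'
      · simp [h']
      · by_cases h'' : D.piecewise φ ψ ∈ A <;> simp [h', h'']
    · rw [Finset.sum_eq_zero]
      · positivity
      · intro ψ _
        have : D.piecewise φ ψ ∉ A := fun h' => hφ (hA _ _ h')
        simp [u, this]
  rw [freq_eq_sum, div_le_iff₀ hc]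
  rw [h1] at h2
  have : (∑ ω, u (A \ A') ω) * Fintype.card (ι → κ) ≤ (δ * Fintype.card (ι → κ)) * Fintype.card (ι → κ) := by linarith
  exact le_of_mul_le_mul_right this hc

/-- A uniformly random function takes the same value at `i` and `j` with probability `1 / |κ|`,
even conditionally on an event that does not depend on the value at `i`. -/
theorem freq_inter_eq_apply [Nonempty κ] {i j : ι} (hij : i ≠ j) (P : Set (ι → κ))
    (hP : ∀ g b, Function.update g i b ∈ P ↔ g ∈ P) :
    freq (P ∩ {g | g i = g j}) = freq P / Fintype.card κ := by
  classical
  have hκ : (Fintype.card κ : ℝ) ≠ 0 := by exact_mod_cast Fintype.card_ne_zero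
  have key : (P ∩ {g | g i = g j}).ncard * Fintype.card κ = P.ncard := by
    -- If g i = g j, the value at `i` carries no information; replacing it by a free value gives
    -- each element of `P` exactly once.
    let e : (↥(P ∩ {g : ι → κ | g i = g j}) × κ) ≃ ↥P :=
      { toFun := fun q => ⟨Function.update q.1.1 i q.2, (hP _ _).2 q.1.2.1⟩
        invFun := fun g => (⟨Function.update g.1 i (g.1 j), (hP _ _).2 g.2, by
          simp [Function.update_of_ne hij.symm]⟩, g.1 i)
        left_inv := by
          rintro ⟨⟨g, hg, hgij⟩, b⟩
          have : g i = g j := hgij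
          simp [Function.update_of_ne hij.symm, ← this]
        right_inv := by rintro ⟨g, hg⟩; simp }
    have := Nat.card_congr e
    rw [Nat.card_prod, Nat.card_eq_fintype_card (α := κ)] at this
    exact this
  unfold freq
  rw [← key]
  push_cast
  field_simp

end Functions

/-! ### Concentration of occupancy numbers through collisions -/

section Dispersion

variable {ι β : Type*} [LinearOrder ι]

/-- The pairs of elements of `W`, in increasing order. -/
def incPairs (W : Finset ι) : Finset (ι × ι) := (W ×ˢ W).filter fun p => p.1 < p.2

theorem sum_sum_eq_sum_diag_add_two_mul (W : Finset ι) (h : ι → ι → ℝ)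
    (hs : ∀ i j, h i j = h j i) :
    ∑ i ∈ W, ∑ j ∈ W, h i j = ∑ i ∈ W, h i i + 2 * ∑ p ∈ incPairs W, h p.1 p.2 := by
  have h1 : ∀ i j, h i j = (if i < j then h i j else 0) + (if j < i then h j i else 0)
      + (if i = j then h i i else 0) := by
    intro i j
    rcases lt_trichotomy i j with hij | rfl | hij
    · simp [hij, hij.not_gt, hij.ne]
    · simp
    · simp [hij, hij.not_gt, hij.ne', hs i j]
  have h2 : ∑ p ∈ incPairs W, h p.1 p.2 = ∑ i ∈ W, ∑ j ∈ W, if i < j then h i j else 0 := by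
    rw [incPairs, Finset.sum_filter, Finset.sum_product]
  rw [Finset.sum_congr rfl fun i _ => Finset.sum_congr rfl fun j _ => h1 i j]
  simp_rw [Finset.sum_add_distrib]
  rw [h2, Finset.sum_comm (f := fun i j => if j < i then h j i else 0)]
  have h3 : ∀ i ∈ W, ∑ j ∈ W, (if i = j then h i i else 0) = h i i := by
    intro i hi; simp [hi]
  rw [Finset.sum_congr rfl h3]
  ring

theorem two_mul_card_incPairs (W : Finset ι) :
    2 * ((incPairs W).card : ℝ) = (W.card : ℝ) ^ 2 - W.card := by
  have := sum_sum_eq_sum_diag_add_two_mul W (fun _ _ => 1) (fun _ _ => rfl)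
  simp at this
  nlinarith

variable [Fintype ι] [Fintype β] [Nonempty β]

/-- Two different increasing pairs cannot have the same elements, so some element of `p` lies
outside `q`. Resampling its value does not affect the collision of `q`: collisions are exactly
pairwise independent, even for pairs sharing an element. -/
theorem freq_inter_collision {p q : ι × ι} (hp : p.1 < p.2) (hq : q.1 < q.2) (hpq : p ≠ q) :
    freq ({g : ι → β | g p.1 = g p.2} ∩ {g | g q.1 = g q.2}) = (1 / Fintype.card β : ℝ) ^ 2 := by
  have huniv : freq (Set.univ : Set (ι → β)) = 1 := by
    have := freq_compl (∅ : Set (ι → β))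
    simpa [freq_empty] using this
  have hone : ∀ i j : ι, i ≠ j → freq {g : ι → β | g i = g j} = 1 / Fintype.card β := by
    intro i j hij
    have := freq_inter_eq_apply hij (Set.univ : Set (ι → β)) (by simp)
    rwa [Set.univ_inter, huniv] at this
  have key : ∀ i j : ι, i ≠ j → i ≠ q.1 → i ≠ q.2 →
      freq ({g : ι → β | g q.1 = g q.2} ∩ {g | g i = g j}) = (1 / Fintype.card β : ℝ) ^ 2 := by
    intro i j hij h1 h2
    rw [freq_inter_eq_apply hij, hone _ _ hq.ne]
    · ring
    · intro g b
      simp [Function.update_of_ne h1.symm, Function.update_of_ne h2.symm]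
  by_cases h : p.1 ≠ q.1 ∧ p.1 ≠ q.2
  · rw [Set.inter_comm]
    exact key _ _ hp.ne h.1 h.2
  · have h' : p.2 ≠ q.1 ∧ p.2 ≠ q.2 := by
      by_contra hc
      rw [not_and_or, not_not, not_not] at h hc
      rcases h with h | h <;> rcases hc with hc | hc
      · exact hp.ne (h.trans hc.symm)
      · exact hpq (Prod.ext h hc)
      · exact absurd (h ▸ hc ▸ hp) hq.not_gt
      · exact hp.ne (h.trans hc.symm)
    rw [Set.inter_comm, show {g : ι → β | g p.1 = g p.2} = {g | g p.2 = g p.1} by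
      ext g; exact eq_comm]
    exact key _ _ hp.ne' h'.1 h'.2

variable [DecidableEq β]

/-- The numbers of elements of `W` that a uniformly random function sends to the different
values are concentrated, in the mean square sense. -/
theorem freq_dispersion_ge_le (W : Finset ι) {τ : ℝ} (hτ : 0 < τ) :
    freq {g : ι → β | W.card + τ ≤ ∑ c, (((W.filter fun v => g v = c).card : ℝ)
      - W.card / Fintype.card β) ^ 2} ≤ 2 * (W.card : ℝ) ^ 2 / (Fintype.card β * τ ^ 2) := by
  classical
  have hβ : (0 : ℝ) < Fintype.card β := by exact_mod_cast Fintype.card_pos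
  set b : ℝ := (Fintype.card β : ℝ) with hb
  let E : ι × ι → Set (ι → β) := fun p => {g | g p.1 = g p.2}
  let X : (ι → β) → ℝ := fun g => ∑ p ∈ incPairs W, Set.indicator (E p) (fun _ => (1 : ℝ)) g
  have huniv : freq (Set.univ : Set (ι → β)) = 1 := by
    have := freq_compl (∅ : Set (ι → β))
    simpa [freq_empty] using this
  have hlt : ∀ p ∈ incPairs W, p.1 < p.2 := fun p hp => (Finset.mem_filter.1 hp).2
  -- Exact pairwise independence allows ε = 0. The deviation is τ / 2 because the dispersion
  -- contains twice the number of colliding pairs.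
  have hcheb := freq_abs_count_sub_ge_le (incPairs W) E (p := 1 / b) (ε := 0) (τ := τ / 2)
    (fun p hp => by
      have := freq_inter_eq_apply (hlt p hp).ne (Set.univ : Set (ι → β)) (by simp)
      rwa [Set.univ_inter, huniv] at this)
    (fun p hp q hq hpq => by
      rw [freq_inter_collision (hlt p hp) (hlt q hq) hpq]; simp [hb])
    le_rfl (by positivity) X (fun _ => rfl)
  -- The squared occupancies count ordered colliding pairs, the |W| diagonal ones included, so the
  -- dispersion is an affine function of `X`.
  have hV : ∀ g : ι → β, ∑ c, (((W.filter fun v => g v = c).card : ℝ) - W.card / b) ^ 2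
      = W.card + 2 * X g - (W.card : ℝ) ^ 2 / b := by
    intro g
    have h1 : ∑ c, ((W.filter fun v => g v = c).card : ℝ) ^ 2 = W.card + 2 * X g := by
      have h3 := sum_sum_eq_sum_diag_add_two_mul W (fun i j => if g i = g j then (1 : ℝ) else 0)
        (fun i j => by simp [eq_comm])
      have h4 : X g = ∑ p ∈ incPairs W, (if g p.1 = g p.2 then (1 : ℝ) else 0) := by
        simp [X, E, Set.indicator_apply]
      rw [← h4] at h3
      simp only [if_true, Finset.sum_const, nsmul_eq_mul, mul_one] at h3
      rw [← h3]
      have h5 : ∀ c, ((W.filter fun v => g v = c).card : ℝ) ^ 2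
          = ∑ i ∈ W, ∑ j ∈ W, if g i = c ∧ g j = c then (1 : ℝ) else 0 := by
        intro c
        rw [sq, ← Finset.sum_boole, Finset.sum_mul_sum]
        refine Finset.sum_congr rfl fun i _ => Finset.sum_congr rfl fun j _ => ?_
        by_cases h : g i = c <;> by_cases h' : g j = c <;> simp [h, h']
      simp_rw [h5]
      rw [Finset.sum_comm]
      refine Finset.sum_congr rfl fun i _ => ?_
      rw [Finset.sum_comm]
      refine Finset.sum_congr rfl fun j _ => ?_
      by_cases h : g i = g j
      · simp [h]
      · rw [if_neg h]
        exact Finset.sum_eq_zero fun c _ => if_neg fun hc => h (hc.1.trans hc.2.symm)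
    have h2 : ∑ c, ((W.filter fun v => g v = c).card : ℝ) = W.card := by
      rw [← Nat.cast_sum, ← Finset.card_eq_sum_card_fiberwise (by simp [Set.MapsTo])]
    have h6 : ∀ c, (((W.filter fun v => g v = c).card : ℝ) - W.card / b) ^ 2
        = ((W.filter fun v => g v = c).card : ℝ) ^ 2
          - 2 * (W.card / b) * ((W.filter fun v => g v = c).card : ℝ) + (W.card / b) ^ 2 :=
      fun c => by ring
    simp_rw [h6]
    rw [Finset.sum_add_distrib, Finset.sum_sub_distrib, ← Finset.mul_sum, h1, h2]
    simp only [Finset.sum_const, Finset.card_univ, nsmul_eq_mul]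
    rw [← hb]
    field_simp
    ring
  have hcard := two_mul_card_incPairs W
  have hw : (0 : ℝ) ≤ W.card := by positivity
  refine (freq_mono ?_).trans (hcheb.trans ?_)
  · intro g hg
    simp only [Set.mem_ofPred_eq] at hg ⊢
    rw [hV] at hg
    refine le_trans ?_ (le_abs_self _)
    have : (incPairs W).card * (1 / b) = ((W.card : ℝ) ^ 2 / b - W.card / b) / 2 := by
      field_simp; linarith
    rw [this]
    have : 0 ≤ (W.card : ℝ) / b := by positivity
    linarith
  · rw [div_le_div_iff₀ (by positivity) (by positivity)]
    have h7 : (incPairs W).card * (1 / b) ≤ (W.card : ℝ) ^ 2 / (2 * b) := by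
      rw [mul_one_div, div_le_div_iff₀ hβ (by positivity)]
      nlinarith
    calc _ ≤ ((W.card : ℝ) ^ 2 / (2 * b)) * (b * τ ^ 2) := by
            rw [zero_mul, add_zero]; gcongr
      _ = (W.card : ℝ) ^ 2 * τ ^ 2 / 2 := by field_simp
      _ = _ := by ring

end Dispersion

/-! ### From the probability model to counting -/

/-- Used for the colours and again for the grid cells of the points, so that all estimates can be
made by counting. -/
theorem pi_apply_eq_freq {ι κ : Type*} [Fintype ι] [Fintype κ] [DecidableEq ι] [Nonempty κ]
    [MeasurableSpace κ] [MeasurableSingletonClass κ] (ν : ι → Measure κ) [∀ i, SigmaFinite (ν i)]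
    (hν : ∀ i c, ν i {c} = ENNReal.ofReal (1 / Fintype.card κ)) (B : Set (ι → κ)) :
    Measure.pi ν B = ENNReal.ofReal (freq B) := by
  classical
  have hs : ∀ g : ι → κ, Measure.pi ν {g} = ENNReal.ofReal (1 / Fintype.card (ι → κ)) := by
    intro g
    rw [← Set.univ_pi_singleton, Measure.pi_pi]
    simp_rw [hν]
    rw [Finset.prod_const, ← ENNReal.ofReal_pow (by positivity)]
    simp
  have hB : B = ((Set.toFinset B : Finset (ι → κ)) : Set (ι → κ)) := by simp
  rw [hB, ← sum_measure_singleton]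
  simp_rw [hs]
  rw [Finset.sum_const, nsmul_eq_mul, freq, Set.ncard_coe_finset,
    div_eq_mul_one_div ((Set.toFinset B).card : ℝ), ENNReal.ofReal_mul (Nat.cast_nonneg _), ENNReal.ofReal_natCast]

/-- The half-open unit square. -/
def halfOpenSquare : Set Plane := {p | ∀ k, p k ∈ Set.Ico (0 : ℝ) 1}

/-- Half-open cells tile the half-open square exactly. A coordinate equal to 1 would wrap round to
index 0 under `Fin.ofNat`, but such points form a null set. -/
theorem halfOpenSquare_ae_eq_unitSquare : halfOpenSquare =ᵐ[volume] unitSquare := by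
  have h := (PiLp.volume_preserving_ofLp (Fin 2)).quasiMeasurePreserving.preimage_ae_eq
    (Measure.univ_pi_Ico_ae_eq_Icc (μ := fun _ : Fin 2 => (volume : Measure ℝ))
      (f := fun _ => 0) (g := fun _ => 1))
  have h1 : halfOpenSquare = WithLp.ofLp ⁻¹' Set.univ.pi fun _ : Fin 2 => Set.Ico (0 : ℝ) 1 := by
    ext p
    simp [halfOpenSquare]
  have h2 : unitSquare
      = WithLp.ofLp ⁻¹' Set.Icc (fun _ : Fin 2 => (0 : ℝ)) (fun _ : Fin 2 => (1 : ℝ)) := by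
    ext p
    simp [unitSquare, Pi.le_def, forall_and]
  rw [h1, h2]
  exact h

theorem uniformSquare_eq_restrict : uniformSquare = volume.restrict halfOpenSquare :=
  (Measure.restrict_congr_set halfOpenSquare_ae_eq_unitSquare).symm

theorem volume_rectangle (a b : Fin 2 → ℝ) :
    volume {p : Plane | ∀ k, p k ∈ Set.Ico (a k) (b k)} = ∏ k, ENNReal.ofReal (b k - a k) := by
  have h := (PiLp.volume_preserving_ofLp (Fin 2)).measure_preimage
    (s := Set.univ.pi fun k => Set.Ico (a k) (b k))
    (MeasurableSet.univ_pi fun k => measurableSet_Ico).nullMeasurableSet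
  rw [volume_pi_pi] at h
  simp_rw [Real.volume_Ico] at h
  rw [← h]
  congr 1
  ext p
  simp

theorem measurableSet_halfOpenSquare : MeasurableSet halfOpenSquare := by
  unfold halfOpenSquare
  measurability

instance isProbabilityMeasure_uniformSquare : IsProbabilityMeasure uniformSquare := by
  constructor
  rw [uniformSquare_eq_restrict, Measure.restrict_apply_univ]
  have := volume_rectangle (fun _ => 0) (fun _ => 1)
  simpa [halfOpenSquare] using this

/-- The cell of a grid with `M` columns and `N` rows that contains a point of the unit square. -/
noncomputable def cell (M N : ℕ) [NeZero M] [NeZero N] (p : Plane) : Fin M × Fin N :=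
  (Fin.ofNat M ⌊p 0 * M⌋₊, Fin.ofNat N ⌊p 1 * N⌋₊)

section Cell

variable {M N : ℕ} [NeZero M] [NeZero N]

theorem ofNat_floor_eq_iff {t : ℝ} (ht : t ∈ Set.Ico (0 : ℝ) 1) (c : Fin M) :
    Fin.ofNat M ⌊t * M⌋₊ = c ↔ ((c : ℕ) : ℝ) / M ≤ t ∧ t < (((c : ℕ) : ℝ) + 1) / M := by
  have hM : (0 : ℝ) < M := by exact_mod_cast NeZero.pos M
  have hlt : ⌊t * M⌋₊ < M := by
    rw [Nat.floor_lt (by have := ht.1; positivity)]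
    nlinarith [ht.2]
  rw [Fin.ext_iff, Fin.val_ofNat, Nat.mod_eq_of_lt hlt,
    Nat.floor_eq_iff (by have := ht.1; positivity), div_le_iff₀ hM, lt_div_iff₀ hM]

theorem cell_fst_bounds {p : Plane} (hp : p ∈ halfOpenSquare) :
    (((cell M N p).1 : ℕ) : ℝ) ≤ p 0 * M ∧ p 0 * M < ((cell M N p).1 : ℕ) + 1 := by
  have hM : (0 : ℝ) < M := by exact_mod_cast NeZero.pos M
  have := (ofNat_floor_eq_iff (hp 0) (cell M N p).1).1 rfl
  rwa [div_le_iff₀ hM, lt_div_iff₀ hM] at this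

theorem cell_snd_bounds {p : Plane} (hp : p ∈ halfOpenSquare) :
    (((cell M N p).2 : ℕ) : ℝ) ≤ p 1 * N ∧ p 1 * N < ((cell M N p).2 : ℕ) + 1 := by
  have hM : (0 : ℝ) < N := by exact_mod_cast NeZero.pos N
  have := (ofNat_floor_eq_iff (hp 1) (cell M N p).2).1 rfl
  rwa [div_le_iff₀ hM, lt_div_iff₀ hM] at this

theorem measurable_cell : Measurable (cell M N) := by
  have h : ∀ k : Fin 2, Measurable fun p : Plane => p k := fun k => by fun_prop
  refine Measurable.prodMk ?_ ?_
  · exact (Measurable.of_discrete (f := fun m : ℕ => Fin.ofNat M m)).comp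
      (Nat.measurable_floor.comp ((h 0).mul_const _))
  · exact (Measurable.of_discrete (f := fun m : ℕ => Fin.ofNat N m)).comp
      (Nat.measurable_floor.comp ((h 1).mul_const _))

theorem uniformSquare_cell_preimage_singleton (c : Fin M × Fin N) :
    uniformSquare (cell M N ⁻¹' {c}) = ENNReal.ofReal (1 / Fintype.card (Fin M × Fin N)) := by
  have hM : (0 : ℝ) < M := by exact_mod_cast NeZero.pos M
  have hN : (0 : ℝ) < N := by exact_mod_cast NeZero.pos N
  rw [uniformSquare_eq_restrict, Measure.restrict_apply (measurable_cell (measurableSet_singleton c))]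
  have hset : cell M N ⁻¹' {c} ∩ halfOpenSquare = {p : Plane | ∀ k, p k ∈
      Set.Ico ((![((c.1 : ℕ) : ℝ) / M, ((c.2 : ℕ) : ℝ) / N]) k)
        ((![(((c.1 : ℕ) : ℝ) + 1) / M, (((c.2 : ℕ) : ℝ) + 1) / N]) k)} := by
    ext p
    constructor
    · rintro ⟨h, hp⟩
      have h : cell M N p = c := h
      rw [Prod.ext_iff] at h
      have h1 := (ofNat_floor_eq_iff (hp 0) c.1).1 h.1
      have h2 := (ofNat_floor_eq_iff (hp 1) c.2).1 h.2
      intro k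
      fin_cases k
      · simpa using h1
      · simpa using h2
    · intro h
      have h1 : p 0 ∈ Set.Ico (((c.1 : ℕ) : ℝ) / M) ((((c.1 : ℕ) : ℝ) + 1) / M) := by
        simpa using h 0
      have h2 : p 1 ∈ Set.Ico (((c.2 : ℕ) : ℝ) / N) ((((c.2 : ℕ) : ℝ) + 1) / N) := by
        simpa using h 1
      have hp0 : p 0 ∈ Set.Ico (0 : ℝ) 1 := by
        refine ⟨le_trans (by positivity) h1.1, h1.2.trans_le ?_⟩
        rw [div_le_one hM]; exact_mod_cast c.1.2
      have hp1 : p 1 ∈ Set.Ico (0 : ℝ) 1 := by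
        refine ⟨le_trans (by positivity) h2.1, h2.2.trans_le ?_⟩
        rw [div_le_one hN]; exact_mod_cast c.2.2
      refine ⟨?_, ?_⟩
      · show cell M N p = c
        exact Prod.ext ((ofNat_floor_eq_iff hp0 _).2 h1) ((ofNat_floor_eq_iff hp1 _).2 h2)
      · intro k
        fin_cases k
        · exact hp0
        · exact hp1
  rw [hset, volume_rectangle, Fin.prod_univ_two, ← ENNReal.ofReal_mul]
  · congr 1
    simp
    field_simp
    ring
  · simp
    field_simp
    linarith

/-- The grid cells of independent uniform points of the unit square are independent and uniform. -/
theorem pi_uniformSquare_cell_preimage {ι : Type*} [Fintype ι] [DecidableEq ι]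
    (B : Set (ι → Fin M × Fin N)) :
    Measure.pi (fun _ : ι => uniformSquare) {x | (fun i => cell M N (x i)) ∈ B}
      = ENNReal.ofReal (freq B) := by
  have : IsProbabilityMeasure (uniformSquare.map (cell M N)) :=
    Measure.isProbabilityMeasure_map measurable_cell.aemeasurable
  have hmp : MeasurePreserving (fun (x : ι → Plane) i => cell M N (x i))
      (Measure.pi fun _ : ι => uniformSquare)
      (Measure.pi fun _ : ι => uniformSquare.map (cell M N)) :=
    measurePreserving_pi _ _ fun _ => ⟨measurable_cell, rfl⟩
  rw [← pi_apply_eq_freq (fun _ : ι => uniformSquare.map (cell M N)), ← hmp.measure_preimage]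
  · rfl
  · exact B.toFinite.measurableSet.nullMeasurableSet
  · intro _ c
    rw [Measure.map_apply measurable_cell (measurableSet_singleton c),
      uniformSquare_cell_preimage_singleton]

theorem ae_mem_halfOpenSquare {ι : Type*} [Fintype ι] :
    ∀ᵐ x ∂(Measure.pi fun _ : ι => uniformSquare), ∀ i, x i ∈ halfOpenSquare := by
  rw [eventually_countable_forall]
  intro i
  refine (Measure.quasiMeasurePreserving_eval (μ := fun _ : ι => uniformSquare) i).ae ?_
  rw [uniformSquare_eq_restrict]
  exact ae_restrict_mem measurableSet_halfOpenSquare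

end Cell

/-- Fubini, with the positions outside. Neither `E` nor `H` is known to be measurable, so both are
replaced by measurable hulls: this leaves the measure of each unchanged and keeps points outside the
hull of `H` outside `H`. -/
theorem le_modelLaw {n : ℕ} (hn : 2 ≤ n) {E : Set (Outcome n)} {H : Set (Fin n → Plane)} {η δ : ℝ}
    (hH : Measure.pi (fun _ : Fin n => uniformSquare) H ≤ ENNReal.ofReal η)
    (hE : ∀ x ∉ H, freq {χ | (x, χ) ∉ E} ≤ δ) :
    ENNReal.ofReal (1 - δ) * (1 - ENNReal.ofReal η) ≤ modelLaw n E := by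
  classical
  have : Nonempty (Fin (n - 1)) := ⟨⟨0, by omega⟩⟩
  set P : Measure (Fin n → Plane) := Measure.pi fun _ => uniformSquare
  set Q : Measure (KnEdge n → Fin (n - 1)) :=
    Measure.pi fun _ => ProbabilityTheory.uniformOn (Set.univ : Set (Fin (n - 1))) with hQ
  have huni : IsProbabilityMeasure
      (ProbabilityTheory.uniformOn (Set.univ : Set (Fin (n - 1)))) :=
    ProbabilityTheory.isProbabilityMeasure_uniformOn Set.finite_univ Set.univ_nonempty
  have hQf : ∀ B, Q B = ENNReal.ofReal (freq B) := by
    intro B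
    rw [hQ, pi_apply_eq_freq]
    intro _ c
    rw [ProbabilityTheory.uniformOn_univ, Measure.count_singleton, ENNReal.ofReal_div_of_pos
      (by exact_mod_cast Fintype.card_pos)]
    simp
  have hmodel : modelLaw n = P.prod Q := rfl
  rw [← measure_toMeasurable, hmodel, Measure.prod_apply (measurableSet_toMeasurable _ _)]
  set G : Set (Fin n → Plane) := (toMeasurable P H)ᶜ
  have hG : MeasurableSet G := (measurableSet_toMeasurable _ _).compl
  have hPG : 1 - ENNReal.ofReal η ≤ P G := by
    rw [prob_compl_eq_one_sub (measurableSet_toMeasurable _ _), measure_toMeasurable]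
    gcongr
  calc ENNReal.ofReal (1 - δ) * (1 - ENNReal.ofReal η)
      ≤ ENNReal.ofReal (1 - δ) * P G := by gcongr
    _ = ∫⁻ x, G.indicator (fun _ => ENNReal.ofReal (1 - δ)) x ∂P := by
        rw [lintegral_indicator_const hG]
    _ ≤ _ := by
        refine lintegral_mono fun x => ?_
        by_cases hx : x ∈ G
        · rw [Set.indicator_of_mem hx]
          have hxH : x ∉ H := fun h => hx (subset_toMeasurable _ _ h)
          refine le_trans ?_ (measure_mono
            (Set.preimage_mono (subset_toMeasurable ((P.prod Q)) E)))
          rw [hQf]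
          apply ENNReal.ofReal_le_ofReal
          have h1 := hE x hxH
          have h2 := freq_compl (Prod.mk x ⁻¹' E)
          have h3 : (Prod.mk x ⁻¹' E)ᶜ = {χ | (x, χ) ∉ E} := rfl
          rw [h3] at h2
          linarith
        · rw [Set.indicator_of_notMem hx]
          exact zero_le

theorem withHighProbability_of_freq {E : (n : ℕ) → Set (Outcome n)}
    {H : (n : ℕ) → Set (Fin n → Plane)} {η δ : ℕ → ℝ} 
    (hH : ∀ᶠ n in atTop, Measure.pi (fun _ : Fin n => uniformSquare) (H n) ≤ ENNReal.ofReal (η n))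
    (hE : ∀ᶠ n in atTop, ∀ x ∉ H n, freq {χ | (x, χ) ∉ E n} ≤ δ n)
    (hη : Tendsto η atTop (𝓝 0)) (hδ : Tendsto δ atTop (𝓝 0)) : WithHighProbability E := by
  have hlow : Tendsto (fun n => ENNReal.ofReal (1 - δ n) * (1 - ENNReal.ofReal (η n)))
      atTop (𝓝 1) := by
    have h1 : Tendsto (fun n => ENNReal.ofReal (1 - δ n)) atTop (𝓝 1) := by
      have := ENNReal.tendsto_ofReal (hδ.const_sub 1)
      simpa using this
    have h2 : Tendsto (fun n => 1 - ENNReal.ofReal (η n)) atTop (𝓝 1) := by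
      have h3 := ENNReal.tendsto_ofReal hη
      rw [ENNReal.ofReal_zero] at h3
      have := ENNReal.Tendsto.sub (tendsto_const_nhds (x := (1 : ENNReal)) (f := atTop)) h3
        (Or.inl ENNReal.one_ne_top)
      simpa using this
    have := ENNReal.Tendsto.mul h1 (Or.inl one_ne_zero) h2 (Or.inl one_ne_zero)
    simpa using this
  refine tendsto_of_tendsto_of_tendsto_of_le_of_le' hlow tendsto_const_nhds ?_ ?_
  · filter_upwards [hH, hE, eventually_ge_atTop 2] with n h1 h2 hn
    exact le_modelLaw hn h1 h2
  · filter_upwards [eventually_ge_atTop 2] with n hn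
    have : Nonempty (Fin (n - 1)) := ⟨⟨0, by omega⟩⟩
    have huni : IsProbabilityMeasure
        (ProbabilityTheory.uniformOn (Set.univ : Set (Fin (n - 1)))) :=
      ProbabilityTheory.isProbabilityMeasure_uniformOn Set.finite_univ Set.univ_nonempty
    have : IsProbabilityMeasure (modelLaw n) := by unfold modelLaw; infer_instance
    exact prob_le_one

/-! ### Rainbow forests and their greedy extension -/

/-- The graph with edge set `F`. -/
def edgeGraph {n : ℕ} (F : Finset (KnEdge n)) : SimpleGraph (Fin n) :=
  SimpleGraph.fromEdgeSet (Subtype.val '' (F : Set (KnEdge n)))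

theorem edgeGraph_mono {n : ℕ} {F F' : Finset (KnEdge n)} (h : F ⊆ F') :
    edgeGraph F ≤ edgeGraph F' :=
  SimpleGraph.fromEdgeSet_mono (Set.image_mono (by exact_mod_cast h))

theorem edgeGraph_adj {n : ℕ} {F : Finset (KnEdge n)} {e : KnEdge n} (he : e ∈ F) {u v : Fin n}
    (h : e.1 = s(u, v)) : (edgeGraph F).Adj u v := by
  rw [edgeGraph, SimpleGraph.fromEdgeSet_adj]
  refine ⟨⟨e, he, h⟩, ?_⟩
  rintro rfl
  have := e.2
  rw [h] at this
  simp at this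

/-- The edge set `F` together with a labelling `f` of the vertices in `W` whose classes are
connected by the edges in `F`, with as few edges as possible. -/
structure Linked {n : ℕ} (W : Finset (Fin n)) (F : Finset (KnEdge n)) (f : Fin n → Fin n) :
    Prop where
  reachable : ∀ u ∈ W, ∀ v ∈ W, f u = f v → (edgeGraph F).Reachable u v
  card_add_card : F.card + (W.image f).card = W.card

namespace Linked

variable {n : ℕ} {W : Finset (Fin n)} {F : Finset (KnEdge n)} {f : Fin n → Fin n}

theorem empty (W : Finset (Fin n)) : Linked W ∅ id where
  reachable u _ v _ h := by
    have : u = v := h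
    rw [this]
  card_add_card := by simp

/-- Renaming the label of `u` to that of `v` removes exactly one label while one edge is added, so
the count behind the forest property is preserved. -/
theorem insert_edge (hL : Linked W F f) {u v : Fin n} (hu : u ∈ W) (hv : v ∈ W) (hne : f u ≠ f v)
    {e : KnEdge n} (he : e.1 = s(u, v)) (heF : e ∉ F) :
    Linked W (insert e F) (fun x => if f x = f u then f v else f x) := by
  have hadj : (edgeGraph (insert e F)).Adj u v := edgeGraph_adj (Finset.mem_insert_self e F) he
  have hr : ∀ x ∈ W, ∀ y ∈ W, f x = f y → (edgeGraph (insert e F)).Reachable x y :=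
    fun x hx y hy h => (hL.reachable x hx y hy h).mono (edgeGraph_mono (Finset.subset_insert e F))
  constructor
  · intro x hx y hy h
    by_cases h1 : f x = f u <;> by_cases h2 : f y = f u <;> simp only [h1, h2, if_true, if_false] at h
    · exact hr x hx y hy (h1.trans h2.symm)
    · exact (hr x hx u hu h1).trans (hadj.reachable.trans (hr v hv y hy h))
    · exact (hr x hx v hv h).trans (hadj.symm.reachable.trans (hr u hu y hy h2.symm))
    · exact hr x hx y hy h
  · have himg : W.image (fun x => if f x = f u then f v else f x) = (W.image f).erase (f u) := by
      ext a
      simp only [Finset.mem_image, Finset.mem_erase]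
      constructor
      · rintro ⟨x, hx, rfl⟩
        by_cases h : f x = f u
        · rw [if_pos h]; exact ⟨hne.symm, v, hv, rfl⟩
        · rw [if_neg h]; exact ⟨h, x, hx, rfl⟩
      · rintro ⟨ha, x, hx, rfl⟩
        exact ⟨x, hx, if_neg ha⟩
    have hmem : f u ∈ W.image f := Finset.mem_image_of_mem f hu
    rw [himg, Finset.card_insert_of_notMem heF, Finset.card_erase_of_mem hmem]
    have := hL.card_add_card
    have := Finset.card_pos.2 ⟨_, hmem⟩
    omega

variable {κ : Type*} [DecidableEq κ]

/-- Greedy extension of a rainbow edge set: whenever many labels are untouched and many colours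
unused, some edge from an untouched label has an unused colour. -/
theorem exists_rainbow_extension (hL : Linked W F f) {R : Finset (Fin n)} (hRW : R ⊆ W)
    (hinj : Set.InjOn f R) {Nb : Fin n → Finset (Fin n)}
    (hNb : ∀ v ∈ R, ∀ w ∈ Nb v, w ∈ W ∧ f w ≠ f v) {χ : KnEdge n → κ} {J₀ : Finset κ}
    (hF : ∀ e ∈ F, χ e ∉ J₀) (hχ : Set.InjOn χ F) {a b : ℝ}
    (hgood : ∀ S ⊆ R, a ≤ S.card → ∀ J ⊆ J₀, b ≤ J.card →
      ∃ v ∈ S, ∃ w ∈ Nb v, ∃ e : KnEdge n, e.1 = s(v, w) ∧ χ e ∈ J) (j : ℕ)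
    (hja : a + 2 * j ≤ R.card + 2) (hjb : b + j ≤ J₀.card + 1) :
    ∃ F' f', Linked W F' f' ∧ F ⊆ F' ∧ Set.InjOn χ F' ∧ F'.card = F.card + j ∧
      (∀ e ∈ F' \ F, ∃ v ∈ R, ∃ w ∈ Nb v, e.1 = s(v, w)) := by
  -- The induction also tracks the set `T` of original labels touched so far. A label outside `T` is
  -- still a class of its own, so an edge from it to another label always merges two classes. Each
  -- edge touches at most two labels and uses one colour of `J₀`; when the last of j edges is chosen
  -- only j - 1 precede it, whence the slack 2 and 1 in `hja` and `hjb`.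
  suffices ∃ F' f' T, Linked W F' f' ∧ F ⊆ F' ∧ Set.InjOn χ F' ∧ F'.card = F.card + j ∧
      (∀ e ∈ F' \ F, ∃ v ∈ R, ∃ w ∈ Nb v, e.1 = s(v, w)) ∧ (∀ e ∈ F' \ F, χ e ∈ J₀) ∧
      Finset.card T ≤ 2 * j ∧ ∀ x y, f x ∉ T → (f' y = f' x ↔ f y = f x) by
    obtain ⟨F', f', T, h1, h2, h3, h4, h5, -⟩ := this
    exact ⟨F', f', h1, h2, h3, h4, h5⟩
  induction j with
  | zero => exact ⟨F, f, ∅, hL, subset_rfl, hχ, rfl, by simp, by simp, by simp, by simp⟩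
  | succ j ih =>
    push_cast at hja hjb
    obtain ⟨F', f', T, hL', hFF', hχ', hcard, hedge, hcol, hT, hf'⟩ := ih (by linarith) (by linarith)
    have hS : a ≤ ((R.filter fun v => f v ∉ T).card : ℝ) := by
      have h1 := Finset.card_filter_add_card_filter_not (s := R) (fun v => f v ∈ T)
      -- Representatives carry different labels, so each touched label disables at most one of them.
      have h2 : (R.filter fun v => f v ∈ T).card ≤ T.card :=
        Finset.card_le_card_of_injOn f (by intro v hv; exact (Finset.mem_filter.1 hv).2)
          (hinj.mono (by intro v hv; exact (Finset.mem_filter.1 hv).1))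
      have h3 : (R.card : ℝ) ≤ 2 * j + (R.filter fun v => f v ∉ T).card := by
        have : R.card ≤ 2 * j + (R.filter fun v => f v ∉ T).card := by omega
        exact_mod_cast this
      linarith
    have hJ : b ≤ ((J₀ \ (F' \ F).image χ).card : ℝ) := by
      have h1 : ((F' \ F).image χ).card ≤ j := by
        refine Finset.card_image_le.trans ?_
        rw [Finset.card_sdiff_of_subset hFF']
        omega
      have h2 := Finset.le_card_sdiff ((F' \ F).image χ) J₀
      have h3 : (J₀.card : ℝ) ≤ (J₀ \ (F' \ F).image χ).card + j := by
        have : J₀.card ≤ (J₀ \ (F' \ F).image χ).card + j := by omega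
        exact_mod_cast this
      linarith
    obtain ⟨v, hv, w, hw, e, he, heJ⟩ := hgood _ (Finset.filter_subset _ _) hS _
      Finset.sdiff_subset hJ
    obtain ⟨hvR, hvT⟩ := Finset.mem_filter.1 hv
    obtain ⟨heJ₀, heim⟩ := Finset.mem_sdiff.1 heJ
    obtain ⟨hwW, hwv⟩ := hNb v hvR w hw
    have heF' : χ e ∉ F'.image χ := by
      intro h
      obtain ⟨e', he', h'⟩ := Finset.mem_image.1 h
      by_cases h'' : e' ∈ F
      · exact hF e' h'' (h' ▸ heJ₀)
      · exact heim (Finset.mem_image.2 ⟨e', Finset.mem_sdiff.2 ⟨he', h''⟩, h'⟩)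
    have heF : e ∉ F' := fun h => heF' (Finset.mem_image_of_mem χ h)
    have hvw : f' v ≠ f' w := fun h => hwv ((hf' v w hvT).1 h.symm)
    refine ⟨insert e F', _, insert (f v) (insert (f w) T),
      hL'.insert_edge (hRW hvR) hwW hvw he heF, hFF'.trans (Finset.subset_insert _ _), ?_, ?_, ?_,
      ?_, ?_, ?_⟩
    · rw [Finset.coe_insert, Set.injOn_insert (by exact_mod_cast heF)]
      refine ⟨hχ', ?_⟩
      rw [← Finset.coe_image]
      exact_mod_cast heF'
    · rw [Finset.card_insert_of_notMem heF, hcard, add_assoc]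
    · intro e' he'
      obtain ⟨h1, h2⟩ := Finset.mem_sdiff.1 he'
      rcases Finset.mem_insert.1 h1 with rfl | h1
      · exact ⟨v, hvR, w, hw, he⟩
      · exact hedge e' (Finset.mem_sdiff.2 ⟨h1, h2⟩)
    · intro e' he'
      obtain ⟨h1, h2⟩ := Finset.mem_sdiff.1 he'
      rcases Finset.mem_insert.1 h1 with rfl | h1
      · exact heJ₀
      · exact hcol e' (Finset.mem_sdiff.2 ⟨h1, h2⟩)
    · refine (Finset.card_insert_le _ _).trans ?_
      have := Finset.card_insert_le (f w) T
      omega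
    · intro x y hx
      simp only [Finset.mem_insert, not_or] at hx
      obtain ⟨hxv, hxw, hxT⟩ := hx
      have h1 : f' x ≠ f' v := fun h => hxv ((hf' x v hxT).1 h.symm).symm
      have h2 : f' w ≠ f' x := fun h => hxw ((hf' x w hxT).1 h).symm
      rw [if_neg h1, ← hf' x y hxT]
      by_cases h3 : f' y = f' v
      · rw [if_pos h3]
        exact ⟨fun h => absurd h h2, fun h => absurd (h.symm.trans h3) h1⟩
      · rw [if_neg h3]

end Linked

/-- The number of edges between the vertices in `S` and their neighbours. -/
theorem card_mul_le_two_mul_card_edges {n : ℕ} (S : Finset (Fin n)) (Nb : Fin n → Finset (Fin n))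
    (hne : ∀ v ∈ S, v ∉ Nb v) {d : ℝ} (hd : ∀ v ∈ S, d ≤ (Nb v).card) (A : Finset (KnEdge n))
    (hA : ∀ e : KnEdge n, (∃ v ∈ S, ∃ w ∈ Nb v, e.1 = s(v, w)) → e ∈ A) :
    S.card * d ≤ 2 * A.card := by
  classical
  -- An edge with both ends in `S` may be counted from each end, hence the factor 2.
  have h1 : (S.sigma fun v => Nb v).card ≤ 2 * ((S.sigma fun v => Nb v).image
      fun q => s(q.1, q.2)).card := by
    refine Finset.card_le_mul_card_image _ 2 fun z _ => ?_
    induction z using Sym2.ind with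
    | _ x y =>
      refine (Finset.card_le_card (t := {⟨x, y⟩, ⟨y, x⟩}) ?_).trans Finset.card_le_two
      rintro ⟨u, w⟩ hq
      have := (Finset.mem_filter.1 hq).2
      rcases Sym2.eq_iff.1 this with ⟨rfl, rfl⟩ | ⟨rfl, rfl⟩ <;> simp
  have h2 : ((S.sigma fun v => Nb v).image fun q => s(q.1, q.2)).card ≤ A.card := by
    rw [← Finset.card_image_of_injective A Subtype.val_injective]
    refine Finset.card_le_card ?_
    intro z hz
    obtain ⟨⟨v, w⟩, hq, rfl⟩ := Finset.mem_image.1 hz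
    obtain ⟨hv, hw⟩ := Finset.mem_sigma.1 hq
    have hvw : v ≠ w := by rintro rfl; exact hne v hv hw
    exact Finset.mem_image.2 ⟨⟨s(v, w), by simpa using hvw⟩, hA _ ⟨v, hv, w, hw, rfl⟩, rfl⟩
  have h3 : S.card * d ≤ (S.sigma fun v => Nb v).card := by
    rw [Finset.card_sigma, Nat.cast_sum, ← nsmul_eq_mul]
    exact Finset.card_nsmul_le_sum _ _ _ hd
  have h4 : ((S.sigma fun v => Nb v).card : ℝ) ≤ 2 * A.card := by exact_mod_cast h1.trans (by omega)
  exact h3.trans h4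

open Classical in
/-- With high probability any many vertices have an edge in any large set of colours. -/
theorem freq_not_forall_exists_edge_le {n : ℕ} {κ : Type*} [Fintype κ] [Nonempty κ]
    (D : Set (KnEdge n)) (φ : KnEdge n → κ) (R : Finset (Fin n)) (Nb : Fin n → Finset (Fin n))
    (hne : ∀ v ∈ R, v ∉ Nb v)
    (hD : ∀ v ∈ R, ∀ w ∈ Nb v, ∀ e : KnEdge n, e.1 = s(v, w) → e ∉ D) (J₀ : Finset κ)
    {a b d t : ℝ} (hb : 0 ≤ b) (hd₀ : 0 ≤ d) (hd : ∀ v ∈ R, d ≤ (Nb v).card)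
    (ht : 2 * t * Fintype.card κ ≤ a * d * b) :
    freq {ψ | ¬ ∀ S ⊆ R, a ≤ S.card → ∀ J ⊆ J₀, b ≤ J.card →
      ∃ v ∈ S, ∃ w ∈ Nb v, ∃ e : KnEdge n, e.1 = s(v, w) ∧ D.piecewise φ ψ e ∈ J}
      ≤ 2 ^ R.card * 2 ^ J₀.card * Real.exp (-t) := by
  let A : Finset (Fin n) → Finset (KnEdge n) := fun S =>
    Finset.univ.filter fun e => ∃ v ∈ S, ∃ w ∈ Nb v, e.1 = s(v, w)
  -- Union bound over all candidate pairs (S, J).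
  let I := (R.powerset ×ˢ J₀.powerset).filter fun q => a ≤ q.1.card ∧ b ≤ q.2.card
  have hI : (I.card : ℝ) ≤ 2 ^ R.card * 2 ^ J₀.card := by
    have : I.card ≤ 2 ^ R.card * 2 ^ J₀.card := by
      refine (Finset.card_filter_le _ _).trans ?_
      simp
    exact_mod_cast this
  refine (freq_mono (B := {ψ | ∃ q ∈ I, ψ ∈ {ψ : KnEdge n → κ | ∀ e ∈ A q.1, ψ e ∉ q.2}}) ?_).trans
    ((freq_biUnion_le_card_mul I _ (δ := Real.exp (-t)) ?_).trans (by gcongr))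
  · intro ψ hψ
    simp only [Set.mem_ofPred_eq] at hψ ⊢
    push Not at hψ
    obtain ⟨S, hS, haS, J, hJ, hbJ, h⟩ := hψ
    refine ⟨(S, J), by simp [I, hS, haS, hJ, hbJ], fun e he => ?_⟩
    obtain ⟨v, hv, w, hw, hvw⟩ := (Finset.mem_filter.1 he).2
    have := h v hv w hw e hvw
    -- The edges in question lie outside `D`, so their colours are fresh.
    rwa [Set.piecewise_eq_of_notMem _ _ _ (hD v (hS hv) w hw e hvw)] at this
  · rintro ⟨S, J⟩ hq
    simp only [I, Finset.mem_filter, Finset.mem_product, Finset.mem_powerset] at hq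
    obtain ⟨⟨hS, hJ⟩, haS, hbJ⟩ := hq
    refine freq_avoid_le_exp _ _ ?_
    have h1 := card_mul_le_two_mul_card_edges S Nb (fun v hv => hne v (hS hv))
      (fun v hv => hd v (hS hv)) (A S) (fun e he => Finset.mem_filter.2 ⟨Finset.mem_univ _, he⟩)
    have h2 : a * d * b ≤ (2 * (A S).card) * J.card := by
      have : a * d ≤ 2 * (A S).card := le_trans (by gcongr) h1
      gcongr
    linarith

/-- Most labels are represented by a vertex `v` such that many vertices in the cell paired with
the cell of `v` have another label. -/
theorem exists_representatives {n : ℕ} {β : Type*} [Fintype β] [DecidableEq β] (W : Finset (Fin n))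
    (f : Fin n → Fin n) (c : Fin n → β) (σ : β → β) (μ : ℝ) :
    ∃ R ⊆ W, Set.InjOn f R ∧
      (W.image f).card ≤ R.card + (W.filter fun v =>
        ((W.filter fun w => c w = σ (c v)).card : ℝ) < μ / 2).card + Fintype.card β ∧
      ∀ v ∈ R, μ / 4 ≤ (W.filter fun w => c w = σ (c v) ∧ f w ≠ f v).card := by
  classical
  have hr : ∀ a : Fin n, ∃ v, a ∈ W.image f → v ∈ W ∧ f v = a := by
    intro a
    by_cases h : a ∈ W.image f
    · obtain ⟨v, hv, h'⟩ := Finset.mem_image.1 h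
      exact ⟨v, fun _ => ⟨hv, h'⟩⟩
    · exact ⟨a, fun h' => absurd h' h⟩
  choose r hr using hr
  let bad := W.filter fun v => ((W.filter fun w => c w = σ (c v)).card : ℝ) < μ / 2
  -- A label is discarded if its chosen representative `r a` has a sparse partner cell, or if it
  -- holds more than half of some cell. For every other label at least half of the partner cell of
  -- its representative carries other labels.
  let Maj : Fin n → β → Prop := fun a b =>
    (W.filter fun w => c w = b).card < 2 * (W.filter fun w => c w = b ∧ f w = a).card
  let L₁ := (W.image f).filter fun a => r a ∈ bad
  let L₂ := (W.image f).filter fun a => ∃ b, Maj a b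
  let G := (W.image f).filter fun a => r a ∉ bad ∧ ¬ ∃ b, Maj a b
  have hrG : Set.InjOn r G := by
    intro a ha a' ha' h
    rw [← (hr a (Finset.mem_filter.1 ha).1).2, ← (hr a' (Finset.mem_filter.1 ha').1).2, h]
  have hL₁ : L₁.card ≤ bad.card := by
    refine Finset.card_le_card_of_injOn r (fun a ha => (Finset.mem_filter.1 ha).2) ?_
    intro a ha a' ha' h
    rw [← (hr a (Finset.mem_filter.1 ha).1).2, ← (hr a' (Finset.mem_filter.1 ha').1).2, h]
  have hL₂ : L₂.card ≤ Fintype.card β := by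
    have : ∀ a : L₂, ∃ b, Maj a b := fun a => (Finset.mem_filter.1 a.2).2
    choose g hg using this
    rw [← Fintype.card_coe L₂]
    refine Fintype.card_le_of_injective g ?_
    intro a a' h
    by_contra hne
    have h1 := hg a
    have h2 := hg a'
    rw [← h] at h2
    -- Two labels cannot both hold more than half of one cell, so majority labels inject into cells.
    have h3 : Disjoint (W.filter fun w => c w = g a ∧ f w = a)
        (W.filter fun w => c w = g a ∧ f w = a') := by
      rw [Finset.disjoint_filter]
      rintro w - ⟨-, h4⟩ ⟨-, h5⟩
      exact hne (Subtype.ext (h4.symm.trans h5))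
    have h4 : (W.filter fun w => c w = g a ∧ f w = a).card
        + (W.filter fun w => c w = g a ∧ f w = a').card ≤ (W.filter fun w => c w = g a).card := by
      rw [← Finset.card_union_of_disjoint h3]
      refine Finset.card_le_card ?_
      intro w
      simp only [Finset.mem_union, Finset.mem_filter]
      tauto
    simp only [Maj] at h1 h2
    omega
  refine ⟨G.image r, ?_, ?_, ?_, ?_⟩
  · intro v hv
    obtain ⟨a, ha, rfl⟩ := Finset.mem_image.1 hv
    exact (hr a (Finset.mem_filter.1 ha).1).1
  · intro v hv v' hv' h
    obtain ⟨a, ha, rfl⟩ := Finset.mem_image.1 hv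
    obtain ⟨a', ha', rfl⟩ := Finset.mem_image.1 hv'
    rw [(hr a (Finset.mem_filter.1 ha).1).2, (hr a' (Finset.mem_filter.1 ha').1).2] at h
    rw [h]
  · rw [Finset.card_image_of_injOn hrG]
    have : W.image f ⊆ G ∪ (L₁ ∪ L₂) := by
      intro a ha
      simp only [G, L₁, L₂, Finset.mem_union, Finset.mem_filter, ha, true_and]
      tauto
    have h1 := Finset.card_le_card this
    have h2 := Finset.card_union_le G (L₁ ∪ L₂)
    have h3 := Finset.card_union_le L₁ L₂
    show _ ≤ G.card + bad.card + _
    omega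
  · intro v hv
    obtain ⟨a, ha, rfl⟩ := Finset.mem_image.1 hv
    obtain ⟨haf, hb, hM⟩ := Finset.mem_filter.1 ha
    obtain ⟨hrW, hra⟩ := hr a haf
    rw [hra]
    have h1 : μ / 2 ≤ (W.filter fun w => c w = σ (c (r a))).card := by
      by_contra h
      exact hb (Finset.mem_filter.2 ⟨hrW, not_le.1 h⟩)
    have h2 : 2 * (W.filter fun w => c w = σ (c (r a)) ∧ f w = a).card
        ≤ (W.filter fun w => c w = σ (c (r a))).card :=
      not_lt.1 fun h => hM ⟨_, h⟩
    have h3 : (W.filter fun w => c w = σ (c (r a)) ∧ f w = a).card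
        + (W.filter fun w => c w = σ (c (r a)) ∧ f w ≠ a).card
        = (W.filter fun w => c w = σ (c (r a))).card := by
      rw [← Finset.filter_filter, ← Finset.filter_filter]
      exact Finset.card_filter_add_card_filter_not _
    have h4 : ((W.filter fun w => c w = σ (c (r a))).card : ℝ)
        ≤ 2 * (W.filter fun w => c w = σ (c (r a)) ∧ f w ≠ a).card := by
      have h5 : (W.filter fun w => c w = σ (c (r a))).card
          ≤ 2 * (W.filter fun w => c w = σ (c (r a)) ∧ f w ≠ a).card := by omega
      exact_mod_cast h5
    linarith

/-! ### One stage of merging -/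

/-- The colourings for which there are rainbow edges in `D`, of total length at most `L`,
that connect `W` up to at most `m` classes. -/
def forestEvent {n : ℕ} {κ : Type*} (W : Finset (Fin n)) (D : Set (KnEdge n))
    (len : KnEdge n → ℝ) (m L : ℝ) : Set (KnEdge n → κ) :=
  {χ | ∃ F f, Linked W F f ∧ (∀ e ∈ F, e ∈ D) ∧ Set.InjOn χ F ∧ ((W.image f).card : ℝ) ≤ m ∧
    ∑ e ∈ F, len e ≤ L}

section Stages

variable {n : ℕ} {κ : Type*} {W : Finset (Fin n)} {D D' : Set (KnEdge n)} {len : KnEdge n → ℝ}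

-- Since the forest uses only edges of `D`, the event is determined by their colours; this is what
-- `freq_diff_le_of_exposure` requires.
open Classical in
theorem mem_forestEvent_of_piecewise {m L : ℝ} {φ ψ : KnEdge n → κ}
    (h : D.piecewise φ ψ ∈ forestEvent W D len m L) : φ ∈ forestEvent W D len m L := by
  obtain ⟨F, f, h1, h2, h3, h4, h5⟩ := h
  refine ⟨F, f, h1, h2, fun e he e' he' hee => h3 he he' ?_, h4, h5⟩
  rwa [Set.piecewise_eq_of_mem _ _ _ (h2 e he), Set.piecewise_eq_of_mem _ _ _ (h2 e' he')]

variable [Fintype κ]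

/-- The colours not used by a linked rainbow edge set. -/
theorem Linked.card_unused [DecidableEq κ] {F : Finset (KnEdge n)} {f : Fin n → Fin n}
    (hL : Linked W F f) {χ : KnEdge n → κ} (hχ : Set.InjOn χ F) :
    (Finset.univ \ F.image χ).card + W.card = Fintype.card κ + (W.image f).card := by
  have h1 := Finset.card_sdiff_of_subset (Finset.subset_univ (F.image χ))
  rw [Finset.card_image_of_injOn hχ, Finset.card_univ] at h1
  have h2 : F.card ≤ Fintype.card κ := by
    rw [← Finset.card_image_of_injOn hχ]; exact Finset.card_le_univ _
  have := hL.card_add_card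
  omega

/-- One stage of the construction: the edges between paired cells reduce the number of classes by
a constant factor. -/
theorem freq_forestEvent_diff_le [Nonempty κ] {β : Type*} [Fintype β] [DecidableEq β]
    (c : Fin n → β) (σ : β → β) {m L ℓ μ : ℝ} (hm : 0 ≤ m) (hℓ : 0 ≤ ℓ)
    (hDD' : D ⊆ D') (hμ : 0 ≤ μ)
    (hedge : ∀ v ∈ W, ∀ w ∈ W, c w = σ (c v) → ∀ e : KnEdge n, e.1 = s(v, w) →
      e ∉ D ∧ e ∈ D' ∧ len e ≤ ℓ)
    (hW : W.card ≤ Fintype.card κ)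
    (hbad : ((W.filter fun v =>
      ((W.filter fun w => c w = σ (c v)).card : ℝ) < μ / 2).card : ℝ) ≤ m / 64)
    (hβ : (Fintype.card β : ℝ) ≤ m / 64) (hmμ : 2048 * Fintype.card κ ≤ m * μ) :
    freq (forestEvent (κ := κ) W D len m L \ forestEvent W D' len (9 / 16 * m) (L + m * ℓ))
      ≤ Real.exp (-m) := by
  classical
  refine freq_diff_le_of_exposure D (fun φ ψ h => mem_forestEvent_of_piecewise h) ?_
    (Real.exp_pos _).le
  rintro φ ⟨F, f, hL, hFD, hφ, hcard, hlen⟩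
  by_cases hsmall : ((W.image f).card : ℝ) ≤ 9 / 16 * m
  · have : {ψ | D.piecewise φ ψ ∉ forestEvent W D' len (9 / 16 * m) (L + m * ℓ)} = ∅ := by
      rw [Set.eq_empty_iff_forall_notMem]
      intro ψ h
      refine h ⟨F, f, hL, fun e he => hDD' (hFD e he), ?_, hsmall, ?_⟩
      · intro e he e' he' hee
        rw [Set.piecewise_eq_of_mem _ _ _ (hFD e he),
          Set.piecewise_eq_of_mem _ _ _ (hFD e' he')] at hee
        exact hφ he he' hee
      · have : 0 ≤ m * ℓ := by positivity
        linarith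
    rw [this, freq_empty]
    positivity
  rw [not_le] at hsmall
  obtain ⟨R, hRW, hinj, hRcard, hRNb⟩ := exists_representatives W f c σ μ
  set c₀ := (W.image f).card with hc₀
  -- The forest has |W| - c₀ edges and there are at least |W| colours, so at least c₀ are unused.
  -- Keeping exactly c₀ of them limits the union bound to 2^c₀ sets of colours.
  obtain ⟨J₀, hJ₀, hJ₀card⟩ : ∃ J₀ ⊆ Finset.univ \ F.image φ, J₀.card = c₀ := by
    apply Finset.exists_subset_card_eq
    have := hL.card_unused hφ
    omega
  let Nb : Fin n → Finset (Fin n) := fun v => W.filter fun w => c w = σ (c v) ∧ f w ≠ f v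
  have hR₀ : R.card ≤ c₀ := by
    rw [← Finset.card_image_of_injOn hinj]
    exact Finset.card_le_card (Finset.image_subset_image hRW)
  -- With these values the condition on `t` reads 16 m |κ| ≤ (m/16)(μ/4)(m/2), which is `hmμ`; exp
  -- (-8m) then outweighs the 2^m · 2^m choices.
  have hprob := freq_not_forall_exists_edge_le D φ R Nb
    (fun v hv h => (Finset.mem_filter.1 h).2.2 rfl)
    (fun v hv w hw e he => by
      obtain ⟨h1, h2, -⟩ := Finset.mem_filter.1 hw
      exact (hedge v (hRW hv) w h1 h2 e he).1) J₀ (a := m / 16) (b := m / 2) (d := μ / 4)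
    (t := 8 * m) (by positivity) (by positivity) hRNb (by nlinarith)
  refine (freq_mono ?_).trans (hprob.trans ?_)
  · intro ψ hψ hgood
    apply hψ
    have hfl : ⌊9 / 16 * m⌋₊ ≤ c₀ := by
      have := Nat.floor_le (show (0 : ℝ) ≤ 9 / 16 * m by positivity)
      exact_mod_cast (this.trans hsmall.le)
    have hfl' := Nat.lt_floor_add_one (9 / 16 * m)
    have hRc : (c₀ : ℝ) ≤ R.card + m / 64 + m / 64 := by
      have : (c₀ : ℝ) ≤ R.card + (W.filter fun v =>
        ((W.filter fun w => c w = σ (c v)).card : ℝ) < μ / 2).card + Fintype.card β := by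
        exact_mod_cast hRcard
      linarith
    have hpw : ∀ e ∈ F, D.piecewise φ ψ e = φ e :=
      fun e he => Set.piecewise_eq_of_mem _ _ _ (hFD e he)
    -- An added edge uses up two labels, so the greedy choice could at best halve the number of
    -- classes; 9/16 leaves room for the m/32 discarded labels and the m/16 representatives that
    -- must remain: 1 + 1/32 + 1/16 ≤ 2 · 9/16.
    obtain ⟨F', f', hL', hFF', hχ', hcard', hedge'⟩ := hL.exists_rainbow_extension hRW hinj
      (Nb := Nb) (fun v hv w hw => ⟨(Finset.mem_filter.1 hw).1, (Finset.mem_filter.1 hw).2.2⟩)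
      (χ := D.piecewise φ ψ) (J₀ := J₀) (fun e he h => by
        rw [hpw e he] at h
        exact (Finset.mem_sdiff.1 (hJ₀ h)).2 (Finset.mem_image_of_mem _ he))
      (fun e he e' he' hee => by
        rw [hpw e he, hpw e' he'] at hee
        exact hφ he he' hee) hgood (c₀ - ⌊9 / 16 * m⌋₊)
      (by rw [Nat.cast_sub hfl]; linarith) (by rw [Nat.cast_sub hfl, hJ₀card]; linarith)
    have hnew : ∀ e ∈ F' \ F, e ∈ D' ∧ len e ≤ ℓ := by
      intro e he
      obtain ⟨v, hv, w, hw, h⟩ := hedge' e he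
      obtain ⟨h1, h2, -⟩ := Finset.mem_filter.1 hw
      exact (hedge v (hRW hv) w h1 h2 e h).2
    refine ⟨F', f', hL', ?_, hχ', ?_, ?_⟩
    · intro e he
      by_cases h : e ∈ F
      · exact hDD' (hFD e h)
      · exact (hnew e (Finset.mem_sdiff.2 ⟨he, h⟩)).1
    · have h1 := hL'.card_add_card
      have h2 := hL.card_add_card
      have h3 : (W.image f').card = ⌊9 / 16 * m⌋₊ := by omega
      rw [h3]
      exact Nat.floor_le (by positivity)
    · rw [← Finset.sum_sdiff hFF']
      have h1 : ∑ e ∈ F' \ F, len e ≤ m * ℓ := by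
        refine (Finset.sum_le_card_nsmul _ _ ℓ fun e he => (hnew e he).2).trans ?_
        rw [nsmul_eq_mul]
        gcongr
        refine le_trans ?_ hcard
        rw [Finset.card_sdiff_of_subset hFF']
        exact_mod_cast (by omega)
      linarith
  · have h2 : ∀ k : ℕ, (k : ℝ) ≤ m → (2 : ℝ) ^ k ≤ Real.exp m := by
      intro k hk
      calc (2 : ℝ) ^ k ≤ Real.exp 1 ^ k := by
            gcongr
            linarith [Real.add_one_le_exp (1 : ℝ)]
        _ = Real.exp k := by rw [← Real.exp_nat_mul, mul_one]
        _ ≤ _ := Real.exp_le_exp.2 hk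
    have h3 : (R.card : ℝ) ≤ m := le_trans (by exact_mod_cast hR₀) hcard
    calc (2 : ℝ) ^ R.card * 2 ^ J₀.card * Real.exp (-(8 * m))
        ≤ Real.exp m * Real.exp m * Real.exp (-(8 * m)) := by
          gcongr
          · exact h2 _ h3
          · exact h2 _ (by rw [hJ₀card]; exact hcard)
      _ = Real.exp (-(6 * m)) := by rw [← Real.exp_add, ← Real.exp_add]; ring_nf
      _ ≤ _ := Real.exp_le_exp.2 (by linarith)

end Stages

/-! ### Joining the last classes through cuts -/

section Connect

variable {n : ℕ} {κ : Type*} {W : Finset (Fin n)}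

/-- If every block of unused colours appears on every cut, the classes can be merged one by one. -/
theorem Linked.exists_extension_of_cuts [DecidableEq κ] {F : Finset (KnEdge n)} {f : Fin n → Fin n}
    (hL : Linked W F f) {χ : KnEdge n → κ} (hχ : Set.InjOn χ F) {J : ℕ → Finset κ}
    (hJ : ∀ i j, i ≠ j → Disjoint (J i) (J j)) (hF : ∀ e ∈ F, ∀ i, χ e ∉ J i)
    {A : Set (KnEdge n)}
    (hcut : ∀ Y ⊆ W.image f, Y.Nonempty → Y ≠ W.image f → ∀ i < (W.image f).card,
      ∃ u ∈ W, ∃ v ∈ W, f u ∈ Y ∧ f v ∉ Y ∧ ∃ e : KnEdge n, e.1 = s(u, v) ∧ e ∈ A ∧ χ e ∈ J i)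
    (j : ℕ) (hj : j < (W.image f).card) :
    ∃ F' f', Linked W F' f' ∧ F ⊆ F' ∧ Set.InjOn χ F' ∧ F'.card = F.card + j ∧
      ∀ e ∈ F' \ F, e ∈ A := by
  -- The merge with index i takes its colour from the block `J i`, so colours never repeat; moreover
  -- `f'` stays coarser than `f`.
  suffices ∃ F' f', Linked W F' f' ∧ F ⊆ F' ∧ Set.InjOn χ F' ∧ F'.card = F.card + j ∧
      (∀ e ∈ F' \ F, e ∈ A) ∧ (∀ e ∈ F' \ F, ∃ i < j, χ e ∈ J i) ∧
      ∀ x ∈ W, ∀ y ∈ W, f x = f y → f' x = f' y by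
    obtain ⟨F', f', h1, h2, h3, h4, h5, -⟩ := this
    exact ⟨F', f', h1, h2, h3, h4, h5⟩
  induction j with
  | zero => exact ⟨F, f, hL, subset_rfl, hχ, rfl, by simp, by simp, fun _ _ _ _ h => h⟩
  | succ j ih =>
    obtain ⟨F', f', hL', hFF', hχ', hcard, hedge, hcol, hf'⟩ := ih (by omega)
    have h2 : 1 < (W.image f').card := by
      have := hL'.card_add_card
      have := hL.card_add_card
      omega
    obtain ⟨a, ha, b, hb, hab⟩ := Finset.one_lt_card.1 h2
    obtain ⟨x₁, hx₁, rfl⟩ := Finset.mem_image.1 ha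
    obtain ⟨x₂, hx₂, rfl⟩ := Finset.mem_image.1 hb
    -- A current class is a union of original classes. Only cuts of the original labels matter, and
    -- these are fixed before the new colours are exposed.
    let Y := (W.filter fun x => f' x = f' x₁).image f
    have hY : ∀ x ∈ W, f x ∈ Y ↔ f' x = f' x₁ := by
      intro x hx
      constructor
      · intro h
        obtain ⟨y, hy, hyx⟩ := Finset.mem_image.1 h
        obtain ⟨hyW, hy⟩ := Finset.mem_filter.1 hy
        rw [← hf' y hyW x hx hyx, hy]
      · intro h
        exact Finset.mem_image_of_mem f (Finset.mem_filter.2 ⟨hx, h⟩)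
    obtain ⟨u, hu, v, hv, huY, hvY, e, he, heA, heJ⟩ := hcut Y
      (Finset.image_subset_image (Finset.filter_subset _ _)) ⟨f x₁, (hY x₁ hx₁).2 rfl⟩
      (fun h => hab ((hY x₂ hx₂).1 (h ▸ Finset.mem_image_of_mem f hx₂)).symm) j (by omega)
    rw [hY u hu] at huY
    rw [hY v hv] at hvY
    have heF' : χ e ∉ F'.image χ := by
      intro h
      obtain ⟨e', he', h'⟩ := Finset.mem_image.1 h
      by_cases h'' : e' ∈ F
      · exact hF e' h'' j (h' ▸ heJ)
      · obtain ⟨i, hi, h3⟩ := hcol e' (Finset.mem_sdiff.2 ⟨he', h''⟩)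
        rw [h'] at h3
        exact Finset.disjoint_left.1 (hJ i j hi.ne) h3 heJ
    have heF : e ∉ F' := fun h => heF' (Finset.mem_image_of_mem χ h)
    refine ⟨insert e F', _, hL'.insert_edge hu hv (fun h => hvY (h ▸ huY)) he heF,
      hFF'.trans (Finset.subset_insert _ _), ?_, ?_, ?_, ?_, ?_⟩
    · rw [Finset.coe_insert, Set.injOn_insert (by exact_mod_cast heF)]
      refine ⟨hχ', ?_⟩
      rw [← Finset.coe_image]
      exact_mod_cast heF'
    · rw [Finset.card_insert_of_notMem heF, hcard, add_assoc]
    · intro e' he'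
      obtain ⟨h1, h2⟩ := Finset.mem_sdiff.1 he'
      rcases Finset.mem_insert.1 h1 with rfl | h1
      · exact heA
      · exact hedge e' (Finset.mem_sdiff.2 ⟨h1, h2⟩)
    · intro e' he'
      obtain ⟨h1, h2⟩ := Finset.mem_sdiff.1 he'
      rcases Finset.mem_insert.1 h1 with rfl | h1
      · exact ⟨j, by omega, heJ⟩
      · obtain ⟨i, hi, h3⟩ := hcol e' (Finset.mem_sdiff.2 ⟨h1, h2⟩)
        exact ⟨i, by omega, h3⟩
    · intro x hx y hy hxy
      simp only [hf' x hx y hy hxy]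

/-- A complete bipartite graph is highly edge-connected. -/
theorem exists_crossing_edges {A B : Finset (Fin n)} (hAB : Disjoint A B)
    {X : Finset (Fin n)} (hX : ∃ u ∈ A ∪ B, u ∈ X) (hX' : ∃ v ∈ A ∪ B, v ∉ X) {k : ℕ}
    (hA : k ≤ A.card) (hB : k ≤ B.card) (hk : 0 < k) (E : Finset (KnEdge n))
    (hE : ∀ u ∈ A, ∀ v ∈ B, ¬ (u ∈ X ↔ v ∈ X) → ∀ e : KnEdge n, e.1 = s(u, v) → e ∈ E) :
    k ≤ E.card := by
  classical
  have hne : ∀ u ∈ A, ∀ v ∈ B, u ≠ v := fun u hu v hv h => Finset.disjoint_left.1 hAB hu (h ▸ hv)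
  obtain ⟨a₀, ha₀⟩ := Finset.card_pos.1 (hk.trans_le hA)
  obtain ⟨b₀, hb₀⟩ := Finset.card_pos.1 (hk.trans_le hB)
  -- If both alternatives failed, some a ∈ A would be on the same side as all of `B` and some b ∈ B
  -- on the same side as all of `A`, so `X` would not separate A ∪ B. Either alternative gives
  -- distinct crossing edges for the vertices of one part.
  suffices (∀ u ∈ A, ∃ v ∈ B, ¬ (u ∈ X ↔ v ∈ X)) ∨ (∀ v ∈ B, ∃ u ∈ A, ¬ (u ∈ X ↔ v ∈ X)) by
    rcases this with h | h
    · refine hA.trans ?_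
      choose! g hgB hg using h
      rw [← Finset.card_image_of_injective E Subtype.val_injective]
      refine Finset.card_le_card_of_injOn (fun u => s(u, g u)) ?_ ?_
      · intro u hu
        exact Finset.mem_coe.2 (Finset.mem_image.2 ⟨⟨s(u, g u), by
          simpa using hne u hu _ (hgB u hu)⟩, hE u hu _ (hgB u hu) (hg u hu) _ rfl, rfl⟩)
      · intro u hu u' hu' h
        rcases Sym2.eq_iff.1 h with ⟨h1, -⟩ | ⟨h1, -⟩
        · exact h1
        · exact absurd h1 (hne u hu _ (hgB u' hu'))
    · refine hB.trans ?_
      choose! g hgA hg using h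
      rw [← Finset.card_image_of_injective E Subtype.val_injective]
      refine Finset.card_le_card_of_injOn (fun v => s(g v, v)) ?_ ?_
      · intro v hv
        exact Finset.mem_coe.2 (Finset.mem_image.2 ⟨⟨s(g v, v), by
          simpa using hne _ (hgA v hv) v hv⟩, hE _ (hgA v hv) v hv (hg v hv) _ rfl, rfl⟩)
      · intro v hv v' hv' h
        rcases Sym2.eq_iff.1 h with ⟨-, h1⟩ | ⟨h1, -⟩
        · exact h1
        · exact absurd h1 (hne _ (hgA v hv) _ hv')
  by_contra hcon
  push Not at hcon
  obtain ⟨⟨a, ha, h1⟩, b, hb, h2⟩ := hcon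
  have hiff : ∀ w ∈ A ∪ B, (w ∈ X ↔ a ∈ X) := by
    intro w hw
    rcases Finset.mem_union.1 hw with hw | hw
    · rw [h2 w hw, ← h1 b hb]
    · exact (h1 w hw).symm
  obtain ⟨u, hu, huX⟩ := hX
  obtain ⟨v, hv, hvX⟩ := hX'
  exact hvX ((hiff v hv).2 ((hiff u hu).1 huX))

variable {D D' : Set (KnEdge n)} {len : KnEdge n → ℝ} [Fintype κ]

/-- The final connecting stage: a small number of classes can be merged into one when there is a
surplus of colours. -/
theorem freq_forestEvent_connect_le [Nonempty κ] {A B : Finset (Fin n)} (hAB : Disjoint A B)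
    (hW : A ∪ B = W) {M b k : ℕ} {L ℓ : ℝ} (hk : 0 < k) (hA : k ≤ A.card) (hB : k ≤ B.card)
    (hℓ : 0 ≤ ℓ) (hDD' : D ⊆ D')
    (hedge : ∀ u ∈ A, ∀ v ∈ B, ∀ e : KnEdge n, e.1 = s(u, v) → e ∉ D ∧ e ∈ D' ∧ len e ≤ ℓ)
    (hcol : W.card + M * b ≤ Fintype.card κ + 1) {t : ℝ} (ht : t * Fintype.card κ ≤ k * b) :
    freq (forestEvent (κ := κ) W D len M L \ forestEvent W D' len 1 (L + M * ℓ))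
      ≤ 2 ^ M * M * Real.exp (-t) := by
  classical
  refine freq_diff_le_of_exposure D (fun φ ψ h => mem_forestEvent_of_piecewise h) ?_
    (by positivity)
  rintro φ ⟨F, f, hL, hFD, hφ, hcard, hlen⟩
  have hcard' : (W.image f).card ≤ M := by exact_mod_cast hcard
  have hpos : 0 < (W.image f).card := by
    rw [Finset.card_pos, Finset.image_nonempty, ← hW]
    exact (Finset.card_pos.1 (hk.trans_le hA)).mono Finset.subset_union_left
  set c₀ := (W.image f).card with hc₀
  -- There are |κ| + c₀ - |W| unused colours, and c₀ ≥ 1 makes up for the 1 in `hcol`.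
  obtain ⟨U, hU, hUcard⟩ : ∃ U ⊆ Finset.univ \ F.image φ, U.card = M * b := by
    apply Finset.exists_subset_card_eq
    have := hL.card_unused hφ
    omega
  obtain ⟨g⟩ : Nonempty (U ≃ Fin M × Fin b) := by
    rw [← Fintype.card_eq]; simp [hUcard]
  -- The colours of `U` are cut into M disjoint blocks of b, one for each possible merge.
  let J : ℕ → Finset κ := fun i => (Finset.univ.filter fun x : U => ((g x).1 : ℕ) = i).map
    (Function.Embedding.subtype _)
  have hJU : ∀ i, ∀ c ∈ J i, c ∈ U := by
    intro i c hc
    obtain ⟨x, -, rfl⟩ := Finset.mem_map.1 hc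
    exact x.2
  have hJcard : ∀ i < M, (J i).card = b := by
    intro i hi
    rw [Finset.card_map, ← Finset.card_map g.toEmbedding]
    have : (Finset.univ.filter fun x : U => ((g x).1 : ℕ) = i).map g.toEmbedding
        = {(⟨i, hi⟩ : Fin M)} ×ˢ (Finset.univ : Finset (Fin b)) := by
      ext q
      simp only [Finset.mem_map_equiv, Finset.mem_filter, Finset.mem_univ, true_and,
        Equiv.apply_symm_apply, Finset.mem_product, Finset.mem_singleton, and_true]
      exact ⟨fun h => Fin.ext h, fun h => by rw [h]⟩
    rw [this]; simp
  have hJdisj : ∀ i j, i ≠ j → Disjoint (J i) (J j) := by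
    intro i j hij
    rw [Finset.disjoint_left]
    intro c hc hc'
    obtain ⟨x, hx, rfl⟩ := Finset.mem_map.1 hc
    obtain ⟨y, hy, hxy⟩ := Finset.mem_map.1 hc'
    have : y = x := Subtype.ext hxy
    subst this
    exact hij ((Finset.mem_filter.1 hx).2.symm.trans (Finset.mem_filter.1 hy).2)
  let S : Set (KnEdge n) := {e | ∃ u ∈ A, ∃ v ∈ B, e.1 = s(u, v)}
  let C : Finset (Fin n) → Finset (KnEdge n) := fun Y => Finset.univ.filter fun e =>
    ∃ u ∈ A, ∃ v ∈ B, ¬ (f u ∈ Y ↔ f v ∈ Y) ∧ e.1 = s(u, v)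
  let I := ((W.image f).powerset.filter fun Y => Y.Nonempty ∧ Y ≠ W.image f) ×ˢ Finset.range c₀
  have hIcard : (I.card : ℝ) ≤ 2 ^ M * M := by
    have : I.card ≤ 2 ^ M * M := by
      rw [Finset.card_product, Finset.card_range]
      refine Nat.mul_le_mul ((Finset.card_filter_le _ _).trans ?_) hcard'
      rw [Finset.card_powerset]
      exact Nat.pow_le_pow_right (by norm_num) hcard'
    exact_mod_cast this
  refine (freq_mono (B := {ψ | ∃ q ∈ I, ψ ∈ {ψ : KnEdge n → κ | ∀ e ∈ C q.1, ψ e ∉ J q.2}}) ?_).trans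
    ((freq_biUnion_le_card_mul I _ (δ := Real.exp (-t)) ?_).trans (by gcongr))
  · intro ψ hψ
    by_contra hgood
    simp only [Set.mem_ofPred_eq] at hgood
    push Not at hgood
    apply hψ
    have hpw : ∀ e ∈ F, D.piecewise φ ψ e = φ e :=
      fun e he => Set.piecewise_eq_of_mem _ _ _ (hFD e he)
    obtain ⟨F', f', hL', hFF', hχ', hcardF, hedge'⟩ := hL.exists_extension_of_cuts
      (χ := D.piecewise φ ψ) (fun e he e' he' hee => by
        rw [hpw e he, hpw e' he'] at hee
        exact hφ he he' hee) hJdisj (fun e he i h => by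
        rw [hpw e he] at h
        exact (Finset.mem_sdiff.1 (hU (hJU i _ h))).2 (Finset.mem_image_of_mem _ he)) (A := S)
      (fun Y hY hY₁ hY₂ i hi => by
        obtain ⟨e, he, heJ⟩ := hgood (Y, i) (by
          simp only [I, Finset.mem_product, Finset.mem_filter, Finset.mem_powerset,
            Finset.mem_range]
          exact ⟨⟨hY, hY₁, hY₂⟩, hi⟩)
        obtain ⟨u, hu, v, hv, huv, he⟩ := (Finset.mem_filter.1 he).2
        have hpe : D.piecewise φ ψ e = ψ e :=
          Set.piecewise_eq_of_notMem _ _ _ (hedge u hu v hv e he).1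
        have huW : u ∈ W := hW ▸ Finset.mem_union_left _ hu
        have hvW : v ∈ W := hW ▸ Finset.mem_union_right _ hv
        by_cases h : f u ∈ Y
        · exact ⟨u, huW, v, hvW, h, by tauto, e, he, ⟨u, hu, v, hv, he⟩, hpe ▸ heJ⟩
        · exact ⟨v, hvW, u, huW, by tauto, h, e, he.trans Sym2.eq_swap, ⟨u, hu, v, hv, he⟩,
            hpe ▸ heJ⟩) (c₀ - 1) (by omega)
    refine ⟨F', f', hL', ?_, hχ', ?_, ?_⟩
    · intro e he
      by_cases h : e ∈ F
      · exact hDD' (hFD e h)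
      · obtain ⟨u, hu, v, hv, h'⟩ := hedge' e (Finset.mem_sdiff.2 ⟨he, h⟩)
        exact (hedge u hu v hv e h').2.1
    · have h1 := hL'.card_add_card
      have h2 := hL.card_add_card
      have h3 : (W.image f').card = 1 := by omega
      rw [h3]; simp
    · rw [← Finset.sum_sdiff hFF']
      have h1 : ∑ e ∈ F' \ F, len e ≤ M * ℓ := by
        refine (Finset.sum_le_card_nsmul _ _ ℓ fun e he => ?_).trans ?_
        · obtain ⟨u, hu, v, hv, h'⟩ := hedge' e he
          exact (hedge u hu v hv e h').2.2
        rw [nsmul_eq_mul]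
        gcongr
        rw [Finset.card_sdiff_of_subset hFF']
        omega
      linarith
  · rintro ⟨Y, i⟩ hq
    simp only [I, Finset.mem_product, Finset.mem_filter, Finset.mem_powerset,
      Finset.mem_range] at hq
    obtain ⟨⟨hY, ⟨y, hy⟩, hYne⟩, hi⟩ := hq
    refine freq_avoid_le_exp _ _ (ht.trans ?_)
    rw [hJcard i (by omega)]
    gcongr
    refine exists_crossing_edges (X := Finset.univ.filter fun x => f x ∈ Y) hAB ?_ ?_ hA hB hk _ ?_
    · obtain ⟨x, hx, rfl⟩ := Finset.mem_image.1 (hY hy)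
      exact ⟨x, hW ▸ hx, by simpa using hy⟩
    · obtain ⟨y', hy', hy''⟩ := Finset.exists_of_ssubset (Finset.ssubset_iff_subset_ne.2 ⟨hY, hYne⟩)
      obtain ⟨x, hx, rfl⟩ := Finset.mem_image.1 hy'
      exact ⟨x, hW ▸ hx, by simpa using hy''⟩
    · intro u hu v hv huv e he
      refine Finset.mem_filter.2 ⟨Finset.mem_univ _, u, hu, v, hv, ?_, he⟩
      simpa using huv

end Connect

/-! ### Attaching leaves by Hall's theorem -/

/-- The colourings for which there is a rainbow spanning tree of length at most `L`. -/
def treeEvent {n : ℕ} {κ : Type*} (len : KnEdge n → ℝ) (L : ℝ) : Set (KnEdge n → κ) :=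
  {χ | ∃ F : Finset (KnEdge n), (edgeGraph F).IsTree ∧ Set.InjOn χ F ∧ ∑ e ∈ F, len e ≤ L}

theorem edgeGraph_edgeSet {n : ℕ} (F : Finset (KnEdge n)) :
    (edgeGraph F).edgeSet = Subtype.val '' (F : Set (KnEdge n)) := by
  rw [edgeGraph, SimpleGraph.edgeSet_fromEdgeSet, sdiff_eq_left, Set.disjoint_left]
  rintro _ ⟨e, -, rfl⟩ h
  exact SimpleGraph.not_isDiag_of_mem_edgeSet _ e.2 h

theorem natCard_edgeGraph_edgeSet {n : ℕ} (F : Finset (KnEdge n)) :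
    Nat.card (edgeGraph F).edgeSet = F.card := by
  rw [edgeGraph_edgeSet, Nat.card_image_of_injective Subtype.val_injective]
  simp

/-- A Hall violation is a set of a vertices missing b = z + 1 - a colours. For a ≤ b one has b ≥ (z
+ 1) / 2, and both binomials are at most z^a because C(z, b) = C(z, a - 1). The product is thus an
a-th power of a base at most 1. -/
theorem choose_mul_choose_mul_exp_le {z a b : ℕ} (ha : 1 ≤ a) (hb : 1 ≤ b) (hab : a + b = z + 1)
    (hz : (z : ℝ) ^ 2 * Real.exp (-((z + 1) / 8)) ≤ 1) :
    (z.choose a * z.choose b : ℝ) * Real.exp (-(a * b / 4))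
      ≤ (z : ℝ) ^ 2 * Real.exp (-((z + 1) / 8)) := by
  wlog h : a ≤ b generalizing a b
  · have := this hb ha (by omega) (by omega)
    rwa [mul_comm (z.choose b : ℝ), mul_comm (b : ℝ)] at this
  have hz1 : 1 ≤ z := by omega
  have h1 : (z.choose a : ℝ) ≤ z ^ a := by exact_mod_cast Nat.choose_le_pow z a
  have h2 : (z.choose b : ℝ) ≤ z ^ a := by
    have h3 : z.choose b = z.choose (a - 1) := by
      rw [← Nat.choose_symm (by omega : b ≤ z)]
      congr 1
      omega
    rw [h3]
    exact_mod_cast (Nat.choose_le_pow z (a - 1)).trans (Nat.pow_le_pow_right hz1 (by omega))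
  have h3 : Real.exp (-(a * b / 4)) ≤ Real.exp (-((z + 1) / 8)) ^ a := by
    rw [← Real.exp_nat_mul]
    apply Real.exp_le_exp.2
    have h4 : (z : ℝ) + 1 ≤ 2 * b := by exact_mod_cast (by omega)
    have : (a : ℝ) * (z + 1) ≤ a * (2 * b) := by gcongr
    linarith
  calc (z.choose a * z.choose b : ℝ) * Real.exp (-(a * b / 4))
      ≤ ((z : ℝ) ^ a * z ^ a) * Real.exp (-((z + 1) / 8)) ^ a := by gcongr
    _ = ((z : ℝ) ^ 2 * Real.exp (-((z + 1) / 8))) ^ a := by rw [mul_pow]; ring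
    _ ≤ _ := pow_le_of_le_one (by positivity) hz (by omega)

open Classical in
/-- The remaining vertices can be attached as leaves, by Hall's theorem. -/
theorem freq_forestEvent_diff_treeEvent_le {n : ℕ} {κ : Type*} [Fintype κ] [Nonempty κ]
    {W : Finset (Fin n)} (hW : W.Nonempty) {D : Set (KnEdge n)} {len : KnEdge n → ℝ} {L ℓ : ℝ}
    (hD : ∀ e ∈ D, ∀ v ∈ e.1, v ∈ W) (hκ : Fintype.card κ + 1 = n) {z : ℕ} (hz : Wᶜ.card = z)
    (hW2 : Fintype.card κ ≤ 2 * W.card) (hlen : ∀ e, len e ≤ ℓ)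
    (hexp : (z : ℝ) ^ 2 * Real.exp (-((z + 1) / 8)) ≤ 1) :
    freq (forestEvent (κ := κ) W D len 1 L \ treeEvent len (L + z * ℓ))
      ≤ z * ((z : ℝ) ^ 2 * Real.exp (-((z + 1) / 8))) := by
  refine freq_diff_le_of_exposure D (fun φ ψ h => mem_forestEvent_of_piecewise h) ?_
    (by positivity)
  rintro φ ⟨F, f, hL, hFD, hφ, hcard, hlenF⟩
  have hwz : W.card + z = n := by
    have := Finset.card_add_card_compl W
    rw [hz, Fintype.card_fin] at this
    exact this
  have hcard1 : (W.image f).card = 1 := by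
    have h1 : (W.image f).card ≤ 1 := by exact_mod_cast hcard
    have h2 : 0 < (W.image f).card := Finset.card_pos.2 (hW.image f)
    omega
  have hFcard : F.card + 1 = W.card := by have := hL.card_add_card; omega
  have hreach : ∀ u ∈ W, ∀ v ∈ W, (edgeGraph F).Reachable u v := fun u hu v hv =>
    hL.reachable u hu v hv (Finset.card_le_one.1 hcard1.le _ (Finset.mem_image_of_mem f hu) _
      (Finset.mem_image_of_mem f hv))
  set J := Finset.univ \ F.image φ with hJ
  -- The tree on `W` uses |W| - 1 of the n - 1 colours: exactly as many remain as there are leaves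
  -- to attach.
  have hJcard : J.card = z := by
    have : J.card + W.card = Fintype.card κ + (W.image f).card := hL.card_unused hφ
    omega
  let C : Finset (Fin n) → Finset (KnEdge n) := fun A => Finset.univ.filter fun e =>
    ∃ v ∈ A, ∃ u ∈ W, e.1 = s(v, u)
  refine (freq_mono (B := {ψ | ∃ a ∈ Finset.Icc 1 z, ψ ∈ {ψ : KnEdge n → κ |
    ∃ q ∈ Finset.powersetCard a Wᶜ ×ˢ Finset.powersetCard (z + 1 - a) J,
      ψ ∈ {ψ : KnEdge n → κ | ∀ e ∈ C q.1, ψ e ∉ q.2}}}) ?_).trans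
    ((freq_biUnion_le_card_mul _ _
      (δ := (z : ℝ) ^ 2 * Real.exp (-((z + 1) / 8))) ?_).trans (by simp))
  · intro ψ hψ
    let t : ↥(Wᶜ) → Finset κ := fun v => J.filter fun c =>
      ∃ u ∈ W, ∃ e : KnEdge n, e.1 = s(v.1, u) ∧ ψ e = c
    by_cases hall : ∀ s : Finset ↥(Wᶜ), s.card ≤ (s.biUnion t).card
    · exfalso
      apply hψ
      obtain ⟨g, hg, hgt⟩ :=
        (Finset.all_card_le_biUnion_card_iff_exists_injective t).1 hall
      have hgt' : ∀ v, g v ∈ J ∧ ∃ u ∈ W, ∃ e : KnEdge n, e.1 = s(v.1, u) ∧ ψ e = g v :=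
        fun v => Finset.mem_filter.1 (hgt v)
      choose hgJ u hu e he hψe using hgt'
      have hpw : ∀ e ∈ F, D.piecewise φ ψ e = φ e :=
        fun e he => Set.piecewise_eq_of_mem _ _ _ (hFD e he)
      have hpw' : ∀ v, D.piecewise φ ψ (e v) = g v := by
        intro v
        rw [Set.piecewise_eq_of_notMem, hψe]
        intro h
        have := hD _ h v.1 (by rw [he]; simp)
        exact Finset.mem_compl.1 v.2 this
      have heinj : Function.Injective e := fun v v' h => hg (by rw [← hpw', ← hpw', h])
      have hdisj : Disjoint F (Finset.univ.image e) := by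
        rw [Finset.disjoint_left]
        intro e' he' h
        obtain ⟨v, -, rfl⟩ := Finset.mem_image.1 h
        have h1 := hgJ v
        rw [← hpw', hpw _ he'] at h1
        exact (Finset.mem_sdiff.1 h1).2 (Finset.mem_image_of_mem φ he')
      have hcardE : (Finset.univ.image e).card = z := by
        rw [Finset.card_image_of_injective _ heinj, Finset.card_univ, Fintype.card_coe, hz]
      refine ⟨F ∪ Finset.univ.image e, ?_, ?_, ?_⟩
      -- The |W| - 1 + z = n - 1 edges connect all vertices, which is enough for a tree.
      · rw [SimpleGraph.isTree_iff_connected_and_card, natCard_edgeGraph_edgeSet,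
          Finset.card_union_of_disjoint hdisj, hcardE, Nat.card_eq_fintype_card, Fintype.card_fin]
        refine ⟨?_, by omega⟩
        obtain ⟨w₀, hw₀⟩ := hW
        have hconn : ∀ v, (edgeGraph (F ∪ Finset.univ.image e)).Reachable v w₀ := by
          intro v
          by_cases hv : v ∈ W
          · exact (hreach v hv w₀ hw₀).mono (edgeGraph_mono Finset.subset_union_left)
          · let v' : ↥(Wᶜ) := ⟨v, Finset.mem_compl.2 hv⟩
            have h1 : (edgeGraph (F ∪ Finset.univ.image e)).Adj v (u v') :=
              edgeGraph_adj (Finset.mem_union_right _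
                (Finset.mem_image_of_mem e (Finset.mem_univ v'))) (he v')
            exact h1.reachable.trans ((hreach _ (hu v') w₀ hw₀).mono
              (edgeGraph_mono Finset.subset_union_left))
        have : Nonempty (Fin n) := ⟨w₀⟩
        exact ⟨fun v v' => (hconn v).trans (hconn v').symm⟩
      · intro e₁ h₁ e₂ h₂ h
        rw [Finset.mem_coe, Finset.mem_union, Finset.mem_image] at h₁ h₂
        rcases h₁ with h₁ | ⟨v₁, -, rfl⟩ <;> rcases h₂ with h₂ | ⟨v₂, -, rfl⟩
        · rw [hpw _ h₁, hpw _ h₂] at h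
          exact hφ h₁ h₂ h
        · rw [hpw _ h₁, hpw'] at h
          exact absurd (Finset.mem_image_of_mem φ h₁) (h ▸ (Finset.mem_sdiff.1 (hgJ v₂)).2)
        · rw [hpw _ h₂, hpw'] at h
          exact absurd (Finset.mem_image_of_mem φ h₂) (h ▸ (Finset.mem_sdiff.1 (hgJ v₁)).2)
        · rw [hpw', hpw'] at h
          rw [hg h]
      · rw [Finset.sum_union hdisj]
        have := Finset.sum_le_card_nsmul (Finset.univ.image e) len ℓ fun e _ => hlen e
        rw [hcardE, nsmul_eq_mul] at this
        linarith
    · push Not at hall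
      obtain ⟨s, hs⟩ := hall
      have hs1 : 1 ≤ s.card := by omega
      have hsz : s.card ≤ z := by
        have := Finset.card_le_univ s
        rwa [Fintype.card_coe, hz] at this
      -- The violating set sees fewer than |s| of the z unused colours, so at least z + 1 - |s| are
      -- absent from all its edges into `W`.
      obtain ⟨B, hB, hBcard⟩ : ∃ B ⊆ J \ s.biUnion t, B.card = z + 1 - s.card := by
        apply Finset.exists_subset_card_eq
        have := Finset.le_card_sdiff (s.biUnion t) J
        omega
      refine ⟨s.card, by simp [hs1, hsz], (s.map (Function.Embedding.subtype _), B), ?_, ?_⟩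
      · simp only [Finset.mem_product, Finset.mem_powersetCard, Finset.card_map, and_true]
        refine ⟨?_, hB.trans Finset.sdiff_subset, hBcard⟩
        intro v hv
        obtain ⟨v', -, rfl⟩ := Finset.mem_map.1 hv
        exact v'.2
      · intro e he heB
        obtain ⟨v, hv, u, hu, he⟩ := (Finset.mem_filter.1 he).2
        obtain ⟨v', hv', rfl⟩ := Finset.mem_map.1 hv
        obtain ⟨h1, h2⟩ := Finset.mem_sdiff.1 (hB heB)
        exact h2 (Finset.mem_biUnion.2 ⟨v', hv', Finset.mem_filter.2 ⟨h1, u, hu, e, he, rfl⟩⟩)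
  · intro a ha
    obtain ⟨ha1, haz⟩ := Finset.mem_Icc.1 ha
    refine (freq_biUnion_le_card_mul _ _ (δ := Real.exp (-(a * ((z + 1 - a : ℕ) : ℝ) / 4))) ?_).trans ?_
    · rintro ⟨A, B⟩ hq
      simp only [Finset.mem_product, Finset.mem_powersetCard] at hq
      obtain ⟨⟨hA, hAcard⟩, hB, hBcard⟩ := hq
      refine freq_avoid_le_exp _ _ ?_
      have h1 := card_mul_le_two_mul_card_edges A (fun _ => W)
        (fun v hv => Finset.mem_compl.1 (hA hv)) (d := W.card) (fun _ _ => le_rfl) (C A)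
        (fun e he => Finset.mem_filter.2 ⟨Finset.mem_univ _, he⟩)
      have h2 : (Fintype.card κ : ℝ) ≤ 2 * W.card := by exact_mod_cast hW2
      rw [hBcard]
      rw [hAcard] at h1
      -- One factor 1/2 comes from the double count of edges, the other from |κ| ≤ 2 |W|.
      calc (a : ℝ) * ((z + 1 - a : ℕ) : ℝ) / 4 * Fintype.card κ
          ≤ (a : ℝ) * ((z + 1 - a : ℕ) : ℝ) / 4 * (2 * W.card) := by gcongr
        _ = (a * W.card / 2) * ((z + 1 - a : ℕ) : ℝ) := by ring
        _ ≤ _ := by gcongr; linarith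
    · rw [Finset.card_product, Finset.card_powersetCard, Finset.card_powersetCard, hz, hJcard]
      push_cast
      exact choose_mul_choose_mul_exp_le ha1 (by omega) (by omega) hexp

/-! ### Nested dyadic cells -/

/-- The cell of a point at level `s` of the nested dyadic partitions of the square into `2 ^ s`
rectangles of area `2 ^ (-s)`. -/
noncomputable def levelCell (s : ℕ) (p : Plane) : Fin (2 ^ ((s + 1) / 2)) × Fin (2 ^ (s / 2)) :=
  cell _ _ p

/-- The other dyadic interval with the same parent. -/
def flipLast {k : ℕ} (j : Fin (2 ^ k)) : Fin (2 ^ k) :=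
  Fin.ofNat (2 ^ k) (if (j : ℕ) % 2 = 0 then j + 1 else j - 1)

/-- The other cell of level `s` in the same cell of level `s - 1`. -/
def siblingCell (s : ℕ) (c : Fin (2 ^ ((s + 1) / 2)) × Fin (2 ^ (s / 2))) :
    Fin (2 ^ ((s + 1) / 2)) × Fin (2 ^ (s / 2)) :=
  if s % 2 = 1 then (flipLast c.1, c.2) else (c.1, flipLast c.2)

/-- For positive k the number 2^k is even, so an even index below it has its successor below it and
`Fin.ofNat` does not wrap round. -/
theorem val_flipLast {k : ℕ} (hk : 0 < k) (j : Fin (2 ^ k)) :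
    (flipLast j : ℕ) = if (j : ℕ) % 2 = 0 then (j : ℕ) + 1 else j - 1 := by
  have h1 := j.2
  have h2 : 2 ^ k = 2 * 2 ^ (k - 1) := by
    rw [← pow_succ']; congr 1; omega
  rw [flipLast, Fin.val_ofNat, Nat.mod_eq_of_lt]
  split_ifs <;> omega

theorem flipLast_injective {k : ℕ} (hk : 0 < k) : Function.Injective (flipLast (k := k)) := by
  intro i j h
  have h1 := congrArg Fin.val h
  rw [val_flipLast hk, val_flipLast hk] at h1
  ext
  split_ifs at h1 <;> omega

theorem siblingCell_injective {s : ℕ} (hs : 0 < s) : Function.Injective (siblingCell s) := by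
  rintro ⟨a, b⟩ ⟨a', b'⟩ h
  unfold siblingCell at h
  by_cases h2 : s % 2 = 1
  · simp only [h2, if_true, Prod.mk.injEq] at h
    exact Prod.ext (flipLast_injective (by omega) h.1) h.2
  · simp only [h2, if_false, Prod.mk.injEq] at h
    exact Prod.ext h.1 (flipLast_injective (by omega) h.2)

theorem siblingCell_ne {s : ℕ} (hs : 0 < s) (c : Fin (2 ^ ((s + 1) / 2)) × Fin (2 ^ (s / 2))) :
    siblingCell s c ≠ c := by
  have key : ∀ {k : ℕ}, 0 < k → ∀ j : Fin (2 ^ k), flipLast j ≠ j := by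
    intro k hk j h
    have h1 := congrArg Fin.val h
    rw [val_flipLast hk] at h1
    split_ifs at h1 <;> omega
  intro h
  unfold siblingCell at h
  by_cases h2 : s % 2 = 1
  · rw [if_pos h2] at h
    exact key (by omega) _ (congrArg Prod.fst h)
  · rw [if_neg h2] at h
    exact key (by omega) _ (congrArg Prod.snd h)

theorem val_ofNat_floor {t : ℝ} (ht : t ∈ Set.Ico (0 : ℝ) 1) (k : ℕ) :
    (Fin.ofNat (2 ^ k) ⌊t * (2 ^ k : ℕ)⌋₊ : ℕ) = ⌊t * 2 ^ k⌋₊ := by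
  rw [Fin.val_ofNat, Nat.mod_eq_of_lt]
  · push_cast; rfl
  · rw [Nat.floor_lt (by have := ht.1; positivity)]
    have : (0 : ℝ) < (2 ^ k : ℕ) := by positivity
    nlinarith [ht.2]

theorem floor_mul_two_pow_succ_div_two (t : ℝ) (k : ℕ) :
    ⌊t * 2 ^ (k + 1)⌋₊ / 2 = ⌊t * 2 ^ k⌋₊ := by
  rw [← Nat.floor_div_ofNat]
  congr 1
  rw [pow_succ]
  ring

theorem levelCell_eq_iff {s : ℕ} {p q : Plane} (hp : p ∈ halfOpenSquare) (hq : q ∈ halfOpenSquare) :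
    levelCell s p = levelCell s q ↔ ⌊p 0 * 2 ^ ((s + 1) / 2)⌋₊ = ⌊q 0 * 2 ^ ((s + 1) / 2)⌋₊ ∧
      ⌊p 1 * 2 ^ (s / 2)⌋₊ = ⌊q 1 * 2 ^ (s / 2)⌋₊ := by
  rw [levelCell, levelCell, Prod.ext_iff, Fin.ext_iff, Fin.ext_iff]
  unfold cell
  simp only
  rw [val_ofNat_floor (hp 0), val_ofNat_floor (hp 1), val_ofNat_floor (hq 0),
    val_ofNat_floor (hq 1)]

theorem levelCell_eq_of_succ {s : ℕ} {p q : Plane} (hp : p ∈ halfOpenSquare)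
    (hq : q ∈ halfOpenSquare) (h : levelCell (s + 1) p = levelCell (s + 1) q) :
    levelCell s p = levelCell s q := by
  rw [levelCell_eq_iff hp hq] at h ⊢
  rcases Nat.even_or_odd' s with ⟨r, rfl | rfl⟩
  · rw [show (2 * r + 1 + 1) / 2 = r + 1 by omega, show (2 * r + 1) / 2 = r by omega] at h
    rw [show (2 * r + 1) / 2 = r by omega, show 2 * r / 2 = r by omega]
    refine ⟨?_, h.2⟩
    rw [← floor_mul_two_pow_succ_div_two, h.1, floor_mul_two_pow_succ_div_two]
  · rw [show (2 * r + 1 + 1 + 1) / 2 = r + 1 by omega,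
      show (2 * r + 1 + 1) / 2 = r + 1 by omega] at h
    rw [show (2 * r + 1 + 1) / 2 = r + 1 by omega, show (2 * r + 1) / 2 = r by omega]
    refine ⟨h.1, ?_⟩
    rw [← floor_mul_two_pow_succ_div_two, h.2, floor_mul_two_pow_succ_div_two]

/-- Siblings differ only in the last binary digit of one index, the column for odd levels and the
row for even ones; passing to the parent drops this digit. -/
theorem levelCell_eq_of_sibling {s : ℕ} {p q : Plane} (hp : p ∈ halfOpenSquare)
    (hq : q ∈ halfOpenSquare) (h : levelCell (s + 1) p = siblingCell (s + 1) (levelCell (s + 1) q)) :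
    levelCell s p = levelCell s q := by
  have key : ∀ {k K : ℕ} {t u : ℝ}, K = k + 1 → t ∈ Set.Ico (0 : ℝ) 1 → u ∈ Set.Ico (0 : ℝ) 1 →
      Fin.ofNat (2 ^ K) ⌊t * (2 ^ K : ℕ)⌋₊
        = flipLast (Fin.ofNat (2 ^ K) ⌊u * (2 ^ K : ℕ)⌋₊) →
      ⌊t * 2 ^ k⌋₊ = ⌊u * 2 ^ k⌋₊ := by
    rintro k K t u rfl ht hu h
    have h1 := congrArg Fin.val h
    rw [val_flipLast (by omega), val_ofNat_floor ht, val_ofNat_floor hu] at h1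
    rw [← floor_mul_two_pow_succ_div_two, ← floor_mul_two_pow_succ_div_two u]
    split_ifs at h1 <;> omega
  rw [levelCell_eq_iff hp hq]
  rw [siblingCell, levelCell, levelCell] at h
  unfold cell at h
  rcases Nat.even_or_odd' s with ⟨r, rfl | rfl⟩
  · rw [if_pos (by omega), Prod.mk.injEq] at h
    obtain ⟨h1, h2⟩ := h
    have h3 := congrArg Fin.val h2
    rw [val_ofNat_floor (hp 1), val_ofNat_floor (hq 1)] at h3
    have e1 : (2 * r + 1 + 1) / 2 = r + 1 := by omega
    have e2 : (2 * r + 1) / 2 = r := by omega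
    have e3 : (2 * r) / 2 = r := by omega
    rw [e2] at h3
    rw [e2, e3]
    exact ⟨key e1 (hp 0) (hq 0) h1, h3⟩
  · rw [if_neg (by omega), Prod.mk.injEq] at h
    obtain ⟨h1, h2⟩ := h
    have h3 := congrArg Fin.val h1
    rw [val_ofNat_floor (hp 0), val_ofNat_floor (hq 0)] at h3
    have e1 : (2 * r + 1 + 1 + 1) / 2 = r + 1 := by omega
    have e2 : (2 * r + 1 + 1) / 2 = r + 1 := by omega
    have e3 : (2 * r + 1) / 2 = r := by omega
    rw [e1] at h3
    rw [e2, e3]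
    exact ⟨h3, key e2 (hp 1) (hq 1) h2⟩

theorem dist_le_abs_add_abs (p q : Plane) : dist p q ≤ |p 0 - q 0| + |p 1 - q 1| := by
  rw [EuclideanSpace.dist_eq, Fin.sum_univ_two]
  apply Real.sqrt_le_iff.2 ⟨by positivity, ?_⟩
  rw [Real.dist_eq, Real.dist_eq]
  nlinarith [abs_nonneg (p 0 - q 0), abs_nonneg (p 1 - q 1)]

theorem dist_le_two_of_mem_halfOpenSquare {p q : Plane} (hp : p ∈ halfOpenSquare)
    (hq : q ∈ halfOpenSquare) : dist p q ≤ 2 := by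
  have h : ∀ k, |p k - q k| ≤ 1 := fun k => by
    have h1 := hp k
    have h2 := hq k
    rw [Set.mem_Ico] at h1 h2
    rw [abs_le]
    constructor <;> linarith
  linarith [dist_le_abs_add_abs p q, h 0, h 1]

/-- The sides of a cell of level s are 2^(-⌈s/2⌉) and 2^(-⌊s/2⌋), both at most 2 / √2^s. -/
theorem dist_le_of_levelCell_eq {s : ℕ} {p q : Plane} (hp : p ∈ halfOpenSquare)
    (hq : q ∈ halfOpenSquare) (h : levelCell s p = levelCell s q) :
    dist p q ≤ 4 / √2 ^ s := by
  have h0 : (0 : ℝ) < √2 := by positivity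
  have hsq : √2 * √2 = 2 := Real.mul_self_sqrt (by norm_num)
  have h1le : (1 : ℝ) ≤ √2 := by nlinarith
  have key : ∀ {t u : ℝ} (k : ℕ), t ∈ Set.Ico (0 : ℝ) 1 → u ∈ Set.Ico (0 : ℝ) 1 →
      ⌊t * 2 ^ k⌋₊ = ⌊u * 2 ^ k⌋₊ → s / 2 ≤ k → |t - u| ≤ 2 / √2 ^ s := by
    intro t u k ht hu h hk
    have hpos : (0 : ℝ) < 2 ^ k := by positivity
    have a1 := Nat.floor_le (show 0 ≤ t * 2 ^ k by have := ht.1; positivity)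
    have a2 := Nat.lt_floor_add_one (t * 2 ^ k)
    have b1 := Nat.floor_le (show 0 ≤ u * 2 ^ k by have := hu.1; positivity)
    have b2 := Nat.lt_floor_add_one (u * 2 ^ k)
    rw [h] at a1 a2
    have h1 : |t - u| * 2 ^ k ≤ 1 := by
      rw [← abs_of_pos hpos, ← abs_mul, abs_le]
      constructor <;> nlinarith
    rw [le_div_iff₀ (by positivity)]
    have h2 : √2 ^ s ≤ 2 * 2 ^ k := by
      calc √2 ^ s ≤ √2 ^ (2 * k + 1) := pow_le_pow_right₀ h1le (by omega)
        _ = √2 * 2 ^ k := by rw [pow_succ, pow_mul, sq, hsq]; ring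
        _ ≤ 2 * 2 ^ k := by gcongr; nlinarith
    calc |t - u| * √2 ^ s ≤ |t - u| * (2 * 2 ^ k) := by gcongr
      _ = 2 * (|t - u| * 2 ^ k) := by ring
      _ ≤ 2 := by linarith
  rw [levelCell_eq_iff hp hq] at h
  have h1 := key _ (hp 0) (hq 0) h.1 (by omega)
  have h2 := key _ (hp 1) (hq 1) h.2 le_rfl
  calc dist p q ≤ |p 0 - q 0| + |p 1 - q 1| := dist_le_abs_add_abs p q
    _ ≤ 2 / √2 ^ s + 2 / √2 ^ s := add_le_add h1 h2
    _ = 4 / √2 ^ s := by ring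

/-- The pairs of points of `W` in the same cell of level `s`. -/
def levelEdges {n : ℕ} (x : Fin n → Plane) (W : Finset (Fin n)) (s : ℕ) : Set (KnEdge n) :=
  {e | (∀ v ∈ e.1, v ∈ W) ∧ ∀ u ∈ e.1, ∀ v ∈ e.1, levelCell s (x u) = levelCell s (x v)}

theorem levelEdges_succ_subset {n : ℕ} {x : Fin n → Plane} (hx : ∀ i, x i ∈ halfOpenSquare)
    (W : Finset (Fin n)) (s : ℕ) : levelEdges x W (s + 1) ⊆ levelEdges x W s :=
  fun _ he => ⟨he.1, fun u hu v hv => levelCell_eq_of_succ (hx u) (hx v) (he.2 u hu v hv)⟩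

/-- The mean square deviation of the numbers of points of `W` in the cells of level `s`. -/
noncomputable def dispersion {n : ℕ} (x : Fin n → Plane) (W : Finset (Fin n)) (s : ℕ) : ℝ :=
  ∑ c, (((W.filter fun v => levelCell s (x v) = c).card : ℝ) - W.card / 2 ^ s) ^ 2

theorem card_levelCells (s : ℕ) :
    Fintype.card (Fin (2 ^ ((s + 1) / 2)) × Fin (2 ^ (s / 2))) = 2 ^ s := by
  rw [Fintype.card_prod, Fintype.card_fin, Fintype.card_fin, ← pow_add]
  congr 1
  omega

theorem pi_uniformSquare_dispersion_ge_le {n : ℕ} (W : Finset (Fin n)) (s : ℕ) {τ : ℝ}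
    (hτ : 0 < τ) : Measure.pi (fun _ : Fin n => uniformSquare) {x | W.card + τ ≤ dispersion x W s}
      ≤ ENNReal.ofReal (2 * (W.card : ℝ) ^ 2 / (2 ^ s * τ ^ 2)) := by
  have h1 := freq_dispersion_ge_le (β := Fin (2 ^ ((s + 1) / 2)) × Fin (2 ^ (s / 2))) W hτ
  rw [card_levelCells] at h1
  push_cast at h1
  refine le_trans (le_of_eq ?_) (ENNReal.ofReal_le_ofReal h1)
  exact pi_uniformSquare_cell_preimage (M := 2 ^ ((s + 1) / 2)) (N := 2 ^ (s / 2))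
    {g : Fin n → _ | W.card + τ ≤ ∑ c, (((W.filter fun v => g v = c).card : ℝ)
      - W.card / 2 ^ s) ^ 2}

/-- Few points have a sparsely populated cell as the sibling of their cell. -/
theorem card_sparse_sibling_mul_le {α β : Type*} [Fintype β] [DecidableEq β] (W : Finset α)
    (c : α → β) {σ : β → β} (hσ : Function.Injective σ) (μ : ℝ) :
    ((W.filter fun v => ((W.filter fun w => c w = σ (c v)).card : ℝ) < μ / 2).card : ℝ) * μ
      ≤ 10 * ∑ b, (((W.filter fun w => c w = b).card : ℝ) - μ) ^ 2 := by
  classical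
  let N : β → ℝ := fun b => ((W.filter fun w => c w = b).card : ℝ)
  have h1 : ((W.filter fun v => N (σ (c v)) < μ / 2).card : ℝ)
      = ∑ b, if N (σ b) < μ / 2 then N b else 0 := by
    rw [Finset.card_eq_sum_card_fiberwise (f := c) (t := Finset.univ) (by simp [Set.MapsTo])]
    push_cast
    refine Finset.sum_congr rfl fun b _ => ?_
    rw [Finset.filter_filter]
    split_ifs with h
    · show _ = ((W.filter fun w => c w = b).card : ℝ)
      congr 2
      ext v
      simp only [Finset.mem_filter, and_congr_right_iff]
      intro _
      constructor
      · exact fun h' => h'.2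
      · rintro rfl; exact ⟨h, rfl⟩
    · rw [Nat.cast_eq_zero, Finset.card_eq_zero, Finset.filter_eq_empty_iff]
      rintro v - ⟨h', rfl⟩
      exact h h'
  have h2 : ∑ b, (N (σ b) - μ) ^ 2 = ∑ b, (N b - μ) ^ 2 :=
    Equiv.sum_comp (Equiv.ofBijective σ (Finite.injective_iff_bijective.1 hσ))
      fun b => (N b - μ) ^ 2
  -- A sparse sibling makes the first term at least 2μ², and N μ ≤ 2μ² + 2(N - μ)² always holds.
  have h3 : ∀ b, (if N (σ b) < μ / 2 then N b else 0) * μ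
      ≤ 8 * (N (σ b) - μ) ^ 2 + 2 * (N b - μ) ^ 2 := by
    intro b
    have hN : 0 ≤ N (σ b) := Nat.cast_nonneg _
    split_ifs with h
    · nlinarith [sq_nonneg (4 * N b - 5 * μ), mul_self_nonneg μ]
    · rw [zero_mul]; positivity
  calc _ = ∑ b, (if N (σ b) < μ / 2 then N b else 0) * μ := by rw [← Finset.sum_mul, ← h1]
    _ ≤ ∑ b, (8 * (N (σ b) - μ) ^ 2 + 2 * (N b - μ) ^ 2) := Finset.sum_le_sum fun b _ => h3 b
    _ = 8 * ∑ b, (N (σ b) - μ) ^ 2 + 2 * ∑ b, (N b - μ) ^ 2 := by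
        rw [Finset.sum_add_distrib, ← Finset.mul_sum, ← Finset.mul_sum]
    _ = 10 * ∑ b, (N b - μ) ^ 2 := by rw [h2]; ring
    _ = _ := rfl

/-! ### The construction through all levels -/

section Upper

variable {n : ℕ} {x : Fin n → Plane} {W : Finset (Fin n)} {S : ℕ}

theorem edgeLength_mk {e : KnEdge n} {u v : Fin n} (h : e.1 = s(u, v)) :
    edgeLength x e.1 = dist (x u) (x v) := by
  rw [h]; rfl

theorem edgeLength_le_two (hx : ∀ i, x i ∈ halfOpenSquare) (e : KnEdge n) :
    edgeLength x e.1 ≤ 2 := by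
  obtain ⟨⟨u, v⟩, h⟩ := e
  exact dist_le_two_of_mem_halfOpenSquare (hx u) (hx v)

theorem mem_levelEdges_iff {s : ℕ} {e : KnEdge n} {u v : Fin n} (h : e.1 = s(u, v)) :
    e ∈ levelEdges x W s ↔ (u ∈ W ∧ v ∈ W) ∧ levelCell s (x u) = levelCell s (x v) := by
  simp only [levelEdges, Set.mem_ofPred_eq, h, Sym2.mem_iff, forall_eq_or_imp, forall_eq,
    true_and, and_true]
  constructor
  · rintro ⟨h1, h2, h3⟩
    exact ⟨h1, h2⟩
  · rintro ⟨h1, h2⟩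
    exact ⟨h1, h2, h2.symm⟩

/-- The total length of the edges added in the first `k` stages. -/
noncomputable def stageLength (w : ℝ) (S k : ℕ) : ℝ :=
  ∑ i ∈ Finset.range k, w * (9 / 16) ^ i * (4 / √2 ^ (S - i - 1))

/-- The numbers of points in the cells of all levels up to `S` are not far from their means. -/
def EvenlySpread (x : Fin n → Plane) (W : Finset (Fin n)) (S : ℕ) : Prop :=
  (∀ i, x i ∈ halfOpenSquare) ∧
    ∀ s, 1 ≤ s → s ≤ S → dispersion x W s < 2 * W.card * (9 / 8) ^ (S - s)

/-- Induction on the stages. Before stage k the bound on the number of classes is at least 4096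
(9/8)^k times the number 2^(S-k) of cells. This growing ratio pays both for one lost label per cell
and for the dispersion, which is also allowed to grow like (9/8)^k. The exposed edges join points in
a common cell of level S - k; edges between sibling cells are fresh. -/
theorem freq_compl_forestEvent_le (hx : EvenlySpread x W S) (hS : 4096 * 2 ^ S ≤ W.card)
    (h1 : W.card ≤ n - 1) (h2 : n - 1 ≤ 2 * W.card) (k : ℕ) (hk : k < S) :
    freq (forestEvent (κ := Fin (n - 1)) W (levelEdges x W (S - k)) (fun e => edgeLength x e.1)
      (W.card * (9 / 16) ^ k) (stageLength W.card S k))ᶜ ≤ k * Real.exp (-(4096 * (9 / 8) ^ S)) := by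
  have hS' : (4096 : ℝ) * 2 ^ S ≤ W.card := by exact_mod_cast hS
  have hwpos : (0 : ℝ) < W.card := lt_of_lt_of_le (by positivity) hS'
  have hn : 0 < n - 1 := by
    have : 0 < W.card := by exact_mod_cast hwpos
    omega
  have : Nonempty (Fin (n - 1)) := ⟨⟨0, hn⟩⟩
  induction k with
  | zero =>
    have : (forestEvent (κ := Fin (n - 1)) W (levelEdges x W (S - 0)) (fun e => edgeLength x e.1)
      (W.card * (9 / 16) ^ 0) (stageLength W.card S 0))ᶜ = ∅ := by
      rw [Set.compl_empty_iff, Set.eq_univ_iff_forall]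
      intro χ
      exact ⟨∅, id, Linked.empty W, by simp, by simp, by simp, by simp [stageLength]⟩
    rw [this, freq_empty]
    simp
  | succ k ih =>
    -- The stages end at level 1 at the latest, so edges between the two halves of the square stay
    -- unexposed for the connecting step.
    obtain ⟨r, rfl⟩ : ∃ r, S = k + (r + 1) + 1 := ⟨S - k - 2, by omega⟩
    set S := k + (r + 1) + 1 with hSdef
    have hs : S - k = r + 1 + 1 := by omega
    have hs' : S - (k + 1) = r + 1 := by omega
    have hpow : (2 : ℝ) ^ S = 2 ^ k * 2 ^ (r + 1 + 1) := by rw [← pow_add, hSdef]; congr 1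
    set m : ℝ := W.card * (9 / 16) ^ k with hm
    set μ : ℝ := W.card / 2 ^ (r + 1 + 1) with hμ
    have hm_ge : 4096 * 2 ^ (r + 1 + 1) * (9 / 8) ^ k ≤ m := by
      calc (4096 : ℝ) * 2 ^ (r + 1 + 1) * (9 / 8) ^ k
          = 4096 * 2 ^ S * (9 / 16) ^ k := by
            rw [hpow, show (9 / 8 : ℝ) = 2 * (9 / 16) by norm_num, mul_pow]; ring
        _ ≤ m := by rw [hm]; gcongr
    have hone : (1 : ℝ) ≤ (9 / 8) ^ k := one_le_pow₀ (by norm_num)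
    have hm_ge' : 4096 * 2 ^ (r + 1 + 1) ≤ m := by
      refine le_trans ?_ hm_ge
      exact le_mul_of_one_le_right (by positivity) hone
    have hμpos : 0 < μ := by positivity
    have hdisp := hx.2 (r + 1 + 1) (by omega) (by omega)
    rw [show S - (r + 1 + 1) = k by omega] at hdisp
    have hbad := card_sparse_sibling_mul_le W (fun v => levelCell (r + 1 + 1) (x v))
      (siblingCell_injective (s := r + 1 + 1) (by omega)) μ
    have hstage := freq_forestEvent_diff_le (κ := Fin (n - 1)) (W := W)
      (D := levelEdges x W (S - k)) (D' := levelEdges x W (S - (k + 1)))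
      (len := fun e => edgeLength x e.1) (fun v => levelCell (r + 1 + 1) (x v))
      (siblingCell (r + 1 + 1)) (m := m) (L := stageLength W.card S k)
      (ℓ := 4 / √2 ^ (S - k - 1)) (μ := μ) (by positivity) (by positivity)
      (by rw [hs, hs']; exact levelEdges_succ_subset hx.1 W _) hμpos.le
      (by
        intro v hv w hw hvw e he
        rw [hs, hs', mem_levelEdges_iff he, mem_levelEdges_iff he, edgeLength_mk he]
        have h3 := levelCell_eq_of_sibling (hx.1 w) (hx.1 v) hvw
        refine ⟨fun h => siblingCell_ne (by omega) _ (hvw.symm.trans h.2.symm),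
          ⟨⟨hv, hw⟩, h3.symm⟩, ?_⟩
        rw [show r + 1 + 1 - 1 = r + 1 by omega]
        exact dist_le_of_levelCell_eq (hx.1 v) (hx.1 w) h3.symm)
      (by simpa using h1)
      (by
        refine le_of_mul_le_mul_right (hbad.trans ?_) hμpos
        -- Ten times the dispersion is below 20 |W| (9/8)^k, well within this bound.
        have h4 : m / 64 * μ ≥ 64 * W.card * (9 / 8) ^ k := by
          calc m / 64 * μ ≥ (4096 * 2 ^ (r + 1 + 1) * (9 / 8) ^ k) / 64 * μ := by gcongr
            _ = 64 * W.card * (9 / 8) ^ k := by rw [hμ]; field_simp; ring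
        have h5 : (0 : ℝ) ≤ W.card * (9 / 8) ^ k := by positivity
        have h6 : dispersion x W (r + 1 + 1) = ∑ b, (((W.filter fun w =>
          levelCell (r + 1 + 1) (x w) = b).card : ℝ) - μ) ^ 2 := rfl
        rw [← h6]
        nlinarith)
      (by
        rw [card_levelCells]
        push_cast
        linarith [show (0 : ℝ) < 2 ^ (r + 1 + 1) by positivity])
      (by
        have h4 : ((n - 1 : ℕ) : ℝ) ≤ 2 * W.card := by exact_mod_cast h2
        rw [Fintype.card_fin]
        calc 2048 * ((n - 1 : ℕ) : ℝ) ≤ 4096 * W.card := by linarith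
          _ = 4096 * 2 ^ (r + 1 + 1) * μ := by rw [hμ]; field_simp
          _ ≤ m * μ := by gcongr)
    have hexp : Real.exp (-m) ≤ Real.exp (-(4096 * (9 / 8) ^ S)) := by
      apply Real.exp_le_exp.2
      rw [neg_le_neg_iff]
      calc (4096 : ℝ) * (9 / 8) ^ S = 4096 * 2 ^ S * (9 / 16) ^ S := by
            rw [show (9 / 8 : ℝ) = 2 * (9 / 16) by norm_num, mul_pow]; ring
        _ ≤ W.card * (9 / 16) ^ S := by gcongr
        _ ≤ W.card * (9 / 16) ^ k := by
            gcongr ?_ * ?_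
            exact pow_le_pow_of_le_one (by norm_num) (by norm_num) (by omega)
    have hm' : W.card * (9 / 16 : ℝ) ^ (k + 1) = 9 / 16 * m := by rw [hm, pow_succ]; ring
    have hL' : stageLength W.card S (k + 1)
        = stageLength W.card S k + m * (4 / √2 ^ (S - k - 1)) := by
      rw [stageLength, Finset.sum_range_succ, ← stageLength]
    rw [hm', hL']
    refine (freq_mono (B := _ ∪ _) ?_).trans ((freq_union_le _ _).trans
      (add_le_add (ih (by omega)) (hstage.trans hexp))) |>.trans (le_of_eq (by push_cast; ring))
    intro χ hχ
    by_cases h : χ ∈ forestEvent (κ := Fin (n - 1)) W (levelEdges x W (S - k))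
      (fun e => edgeLength x e.1) (W.card * (9 / 16) ^ k) (stageLength W.card S k)
    · exact Or.inr ⟨h, hχ⟩
    · exact Or.inl h

/-- A half with fewer than |W| / 4 points would by itself contribute |W|² / 16 to the dispersion at
level 1, which is less than 2 |W| 2^S ≤ |W|² / 2048. -/
theorem EvenlySpread.quarter_le_card (hx : EvenlySpread x W S) (hS : 4096 * 2 ^ S ≤ W.card)
    (hS1 : 1 ≤ S) (c : Fin (2 ^ ((1 + 1) / 2)) × Fin (2 ^ (1 / 2))) :
    W.card / 4 ≤ (W.filter fun v => levelCell 1 (x v) = c).card := by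
  have hS' : (4096 : ℝ) * 2 ^ S ≤ W.card := by exact_mod_cast hS
  have hd := hx.2 1 le_rfl hS1
  by_contra hlt
  rw [not_le] at hlt
  set N := (W.filter fun v => levelCell 1 (x v) = c).card with hN
  have h1 : (N : ℝ) ≤ W.card / 4 := by
    have : (N : ℝ) ≤ (W.card / 4 : ℕ) := by exact_mod_cast hlt.le
    exact this.trans Nat.cast_div_le
  have h2 : ((N : ℝ) - W.card / 2 ^ 1) ^ 2 ≤ dispersion x W 1 :=
    Finset.single_le_sum (f := fun c => (((W.filter fun v => levelCell 1 (x v) = c).card : ℝ)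
      - W.card / 2 ^ 1) ^ 2) (fun _ _ => sq_nonneg _) (Finset.mem_univ c)
  have h3 : (9 / 8 : ℝ) ^ (S - 1) ≤ 2 ^ S :=
    (pow_le_pow_left₀ (by norm_num) (by norm_num) _).trans
      (pow_le_pow_right₀ (by norm_num) (by omega))
  have hw : (0 : ℝ) < W.card := lt_of_lt_of_le (by positivity) hS'
  have h4 : (W.card / 4 : ℝ) ^ 2 ≤ ((N : ℝ) - W.card / 2 ^ 1) ^ 2 := by
    rw [← neg_sq ((N : ℝ) - _)]
    apply pow_le_pow_left₀ (by positivity)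
    linarith
  have h5 : 2 * (W.card : ℝ) * (9 / 8) ^ (S - 1) ≤ 2 * W.card * 2 ^ S := by gcongr
  nlinarith

/-- With high probability there is a short rainbow spanning tree. -/
theorem freq_compl_treeEvent_le (hx : EvenlySpread x W S) (hS : 4096 * 2 ^ S ≤ W.card)
    (hS1 : 1 ≤ S) (h1 : W.card ≤ n - 1) (h2 : n - 1 ≤ 2 * W.card) {z M : ℕ} (hz : Wᶜ.card = z)
    (hM : M = ⌊(W.card * (9 / 16) ^ (S - 1) : ℝ)⌋₊)
    (hexp : (z : ℝ) ^ 2 * Real.exp (-((z + 1) / 8)) ≤ 1) :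
    freq (treeEvent (κ := Fin (n - 1)) (fun e => edgeLength x e.1)
      (stageLength W.card S (S - 1) + M * 2 + z * 2))ᶜ
      ≤ S * Real.exp (-(4096 * (9 / 8) ^ S)) + 2 ^ M * M * Real.exp (-((z / M : ℕ) / 16))
        + z * ((z : ℝ) ^ 2 * Real.exp (-((z + 1) / 8))) := by
  classical
  have hwz : W.card + z = n := by
    have := Finset.card_add_card_compl W
    rwa [hz, Fintype.card_fin] at this
  have hw4 : 4 ≤ W.card := by
    have : 1 ≤ 2 ^ S := Nat.one_le_two_pow
    omega
  have : Nonempty (Fin (n - 1)) := ⟨⟨0, by omega⟩⟩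
  obtain ⟨v₀, hv₀⟩ : W.Nonempty := Finset.card_pos.1 (by omega)
  set len : KnEdge n → ℝ := fun e => edgeLength x e.1 with hlen
  have hstage := freq_compl_forestEvent_le hx hS h1 h2 (S - 1) (by omega)
  rw [show S - (S - 1) = 1 by omega] at hstage
  set L := stageLength W.card S (S - 1) with hL
  set E₁ := forestEvent (κ := Fin (n - 1)) W (levelEdges x W 1) len M L with hE₁
  set E₂ := forestEvent (κ := Fin (n - 1)) W (levelEdges x W 0) len 1 (L + M * 2) with hE₂
  have hE₁c : freq E₁ᶜ ≤ S * Real.exp (-(4096 * (9 / 8) ^ S)) := by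
    refine (freq_mono ?_).trans (hstage.trans ?_)
    · rw [Set.compl_subset_compl]
      rintro χ ⟨F, f, a1, a2, a3, a4, a5⟩
      refine ⟨F, f, a1, a2, a3, ?_, a5⟩
      rw [hM]
      exact_mod_cast Nat.le_floor a4
    · gcongr
      omega
  -- The parts of the bipartite graph are the two halves of the square; its edges belong to level 0
  -- but not to level 1. Blocks of ⌊z / M⌋ colours fit because |W| + z = n.
  set c₀ := levelCell 1 (x v₀) with hc₀
  have hsub : Subsingleton (Fin (2 ^ ((0 + 1) / 2)) × Fin (2 ^ (0 / 2))) := by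
    rw [← Fintype.card_le_one_iff_subsingleton, card_levelCells]; norm_num
  have hconn := freq_forestEvent_connect_le (κ := Fin (n - 1)) (W := W) (D := levelEdges x W 1)
    (D' := levelEdges x W 0) (len := len) (A := W.filter fun v => levelCell 1 (x v) = c₀)
    (B := W.filter fun v => ¬ levelCell 1 (x v) = c₀) (Finset.disjoint_filter_filter_not _ _ _)
    (Finset.filter_union_filter_not_eq _ _) (M := M) (b := z / M) (k := W.card / 4) (L := L)
    (ℓ := 2) (by omega) (hx.quarter_le_card hS hS1 c₀)
    (by
      refine (hx.quarter_le_card hS hS1 (siblingCell 1 c₀)).trans (Finset.card_le_card ?_)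
      intro v hv
      obtain ⟨hvW, hv⟩ := Finset.mem_filter.1 hv
      exact Finset.mem_filter.2 ⟨hvW, fun h => siblingCell_ne (by omega) c₀ (hv.symm.trans h)⟩)
    (by norm_num) (levelEdges_succ_subset hx.1 W 0)
    (by
      intro u hu v hv e he
      obtain ⟨huW, hu⟩ := Finset.mem_filter.1 hu
      obtain ⟨hvW, hv⟩ := Finset.mem_filter.1 hv
      rw [mem_levelEdges_iff he, mem_levelEdges_iff he]
      exact ⟨fun h => hv (h.2.symm.trans hu), ⟨⟨huW, hvW⟩, Subsingleton.elim _ _⟩,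
        edgeLength_le_two hx.1 e⟩)
    (by
      have := Nat.mul_div_le z M
      rw [Fintype.card_fin]
      omega) (t := (z / M : ℕ) / 16)
    (by
      have h3 : ((n - 1 : ℕ) : ℝ) ≤ 16 * (W.card / 4 : ℕ) := by
        exact_mod_cast (by omega : n - 1 ≤ 16 * (W.card / 4))
      rw [Fintype.card_fin]
      calc ((z / M : ℕ) : ℝ) / 16 * ((n - 1 : ℕ) : ℝ)
          ≤ ((z / M : ℕ) : ℝ) / 16 * (16 * (W.card / 4 : ℕ)) := by gcongr
        _ = _ := by ring)
  -- At level 0 only edges inside `W` have been exposed, so the edges to the reserved vertices are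
  -- fresh.
  have hhall := freq_forestEvent_diff_treeEvent_le (κ := Fin (n - 1)) ⟨v₀, hv₀⟩
    (D := levelEdges x W 0) (len := len) (L := L + M * 2) (ℓ := 2) (fun e he => he.1)
    (by rw [Fintype.card_fin]; omega) hz (by rw [Fintype.card_fin]; exact h2)
    (edgeLength_le_two hx.1) hexp
  have hcover : (treeEvent (κ := Fin (n - 1)) len (L + M * 2 + z * 2))ᶜ
      ⊆ (E₁ᶜ ∪ (E₁ \ E₂)) ∪ (E₂ \ treeEvent len (L + M * 2 + z * 2)) := by
    intro χ hχ
    by_cases h1 : χ ∈ E₁ <;> by_cases h2 : χ ∈ E₂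
    · exact Or.inr ⟨h2, hχ⟩
    · exact Or.inl (Or.inr ⟨h1, h2⟩)
    · exact Or.inr ⟨h2, hχ⟩
    · exact Or.inl (Or.inl h1)
  exact (freq_mono hcover).trans ((freq_union_le _ _).trans
    (add_le_add ((freq_union_le _ _).trans (add_le_add hE₁c hconn)) hhall))

end Upper

/-! ### Asymptotic estimates and the upper bound -/

/-- Terms decrease with ratio 9√2/16 < 4/5, so the sum is at most five times the first one, which is
of order w / √2^S. Here √w ≤ 91 √2^S because 91² > 8192. -/
theorem stageLength_le {w : ℝ} {S k : ℕ} (hk : k ≤ S) (hw₀ : 0 ≤ w) (hw : w ≤ 8192 * 2 ^ S) :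
    stageLength w S k ≤ 3000 * √w := by
  have h0 : (0 : ℝ) < √2 := by positivity
  have hsq : √2 * √2 = 2 := Real.mul_self_sqrt (by norm_num)
  have hlt : √2 ≤ 1.42 := by nlinarith
  have hterm : ∀ i ∈ Finset.range k, w * (9 / 16) ^ i * (4 / √2 ^ (S - i - 1))
      = 4 * √2 * w / √2 ^ S * (9 / 16 * √2) ^ i := by
    intro i hi
    have : S = (S - i - 1) + (i + 1) := by have := Finset.mem_range.1 hi; omega
    conv_rhs => rw [this]
    rw [pow_add, pow_succ, mul_pow]
    field_simp
  have hgeom : ∑ i ∈ Finset.range k, (9 / 16 * √2) ^ i ≤ 5 := by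
    have h1 : 9 / 16 * √2 ≤ 4 / 5 := by linarith
    calc ∑ i ∈ Finset.range k, (9 / 16 * √2) ^ i
        ≤ ∑ i ∈ Finset.range k, (4 / 5 : ℝ) ^ i := by gcongr
      _ ≤ ∑' i : ℕ, (4 / 5 : ℝ) ^ i :=
          (summable_geometric_of_lt_one (by norm_num) (by norm_num)).sum_le_tsum _
            fun _ _ => by positivity
      _ = 5 := by rw [tsum_geometric_of_lt_one (by norm_num) (by norm_num)]; norm_num
  have hsqrt : √w ≤ 91 * √2 ^ S := by
    rw [Real.sqrt_le_left (by positivity), mul_pow, ← pow_mul, mul_comm S, pow_mul, sq √2, hsq]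
    nlinarith [show (0 : ℝ) < 2 ^ S by positivity]
  have hratio : w / √2 ^ S ≤ 91 * √w := by
    rw [div_le_iff₀ (by positivity)]
    nlinarith [Real.mul_self_sqrt hw₀, Real.sqrt_nonneg w]
  rw [stageLength, Finset.sum_congr rfl hterm, ← Finset.mul_sum]
  calc 4 * √2 * w / √2 ^ S * ∑ i ∈ Finset.range k, (9 / 16 * √2) ^ i
      ≤ 4 * √2 * w / √2 ^ S * 5 := by gcongr
    _ = 20 * √2 * (w / √2 ^ S) := by ring
    _ ≤ 20 * 1.42 * (91 * √w) := by gcongr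
    _ ≤ _ := by nlinarith [Real.sqrt_nonneg w]

/-- At a coarse level 2^s is too small for Chebyshev's inequality alone; the allowance (9/8)^(S-s)
compensates. Its square is (81/64)^(S-s) and 2 ≥ 81/64, so each level fails with probability at most
2 (64/81)^S. -/
theorem pi_uniformSquare_not_evenlySpread_le {n : ℕ} {W : Finset (Fin n)} (hW : 0 < W.card)
    (S : ℕ) : Measure.pi (fun _ : Fin n => uniformSquare) {x | ¬ EvenlySpread x W S}
      ≤ ENNReal.ofReal (2 * (S * (64 / 81) ^ S)) := by
  set P : Measure (Fin n → Plane) := Measure.pi fun _ => uniformSquare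
  have hw : (0 : ℝ) < W.card := by exact_mod_cast hW
  have h1 : P {x | ¬ ∀ i, x i ∈ halfOpenSquare} = 0 := ae_mem_halfOpenSquare
  have h2 : ∀ s ∈ Finset.Icc 1 S, P {x | 2 * W.card * (9 / 8) ^ (S - s) ≤ dispersion x W s}
      ≤ ENNReal.ofReal (2 * (64 / 81) ^ S) := by
    intro s hs
    obtain ⟨hs1, hsS⟩ := Finset.mem_Icc.1 hs
    have hone : (1 : ℝ) ≤ (9 / 8) ^ (S - s) := one_le_pow₀ (by norm_num)
    refine (measure_mono ?_).trans ((pi_uniformSquare_dispersion_ge_le W s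
      (τ := W.card * (9 / 8) ^ (S - s)) (by positivity)).trans (ENNReal.ofReal_le_ofReal ?_))
    · intro x hx
      simp only [Set.mem_ofPred_eq] at hx ⊢
      nlinarith
    · have h3 : (81 / 64 : ℝ) ^ S ≤ 2 ^ s * ((9 / 8) ^ (S - s)) ^ 2 := by
        calc (81 / 64 : ℝ) ^ S = (81 / 64) ^ s * (81 / 64) ^ (S - s) := by
              rw [← pow_add]; congr 1; omega
          _ ≤ 2 ^ s * (81 / 64) ^ (S - s) := by
              gcongr; norm_num
          _ = _ := by rw [← pow_mul, mul_comm (S - s), pow_mul]; norm_num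
      rw [div_le_iff₀ (by positivity)]
      have h4 : (64 / 81 : ℝ) ^ S * (81 / 64) ^ S = 1 := by
        rw [← mul_pow]; norm_num
      calc 2 * (W.card : ℝ) ^ 2 = 2 * W.card ^ 2 * ((64 / 81 : ℝ) ^ S * (81 / 64) ^ S) := by
            rw [h4, mul_one]
        _ ≤ 2 * W.card ^ 2 * ((64 / 81 : ℝ) ^ S * (2 ^ s * ((9 / 8) ^ (S - s)) ^ 2)) := by gcongr
        _ = _ := by ring
  have hcover : {x | ¬ EvenlySpread x W S} ⊆ {x | ¬ ∀ i, x i ∈ halfOpenSquare} ∪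
      ⋃ s ∈ Finset.Icc 1 S, {x | 2 * W.card * (9 / 8) ^ (S - s) ≤ dispersion x W s} := by
    intro x hx
    by_contra hcon
    apply hx
    rw [Set.mem_union, not_or] at hcon
    refine ⟨not_not.1 hcon.1, fun s h1 h2 => ?_⟩
    by_contra h
    exact hcon.2 (Set.mem_biUnion (Finset.mem_coe.2 (Finset.mem_Icc.2 ⟨h1, h2⟩)) (not_lt.1 h))
  refine (measure_mono hcover).trans ((measure_union_le _ _).trans ?_)
  rw [h1, zero_add]
  refine (measure_biUnion_finset_le _ _).trans ((Finset.sum_le_card_nsmul _ _ _ h2).trans ?_)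
  rw [Nat.card_Icc, nsmul_eq_mul, ← ENNReal.ofReal_natCast, ← ENNReal.ofReal_mul (by positivity)]
  apply ENNReal.ofReal_le_ofReal
  simp
  linarith

theorem tendsto_stage_error :
    Tendsto (fun S : ℕ => (S : ℝ) * Real.exp (-(4096 * (9 / 8) ^ S))) atTop (𝓝 0) := by
  have h := tendsto_self_mul_const_pow_of_lt_one (r := 8 / 9) (by norm_num) (by norm_num)
  refine squeeze_zero (fun S => by positivity) (fun S => ?_) h
  gcongr
  have h1 : (9 / 8 : ℝ) ^ S ≤ Real.exp (4096 * (9 / 8) ^ S) := by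
    have := Real.add_one_le_exp (4096 * (9 / 8 : ℝ) ^ S)
    nlinarith [show (0 : ℝ) < (9 / 8) ^ S by positivity]
  rw [Real.exp_neg, show (8 / 9 : ℝ) = (9 / 8)⁻¹ by norm_num, inv_pow]
  gcongr

/-- The term (5/4)^S, from the size of the colour blocks, outgrows the term (9/8)^S, from the number
of cuts. -/
theorem tendsto_connect_error :
    Tendsto (fun S : ℕ => Real.exp (2 ^ 15 * (9 / 8) ^ S - (5 / 4) ^ S / 8192 + 1 / 16))
      atTop (𝓝 0) := by
  rw [Real.tendsto_exp_comp_nhds_zero]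
  have h1 : Tendsto (fun S : ℕ => (2 ^ 15 * (9 / 10) ^ S - 1 / 8192 : ℝ)) atTop
      (𝓝 (2 ^ 15 * 0 - 1 / 8192)) :=
    ((tendsto_pow_atTop_nhds_zero_of_lt_one (by norm_num) (by norm_num)).const_mul _).sub_const _
  have h2 : Tendsto (fun S : ℕ => (5 / 4 : ℝ) ^ S) atTop atTop :=
    tendsto_pow_atTop_atTop_of_one_lt (by norm_num)
  have h3 := (h2.atTop_mul_neg (by norm_num) h1).atBot_add (tendsto_const_nhds (x := (1 / 16 : ℝ)))
  refine h3.congr fun S => ?_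
  have : (9 / 8 : ℝ) ^ S = (5 / 4) ^ S * (9 / 10) ^ S := by rw [← mul_pow]; norm_num
  rw [this]
  ring

theorem tendsto_leaf_error :
    Tendsto (fun z : ℕ => (z : ℝ) * ((z : ℝ) ^ 2 * Real.exp (-((z + 1) / 8)))) atTop (𝓝 0) := by
  have h1 : Tendsto (fun z : ℕ => (z : ℝ)) atTop atTop := tendsto_natCast_atTop_atTop
  have h2 := ((Real.tendsto_pow_mul_exp_neg_atTop_nhds_zero 3).comp
    (h1.atTop_div_const (show (0 : ℝ) < 8 by norm_num))).const_mul (512 : ℝ)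
  rw [mul_zero] at h2
  refine squeeze_zero (fun z => by positivity) (fun z => ?_) h2
  have : Real.exp (-(((z : ℝ) + 1) / 8)) ≤ Real.exp (-(z / 8)) := by
    apply Real.exp_le_exp.2; linarith
  calc (z : ℝ) * ((z : ℝ) ^ 2 * Real.exp (-((z + 1) / 8)))
      ≤ (z : ℝ) * ((z : ℝ) ^ 2 * Real.exp (-(z / 8))) := by gcongr
    _ = 512 * ((z / 8) ^ 3 * Real.exp (-(z / 8))) := by ring

/-- The estimate for the number `M` of classes left after all stages. -/
theorem connect_error_le {w S z M : ℕ} (hS : 4096 * 2 ^ S ≤ w) (hwS : w ≤ 8192 * 2 ^ S)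
    (hS1 : 1 ≤ S) (hz : w ≤ (z + 1) ^ 2) (hM : M = ⌊(w * (9 / 16) ^ (S - 1) : ℝ)⌋₊) :
    2 ^ M * M * Real.exp (-((z / M : ℕ) / 16))
        ≤ Real.exp (2 ^ 15 * (9 / 8) ^ S - (5 / 4) ^ S / 8192 + 1 / 16) ∧
      (M : ℝ) ≤ 256 * √w := by
  have hS' : (4096 : ℝ) * 2 ^ S ≤ w := by exact_mod_cast hS
  have hwS' : (w : ℝ) ≤ 8192 * 2 ^ S := by exact_mod_cast hwS
  have h0 : (0 : ℝ) < √2 := by positivity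
  have hsq : √2 * √2 = 2 := Real.mul_self_sqrt (by norm_num)
  have h141 : 1.41 ≤ √2 := by
    apply Real.le_sqrt_of_sq_le; norm_num
  have h2S : (√2 ^ S) ^ 2 = 2 ^ S := by rw [← pow_mul, mul_comm S, pow_mul, sq √2, hsq]
  have hqS : (9 / 16 : ℝ) ^ (S - 1) = 16 / 9 * (9 / 16) ^ S := by
    obtain ⟨r, rfl⟩ : ∃ r, S = r + 1 := ⟨S - 1, by omega⟩
    rw [pow_succ]; simp; ring
  have h98 : (9 / 8 : ℝ) ^ S = 2 ^ S * (9 / 16) ^ S := by rw [← mul_pow]; norm_num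
  -- The constant comes from 8192 · 16/9 ≤ 2^14.
  have hM1 : (M : ℝ) ≤ 2 ^ 14 * (9 / 8) ^ S := by
    rw [hM]
    refine (Nat.floor_le (by positivity)).trans ?_
    rw [hqS, h98]
    have : (0 : ℝ) < (9 / 16) ^ S := by positivity
    nlinarith [mul_le_mul_of_nonneg_right hwS' this.le, show (0 : ℝ) < 2 ^ S * (9 / 16) ^ S by
      positivity]
  have hM0 : 1 ≤ M := by
    rw [hM]
    apply Nat.le_floor
    rw [hqS]
    have h3 : (1 : ℝ) ≤ (9 / 8) ^ S := one_le_pow₀ (by norm_num)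
    rw [h98] at h3
    have : (0 : ℝ) < (9 / 16) ^ S := by positivity
    push_cast
    nlinarith [mul_le_mul_of_nonneg_right hS' this.le]
  have hsw : 64 * √2 ^ S ≤ √w := by
    apply Real.le_sqrt_of_sq_le
    rw [mul_pow, h2S]; linarith
  constructor
  · have hz1 : √w ≤ z + 1 := by
      rw [Real.sqrt_le_left (by positivity)]
      exact_mod_cast hz
    have h1S : (1 : ℝ) ≤ √2 ^ S := one_le_pow₀ (by linarith)
    have hz2 : 32 * √2 ^ S ≤ z := by linarith
    -- The base 5/4 is admissible because 5/4 · 9/8 = 45/32 < √2; the 1 is lost to rounding in the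
    -- division.
    have hdiv : (5 / 4 : ℝ) ^ S / 512 - 1 ≤ (z / M : ℕ) := by
      have h3 : (z : ℝ) / M ≤ (z / M : ℕ) + 1 := by
        have := Nat.lt_floor_add_one ((z : ℝ) / M)
        rw [Nat.floor_div_eq_div] at this
        exact this.le
      have h4 : (5 / 4 : ℝ) ^ S / 512 ≤ z / M := by
        rw [le_div_iff₀ (by exact_mod_cast hM0)]
        calc (5 / 4 : ℝ) ^ S / 512 * M ≤ (5 / 4 : ℝ) ^ S / 512 * (2 ^ 14 * (9 / 8) ^ S) := by
              gcongr
          _ = 32 * (5 / 4 * (9 / 8)) ^ S := by rw [mul_pow]; ring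
          _ ≤ 32 * √2 ^ S := by
              gcongr
              norm_num at h141 ⊢
              linarith
          _ ≤ z := hz2
      linarith
    have h2M : (2 : ℝ) ^ M * M ≤ Real.exp (2 * M) := by
      have h5 : (2 : ℝ) ^ M ≤ Real.exp M := by
        calc (2 : ℝ) ^ M ≤ Real.exp 1 ^ M := by
              gcongr
              linarith [Real.add_one_le_exp (1 : ℝ)]
          _ = Real.exp M := by rw [← Real.exp_nat_mul, mul_one]
      have h6 : (M : ℝ) ≤ Real.exp M := by linarith [Real.add_one_le_exp (M : ℝ)]
      calc (2 : ℝ) ^ M * M ≤ Real.exp M * Real.exp M := by gcongr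
        _ = _ := by rw [← Real.exp_add]; ring_nf
    calc 2 ^ M * M * Real.exp (-((z / M : ℕ) / 16))
        ≤ Real.exp (2 * M) * Real.exp (-((z / M : ℕ) / 16)) := by gcongr
      _ = Real.exp (2 * M - (z / M : ℕ) / 16) := by rw [← Real.exp_add]; ring_nf
      _ ≤ _ := by
          apply Real.exp_le_exp.2
          linarith
  · have h3 : (9 / 8 : ℝ) ^ S ≤ √2 ^ S := by
      gcongr
      norm_num at h141 ⊢
      linarith
    calc (M : ℝ) ≤ 2 ^ 14 * √2 ^ S := hM1.trans (by gcongr)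
      _ = 256 * (64 * √2 ^ S) := by ring
      _ ≤ _ := by gcongr

/-- With high probability there is a rainbow spanning tree of length `O(√n)`. -/
theorem exists_short_rainbow_tree_whp :
    ∃ C : ℝ, 0 < C ∧ ∃ (H : (n : ℕ) → Set (Fin n → Plane)) (η δ : ℕ → ℝ),
      Tendsto η atTop (𝓝 0) ∧ Tendsto δ atTop (𝓝 0) ∧
      (∀ᶠ n in atTop, Measure.pi (fun _ : Fin n => uniformSquare) (H n)
        ≤ ENNReal.ofReal (η n)) ∧
      ∀ᶠ n in atTop, ∀ x ∉ H n, freq (treeEvent (κ := Fin (n - 1))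
        (fun e : KnEdge n => edgeLength x e.1) (C * √n))ᶜ ≤ δ n := by
  -- `W` is fixed in advance, independently of the points.
  have hWex : ∀ n : ℕ, ∃ W : Finset (Fin n), W.card = n - Nat.sqrt n := fun n => by
    obtain ⟨W, -, hW⟩ := Finset.exists_subset_card_eq
      (s := (Finset.univ : Finset (Fin n))) (n := n - Nat.sqrt n) (by simp)
    exact ⟨W, hW⟩
  choose W hW using hWex
  let S : ℕ → ℕ := fun n => Nat.log 2 ((n - Nat.sqrt n) / 4096)
  have hsqrt : Tendsto Nat.sqrt atTop atTop := by
    refine tendsto_atTop.2 fun b => ?_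
    filter_upwards [eventually_ge_atTop (b * b)] with n hn
    exact Nat.le_sqrt.2 hn
  have hsqrt_le : ∀ᶠ n in atTop, 2 * Nat.sqrt n ≤ n := by
    filter_upwards [hsqrt.eventually_ge_atTop 2] with n hn
    have := Nat.sqrt_le n
    nlinarith
  have hS : Tendsto S atTop atTop := by
    refine tendsto_atTop.2 fun b => ?_
    filter_upwards [hsqrt_le, eventually_ge_atTop (2 * (4096 * 2 ^ b))] with n h1 h2
    apply Nat.le_log_of_pow_le (by norm_num)
    rw [Nat.le_div_iff_mul_le (by norm_num)]
    omega
  -- The stages contribute 3000, the connecting edges 2 · 256 and the leaves 2.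
  refine ⟨4000, by norm_num, fun n => {x | ¬ EvenlySpread x (W n) (S n)},
    fun n => 2 * (S n * (64 / 81) ^ S n),
    fun n => S n * Real.exp (-(4096 * (9 / 8) ^ S n))
      + Real.exp (2 ^ 15 * (9 / 8) ^ S n - (5 / 4) ^ S n / 8192 + 1 / 16)
      + Nat.sqrt n * ((Nat.sqrt n : ℝ) ^ 2 * Real.exp (-((Nat.sqrt n + 1) / 8))), ?_, ?_, ?_, ?_⟩
  · have := ((tendsto_self_mul_const_pow_of_lt_one (r := 64 / 81) (by norm_num)
      (by norm_num)).comp hS).const_mul 2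
    simpa using this
  · have := ((tendsto_stage_error.comp hS).add (tendsto_connect_error.comp hS)).add
      (tendsto_leaf_error.comp hsqrt)
    simpa using this
  · filter_upwards [hsqrt_le, eventually_ge_atTop 1] with n h1 h2
    apply pi_uniformSquare_not_evenlySpread_le
    rw [hW]
    omega
  · filter_upwards [hsqrt_le, hS.eventually_ge_atTop 1, hsqrt.eventually_ge_atTop 1,
      (tendsto_leaf_error.comp hsqrt).eventually_le_const (show (0 : ℝ) < 1 by norm_num)]
      with n h1 hS1 h3 h4 x hx
    replace hx : EvenlySpread x (W n) (S n) := not_not.1 hx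
    have hne : (n - Nat.sqrt n) / 4096 ≠ 0 := by
      intro h
      simp only [S, h, Nat.log_zero_right] at hS1
      omega
    have hlow : 4096 * 2 ^ S n ≤ (W n).card := by
      have := Nat.pow_log_le_self 2 hne
      rw [Nat.le_div_iff_mul_le (by norm_num)] at this
      rw [hW, mul_comm]
      exact this
    have hupp : (W n).card ≤ 8192 * 2 ^ S n := by
      have := Nat.lt_pow_succ_log_self (b := 2) (by norm_num) ((n - Nat.sqrt n) / 4096)
      rw [Nat.div_lt_iff_lt_mul (by norm_num)] at this
      rw [hW]
      refine this.le.trans (le_of_eq ?_)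
      simp only [S, Nat.succ_eq_add_one, pow_succ]
      ring
    have hz : (W n)ᶜ.card = Nat.sqrt n := by
      rw [Finset.card_compl, Fintype.card_fin, hW]; omega
    have hexp : (Nat.sqrt n : ℝ) ^ 2 * Real.exp (-((Nat.sqrt n + 1) / 8)) ≤ 1 := by
      refine le_trans ?_ h4
      refine le_mul_of_one_le_left (by positivity) ?_
      exact_mod_cast h3
    obtain ⟨M, hM⟩ : ∃ M : ℕ, M = ⌊((W n).card * (9 / 16) ^ (S n - 1) : ℝ)⌋₊ := ⟨_, rfl⟩
    have hfreq := freq_compl_treeEvent_le hx hlow hS1 (by rw [hW]; omega) (by rw [hW]; omega) hz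
      hM hexp
    have hwz : (W n).card ≤ (Nat.sqrt n + 1) ^ 2 := by
      have := Nat.lt_succ_sqrt n
      rw [hW, sq]
      exact (Nat.sub_le _ _).trans this.le
    obtain ⟨he, hMw⟩ := connect_error_le hlow hupp hS1 hwz hM
    refine (freq_mono ?_).trans (hfreq.trans (by gcongr))
    rw [Set.compl_subset_compl]
    rintro χ ⟨F, a1, a2, a3⟩
    refine ⟨F, a1, a2, a3.trans ?_⟩
    have b1 : stageLength (W n).card (S n) (S n - 1) ≤ 3000 * √((W n).card : ℝ) :=
      stageLength_le (by omega) (by positivity) (by exact_mod_cast hupp)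
    have b2 : √((W n).card : ℝ) ≤ √(n : ℝ) := by
      apply Real.sqrt_le_sqrt
      rw [hW]
      exact_mod_cast Nat.sub_le _ _
    have b3 : (Nat.sqrt n : ℝ) ≤ √(n : ℝ) := by
      apply Real.le_sqrt_of_sq_le
      exact_mod_cast Nat.sqrt_le' n
    have b4 := Real.sqrt_nonneg (n : ℝ)
    linarith

/-! ### Exchanging isolated pairs into a spanning tree -/

section Exchange

variable {n : ℕ} {x : Fin n → Plane}

theorem totalLength_eq_sum {T : SimpleGraph (Fin n)} {E : Finset (Sym2 (Fin n))}
    (h : (E : Set (Sym2 (Fin n))) = T.edgeSet) : totalLength x T = ∑ e ∈ E, edgeLength x e := by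
  classical
  unfold totalLength
  congr 1
  ext e
  rw [SimpleGraph.mem_edgeFinset, ← h, Finset.mem_coe]

theorem SimpleGraph.Connected.of_adj_reachable {V : Type*} {G H : SimpleGraph V}
    (hG : G.Connected) (h : ∀ u v, G.Adj u v → H.Reachable u v) : H.Connected := by
  have := hG.nonempty
  refine ⟨fun u v => ?_⟩
  obtain ⟨p⟩ := hG.preconnected u v
  induction p with
  | nil => exact SimpleGraph.Reachable.refl _
  | cons hadj _ ih => exact (h _ _ hadj).trans ih

/-- An edge `ab` much shorter than all others at `a` can be exchanged into a spanning tree. -/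
theorem exists_exchange {T : SimpleGraph (Fin n)} (hT : T.IsTree) {a b : Fin n} (hab : a ≠ b)
    (hnot : s(a, b) ∉ T.edgeSet) {g : ℝ}
    (hiso : ∀ c, c ≠ a → c ≠ b → dist (x a) (x b) + g ≤ dist (x a) (x c)) :
    ∃ T' : SimpleGraph (Fin n), T'.IsTree ∧ totalLength x T' + g ≤ totalLength x T ∧
      ∃ c, c ≠ a ∧ c ≠ b ∧ T'.edgeSet = insert s(a, b) (T.edgeSet \ {s(a, c)}) := by
  classical
  -- The first edge ac of the tree path from a to b is replaced by ab. The rest of the path never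
  -- returns to a, so it survives and connects c with b.
  obtain ⟨p, hp⟩ := (hT.connected.preconnected a b).exists_isPath
  cases p with
  | nil => exact absurd rfl hab
  | @cons _ c _ hac q =>
    have hq := SimpleGraph.Walk.cons_isPath_iff _ _ |>.1 hp
    have hca : c ≠ a := hac.ne'
    have hcb : c ≠ b := by rintro rfl; exact hnot hac
    set T' := SimpleGraph.fromEdgeSet (insert s(a, b) (T.edgeSet \ {s(a, c)})) with hT'
    have hE : T'.edgeSet = insert s(a, b) (T.edgeSet \ {s(a, c)}) := by
      rw [hT', SimpleGraph.edgeSet_fromEdgeSet, sdiff_eq_left, Set.disjoint_left]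
      rintro e (rfl | he) h
      · exact hab h
      · exact SimpleGraph.not_isDiag_of_mem_edgeSet _ he.1 h
    have hreach : T'.Reachable c b := by
      refine ⟨q.transfer T' fun e he => ?_⟩
      rw [hE]
      refine Or.inr ⟨q.edges_subset_edgeSet he, ?_⟩
      rintro rfl
      exact hq.2 (q.fst_mem_support_of_mem_edges he)
    have hadj : T'.Adj a b := by
      rw [← SimpleGraph.mem_edgeSet, hE]; exact Set.mem_insert _ _
    have hconn : T'.Connected := by
      refine SimpleGraph.Connected.of_adj_reachable hT.connected fun u v huv => ?_
      by_cases h : s(u, v) = s(a, c)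
      · have hac' : T'.Reachable a c := hadj.reachable.trans hreach.symm
        rcases Sym2.eq_iff.1 h with ⟨rfl, rfl⟩ | ⟨rfl, rfl⟩
        · exact hac'
        · exact hac'.symm
      · refine SimpleGraph.Adj.reachable ?_
        rw [← SimpleGraph.mem_edgeSet, hE]
        exact Or.inr ⟨huv, h⟩
    refine ⟨T', ?_, ?_, c, hca, hcb, hE⟩
    · rw [SimpleGraph.isTree_iff_connected_and_card] at hT ⊢
      refine ⟨hconn, ?_⟩
      rw [← hT.2, hE, Nat.card_coe_set_eq, Nat.card_coe_set_eq, Set.ncard_exchange hnot hac]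
    · have h1 : totalLength x T = ∑ e ∈ T.edgeFinset, edgeLength x e :=
        totalLength_eq_sum (by simp)
      have h2 : totalLength x T'
          = ∑ e ∈ insert s(a, b) (T.edgeFinset.erase s(a, c)), edgeLength x e :=
        totalLength_eq_sum (by rw [hE]; simp)
      have hmem : s(a, c) ∈ T.edgeFinset := by simpa using hac
      rw [Finset.sum_insert (by
        simp only [Finset.mem_erase, SimpleGraph.mem_edgeFinset]
        exact fun h => hnot h.2)] at h2
      have h3 := Finset.add_sum_erase T.edgeFinset (fun e => edgeLength x e) hmem
      have h4 := hiso c hca hcb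
      have h5 : edgeLength x s(a, b) = dist (x a) (x b) := rfl
      have h6 : edgeLength x s(a, c) = dist (x a) (x c) := rfl
      simp only [h6] at h3
      rw [h1, h2, ← h3, h5]
      linarith

open Classical in
/-- Every spanning tree that misses many isolated pairs is much longer than some other one. -/
theorem exists_shorter_tree {P : Finset (KnEdge n)} {g : ℝ} (hg : 0 < g)
    (hP : ∀ e ∈ P, ∀ a b, e.1 = s(a, b) → ∀ c, c ≠ a → c ≠ b →
      dist (x a) (x b) + g ≤ dist (x a) (x c))
    {T : SimpleGraph (Fin n)} (hT : T.IsTree) :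
    ∃ T' : SimpleGraph (Fin n), T'.IsTree ∧
      totalLength x T' + g * (P.filter fun e => e.1 ∉ T.edgeSet).card ≤ totalLength x T := by
  induction hm : (P.filter fun e => e.1 ∉ T.edgeSet).card generalizing T with
  | zero => exact ⟨T, hT, by simp⟩
  | succ m ih =>
    obtain ⟨e, he⟩ := Finset.card_pos.1 (by omega : 0 < (P.filter fun e => e.1 ∉ T.edgeSet).card)
    obtain ⟨heP, heT⟩ := Finset.mem_filter.1 he
    obtain ⟨a, b, hab⟩ : ∃ a b, e.1 = s(a, b) := by
      induction h : e.1 using Sym2.ind with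
      | _ a b => exact ⟨a, b, rfl⟩
    have hne : a ≠ b := by
      have := e.2
      rw [hab] at this
      simpa using this
    obtain ⟨T₁, hT₁, hlen, c, hca, hcb, hE⟩ := exists_exchange hT hne (hab ▸ heT) (hP e heP a b hab)
    have hcard : (P.filter fun e => e.1 ∉ T₁.edgeSet).card = m := by
      have : (P.filter fun e => e.1 ∉ T₁.edgeSet) = (P.filter fun e => e.1 ∉ T.edgeSet).erase e := by
        ext f
        simp only [Finset.mem_filter, Finset.mem_erase, hE, Set.mem_insert_iff, not_or]
        constructor
        · rintro ⟨hf, h1, h2⟩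
          refine ⟨fun h => h1 (by rw [h, hab]), hf, fun h => h2 ⟨h, ?_⟩⟩
          intro h3
          -- The removed edge ac is not an isolated pair: otherwise ab and ac would each be shorter
          -- than the other by g. So every exchange lowers the number of missing pairs by exactly
          -- one.
          have h4 := hP f hf a c h3 b hne.symm hcb.symm
          have h5 := hP e heP a b hab c hca hcb
          linarith
        · rintro ⟨h1, hf, h2⟩
          exact ⟨hf, fun h => h1 (Subtype.ext (h.trans hab.symm)), fun h => h2 h.1⟩
      rw [this, Finset.card_erase_of_mem he, hm]
      rfl
    obtain ⟨T₂, hT₂, hlen₂⟩ := ih hT₁ hcard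
    refine ⟨T₂, hT₂, ?_⟩
    push_cast
    linarith

/-- A rainbow tree contains at most one pair of each colour, so the repeated colours among the pairs
bound from below the number of pairs it misses. -/
theorem exists_shorter_tree_of_rainbow {κ : Type*} [DecidableEq κ] {P : Finset (KnEdge n)} {g : ℝ}
    (hg : 0 < g) (hP : ∀ e ∈ P, ∀ a b, e.1 = s(a, b) → ∀ c, c ≠ a → c ≠ b →
      dist (x a) (x b) + g ≤ dist (x a) (x c))
    {T : SimpleGraph (Fin n)} (hT : T.IsTree) {χ : KnEdge n → κ} (hχ : IsRainbow χ T) :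
    ∃ T' : SimpleGraph (Fin n), T'.IsTree ∧
      totalLength x T' + g * (P.card - (P.image χ).card) ≤ totalLength x T := by
  classical
  obtain ⟨T', hT', h⟩ := exists_shorter_tree hg hP hT
  refine ⟨T', hT', le_trans ?_ h⟩
  have h1 : (P.filter fun e => e.1 ∈ T.edgeSet).card ≤ (P.image χ).card := by
    refine Finset.card_le_card_of_injOn χ ?_ ?_
    · intro e he
      exact Finset.mem_image_of_mem χ (Finset.mem_filter.1 he).1
    · intro e he e' he' hee
      exact hχ (Finset.mem_filter.1 he).2 (Finset.mem_filter.1 he').2 hee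
  have h2 := Finset.card_filter_add_card_filter_not (s := P) (fun e => e.1 ∈ T.edgeSet)
  have h3 : (P.card : ℝ) ≤ (P.image χ).card + (P.filter fun e => e.1 ∉ T.edgeSet).card := by
    exact_mod_cast (by omega : P.card ≤ (P.image χ).card + (P.filter fun e => e.1 ∉ T.edgeSet).card)
  gcongr
  linarith

end Exchange

/-! ### Colour coincidences -/

/-- A linear number of edges have many coincidences among their colours. -/
theorem freq_card_image_gt_le {ι κ : Type*} [Fintype ι] [DecidableEq ι] [Fintype κ] [DecidableEq κ]
    [Nonempty κ] (P : Finset ι)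
    {h : ℕ} (hP : P.card = 2 * h) (hh : 0 < h) (hκ : h ≤ Fintype.card κ) :
    freq {χ : ι → κ | (2 * h - (h : ℝ) ^ 2 / (2 * Fintype.card κ)) < (P.image χ).card}
      ≤ 4 * (Fintype.card κ : ℝ) ^ 3 / h ^ 4 := by
  set N : ℝ := (Fintype.card κ : ℝ) with hN
  have hN0 : 0 < N := by rw [hN]; exact_mod_cast Fintype.card_pos
  have hh0 : (0 : ℝ) < h := by exact_mod_cast hh
  have hhN : (h : ℝ) ≤ N := by rw [hN]; exact_mod_cast hκ
  have h1N : 1 / N ≤ 1 := by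
    rw [div_le_one hN0, hN]; exact_mod_cast Fintype.card_pos
  set p : ℝ := (1 - 1 / N) ^ (2 * h) with hp
  have hp1 : p ≤ 1 := pow_le_one₀ (by linarith) (by have : 0 < 1 / N := by positivity
                                                    linarith)
  have hp0 : 0 ≤ p := pow_nonneg (by linarith) _
  let E : κ → Set (ι → κ) := fun c => {χ | ∀ i ∈ P, χ i ∉ ({c} : Finset κ)}
  -- The count is that of colours absent from `P`. Absences are negatively correlated, 1 - 2/N ≤ (1
  -- - 1/N)², so ε = 0.
  have hcheb := freq_abs_count_sub_ge_le Finset.univ E (p := p) (ε := 0)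
    (τ := (h : ℝ) ^ 2 / (2 * N))
    (fun c _ => by
      rw [freq_avoid, hP, Finset.card_singleton, Nat.cast_one])
    (fun c _ c' _ hcc => by
      have : E c ∩ E c' = {χ | ∀ i ∈ P, χ i ∉ ({c, c'} : Finset κ)} := by
        ext χ
        simp only [E, Set.mem_inter_iff, Set.mem_ofPred_eq, ← forall₂_and, Finset.mem_singleton,
          Finset.mem_insert, not_or]
      rw [this, freq_avoid, hP, Finset.card_pair hcc, add_zero, one_mul, hp, ← pow_mul,
        mul_comm (2 * h) 2, pow_mul (1 - 1 / N)]
      have h2N : (2 : ℝ) ≤ N := by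
        have := Finset.card_le_univ ({c, c'} : Finset κ)
        rw [Finset.card_pair hcc] at this
        rw [hN]; exact_mod_cast this
      push_cast
      rw [← hN]
      apply pow_le_pow_left₀
      · rw [sub_nonneg, div_le_one hN0]; exact h2N
      · have : (1 - 1 / N) ^ 2 = 1 - 2 / N + (1 / N) ^ 2 := by ring
        rw [this]
        have := sq_nonneg (1 / N)
        linarith)
    le_rfl (by positivity) (fun χ => N - (P.image χ).card)
    (fun χ => by
      have : ∀ c, Set.indicator (E c) (fun _ => (1 : ℝ)) χ = 1 - if c ∈ P.image χ then 1 else 0 := by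
        intro c
        by_cases h : c ∈ P.image χ
        · rw [if_pos h, Set.indicator_of_notMem, sub_self]
          obtain ⟨i, hi, rfl⟩ := Finset.mem_image.1 h
          intro h'
          exact h' i hi (Finset.mem_singleton_self _)
        · rw [if_neg h, Set.indicator_of_mem, sub_zero]
          intro i hi h'
          exact h (Finset.mem_singleton.1 h' ▸ Finset.mem_image_of_mem χ hi)
      simp_rw [this]
      rw [Finset.sum_sub_distrib, Finset.sum_boole, Finset.filter_mem_eq_inter, Finset.univ_inter]
      simp [hN])
  refine (freq_mono ?_).trans (hcheb.trans ?_)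
  · intro χ hχ
    simp only [Set.mem_ofPred_eq] at hχ ⊢
    -- Bernoulli's inequality for the exponent h, then squared; this is why |P| is written as 2h. On
    -- average at least N - 2h + h²/N colours are absent, and half of the excess h²/N is given up as
    -- the deviation.
    have hbern : (1 - h / N) ^ 2 ≤ p := by
      rw [hp, mul_comm, pow_mul]
      have h1 := one_add_mul_le_pow (show (-2 : ℝ) ≤ -(1 / N) by linarith) h
      have h2 : 1 - h / N ≤ (1 - 1 / N) ^ h := by
        calc 1 - h / N = 1 + h * -(1 / N) := by ring
          _ ≤ _ := h1
      exact pow_le_pow_left₀ (by rw [sub_nonneg, div_le_one hN0]; exact hhN) h2 2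
    have h3 : N - 2 * h + h ^ 2 / N ≤ N * p := by
      calc N - 2 * h + (h : ℝ) ^ 2 / N = N * (1 - h / N) ^ 2 := by field_simp; ring
        _ ≤ _ := by gcongr
    have h4 : (h : ℝ) ^ 2 / (2 * N) = h ^ 2 / N / 2 := by field_simp
    rw [Finset.card_univ, ← hN, abs_sub_comm]
    refine le_trans ?_ (le_abs_self _)
    rw [h4] at hχ ⊢
    linarith
  · rw [zero_mul, add_zero, Finset.card_univ, ← hN, div_le_div_iff₀ (by positivity) (by positivity)]
    calc N * p * (h : ℝ) ^ 4 ≤ N * 1 * h ^ 4 := by gcongr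
      _ = 4 * N ^ 3 * ((h : ℝ) ^ 2 / (2 * N)) ^ 2 := by field_simp; ring

theorem prod_ite_mem_const {ι : Type*} [Fintype ι] [DecidableEq ι] (Q : Finset ι) (u v : ℝ) :
    ∏ k, (if k ∈ Q then u else v) = u ^ Q.card * v ^ (Fintype.card ι - Q.card) := by
  rw [Finset.prod_ite]
  simp only [Finset.prod_const]
  rw [Finset.filter_mem_eq_inter, Finset.univ_inter, ← Finset.card_compl]
  congr 3
  ext k
  simp

/-! ### Second moment of the number of isolated pairs -/

section Isolated

variable {L : ℕ}

/-- The cell `c` of the `5L × 5L` grid lies in the `5 × 5` block `β`. -/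
def InBlock (β : Fin L × Fin L) (c : Fin (5 * L) × Fin (5 * L)) : Prop :=
  (c.1 : ℕ) / 5 = β.1 ∧ (c.2 : ℕ) / 5 = β.2

instance (β : Fin L × Fin L) : DecidablePred (InBlock β) := fun _ => instDecidableAnd

/-- The cell in the middle of the block `β`. -/
def blockCentre (β : Fin L × Fin L) : Fin (5 * L) × Fin (5 * L) :=
  (⟨5 * β.1 + 2, by omega⟩, ⟨5 * β.2 + 2, by omega⟩)

theorem inBlock_blockCentre (β : Fin L × Fin L) : InBlock β (blockCentre β) := by
  constructor <;> simp only [blockCentre] <;> omega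

theorem InBlock.unique {β β' : Fin L × Fin L} {c : Fin (5 * L) × Fin (5 * L)} (h : InBlock β c)
    (h' : InBlock β' c) : β = β' :=
  Prod.ext (Fin.ext (h.1.symm.trans h'.1)) (Fin.ext (h.2.symm.trans h'.2))

theorem card_inBlock (β : Fin L × Fin L) : (Finset.univ.filter (InBlock β)).card = 25 := by
  have h1 : ∀ b : Fin L, (Finset.univ.filter fun j : Fin (5 * L) => (j : ℕ) / 5 = b).card = 5 := by
    intro b
    have : (Finset.univ.filter fun j : Fin (5 * L) => (j : ℕ) / 5 = b)
        = Finset.univ.image fun r : Fin 5 => (⟨5 * b + r, by omega⟩ : Fin (5 * L)) := by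
      ext j
      simp only [Finset.mem_filter, Finset.mem_univ, true_and, Finset.mem_image, Fin.ext_iff]
      constructor
      · intro h
        exact ⟨⟨j % 5, by omega⟩, by simp only; omega⟩
      · rintro ⟨r, hr⟩
        omega
    rw [this, Finset.card_image_of_injective _ fun r r' h => Fin.ext (by simpa using h)]
    simp
  have h2 : Finset.univ.filter (InBlock β)
      = (Finset.univ.filter fun j : Fin (5 * L) => (j : ℕ) / 5 = β.1) ×ˢ
        (Finset.univ.filter fun j : Fin (5 * L) => (j : ℕ) / 5 = β.2) := by
    ext c
    simp [InBlock]
  rw [h2, Finset.card_product, h1, h1]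

variable {n : ℕ}

/-- The cells allowed for the vertex `k` if the vertices in `q` are alone in the block `β`, and in
its middle. -/
def allowedCells (a : (Fin L × Fin L) × (Fin n × Fin n)) (k : Fin n) :
    Finset (Fin (5 * L) × Fin (5 * L)) :=
  if k = a.2.1 ∨ k = a.2.2 then {blockCentre a.1} else Finset.univ.filter fun c => ¬ InBlock a.1 c

/-- The event that exactly the two given vertices are in the block, and both in its middle. -/
def isolatedEvent (a : (Fin L × Fin L) × (Fin n × Fin n)) :
    Set (Fin n → Fin (5 * L) × Fin (5 * L)) :=
  {f | ∀ k, f k ∈ allowedCells a k}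

variable [NeZero L]

theorem freq_isolatedEvent {a : (Fin L × Fin L) × (Fin n × Fin n)} (ha : a.2.1 < a.2.2) :
    freq (isolatedEvent a) = (1 / (25 * (L : ℝ) ^ 2)) ^ 2 * (1 - 1 / (L : ℝ) ^ 2) ^ (n - 2) := by
  have hL : (0 : ℝ) < L := by exact_mod_cast NeZero.pos L
  have hcard : (Fintype.card (Fin (5 * L) × Fin (5 * L)) : ℝ) = 25 * (L : ℝ) ^ 2 := by
    simp; ring
  have hQ : ({a.2.1, a.2.2} : Finset (Fin n)).card = 2 := Finset.card_pair ha.ne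
  have := prod_ite_mem_const ({a.2.1, a.2.2} : Finset (Fin n)) (1 / (25 * (L : ℝ) ^ 2))
    (1 - 1 / (L : ℝ) ^ 2)
  rw [hQ, Fintype.card_fin] at this
  rw [isolatedEvent, freq_pi, ← this]
  refine Finset.prod_congr rfl fun k _ => ?_
  rw [hcard, allowedCells]
  by_cases hk : k = a.2.1 ∨ k = a.2.2
  · rw [if_pos hk, if_pos (by simpa using hk)]; simp
  · rw [if_neg hk, if_neg (by simpa using hk), Finset.filter_not, Finset.card_sdiff_of_subset
      (Finset.subset_univ _), card_inBlock, Nat.cast_sub (by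
        rw [← card_inBlock a.1]; exact Finset.card_le_univ _), Finset.card_univ, hcard]
    field_simp
    push_cast
    ring

/-- Two different events are either incompatible or concern different blocks and disjoint pairs. In
the second case put q = 1/L²; each of the other n - 4 vertices contributes 1 - 2q ≤ (1 - q)². The
square of the single probability has four more factors 1 - q, and 1 + 8q makes up for them when q ≤
1/8. -/
theorem freq_isolatedEvent_inter_le {a b : (Fin L × Fin L) × (Fin n × Fin n)}
    (ha : a.2.1 < a.2.2) (hb : b.2.1 < b.2.2) (hab : a ≠ b) (hL8 : 8 ≤ L ^ 2) :
    freq (isolatedEvent a ∩ isolatedEvent b) ≤ (1 + 8 / (L : ℝ) ^ 2) *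
      ((1 / (25 * (L : ℝ) ^ 2)) ^ 2 * (1 - 1 / (L : ℝ) ^ 2) ^ (n - 2)) ^ 2 := by
  have hL : (0 : ℝ) < L := by exact_mod_cast NeZero.pos L
  have hL8' : (8 : ℝ) ≤ (L : ℝ) ^ 2 := by exact_mod_cast hL8
  have hcard : (Fintype.card (Fin (5 * L) × Fin (5 * L)) : ℝ) = 25 * (L : ℝ) ^ 2 := by
    simp; ring
  have hv1 : 1 / (L : ℝ) ^ 2 ≤ 1 / 8 := by
    rw [div_le_div_iff₀ (by positivity) (by norm_num)]; linarith
  have hv0 : 0 < 1 / (L : ℝ) ^ 2 := by positivity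
  have hpos : 0 ≤ (1 + 8 / (L : ℝ) ^ 2) *
      ((1 / (25 * (L : ℝ) ^ 2)) ^ 2 * (1 - 1 / (L : ℝ) ^ 2) ^ (n - 2)) ^ 2 := by positivity
  by_cases hempty : ∃ k, Disjoint (allowedCells a k) (allowedCells b k)
  · obtain ⟨k, hk⟩ := hempty
    have : isolatedEvent a ∩ isolatedEvent b = ∅ := by
      rw [Set.eq_empty_iff_forall_notMem]
      rintro f ⟨h1, h2⟩
      exact Finset.disjoint_left.1 hk (h1 k) (h2 k)
    rw [this, freq_empty]
    exact hpos
  push Not at hempty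
  have hmix : ∀ {β β' : Fin L × Fin L}, β = β' →
      Disjoint {blockCentre β} (Finset.univ.filter fun c => ¬ InBlock β' c) := by
    rintro β _ rfl
    rw [Finset.disjoint_singleton_left, Finset.mem_filter, not_and, not_not]
    exact fun _ => inBlock_blockCentre β
  -- In the same block, a vertex of only one pair would have to be both in the middle cell and
  -- outside the block. So the pairs coincide as sets, and their ordering makes the indices equal.
  have hβ : a.1 ≠ b.1 := by
    intro hβ
    have hmem : ∀ k, (k = a.2.1 ∨ k = a.2.2) ↔ (k = b.2.1 ∨ k = b.2.2) := by
      intro k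
      by_contra hk
      apply hempty k
      unfold allowedCells
      by_cases h1 : k = a.2.1 ∨ k = a.2.2 <;> by_cases h2 : k = b.2.1 ∨ k = b.2.2
      · exact absurd (by tauto) hk
      · rw [if_pos h1, if_neg h2]; exact hmix hβ
      · rw [if_neg h1, if_pos h2]; exact (hmix hβ.symm).symm
      · exact absurd (by tauto) hk
    apply hab
    have h1 := (hmem a.2.1).1 (Or.inl rfl)
    have h2 := (hmem a.2.2).1 (Or.inr rfl)
    refine Prod.ext hβ ?_
    rcases h1 with h1 | h1 <;> rcases h2 with h2 | h2
    · exact absurd (h1.trans h2.symm) ha.ne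
    · exact Prod.ext h1 h2
    · rw [h1, h2] at ha; exact absurd ha hb.not_gt
    · exact absurd (h1.trans h2.symm) ha.ne
  have hdisj : Disjoint ({a.2.1, a.2.2} : Finset (Fin n)) {b.2.1, b.2.2} := by
    rw [Finset.disjoint_left]
    intro k h1 h2
    simp only [Finset.mem_insert, Finset.mem_singleton] at h1 h2
    apply hempty k
    unfold allowedCells
    rw [if_pos h1, if_pos h2, Finset.disjoint_singleton]
    intro h
    exact hβ ((inBlock_blockCentre a.1).unique (h ▸ inBlock_blockCentre b.1))
  set Q : Finset (Fin n) := {a.2.1, a.2.2} ∪ {b.2.1, b.2.2} with hQdef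
  have hQ : Q.card = 4 := by
    rw [hQdef, Finset.card_union_of_disjoint hdisj, Finset.card_pair ha.ne, Finset.card_pair hb.ne]
  have hn : 4 ≤ n := by
    have := Finset.card_le_univ Q
    rwa [hQ, Fintype.card_fin] at this
  have hinter : isolatedEvent a ∩ isolatedEvent b
      = {f | ∀ k, f k ∈ allowedCells a k ∩ allowedCells b k} := by
    ext f
    simp [isolatedEvent, forall_and]
  have hprod := prod_ite_mem_const Q (1 / (25 * (L : ℝ) ^ 2)) (1 - 2 / (L : ℝ) ^ 2)
  rw [hQ, Fintype.card_fin] at hprod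
  have hle : freq (isolatedEvent a ∩ isolatedEvent b)
      ≤ (1 / (25 * (L : ℝ) ^ 2)) ^ 4 * (1 - 2 / (L : ℝ) ^ 2) ^ (n - 4) := by
    rw [hinter, freq_pi, ← hprod]
    refine Finset.prod_le_prod (fun _ _ => by positivity) fun k _ => ?_
    rw [hcard]
    by_cases hk : k ∈ Q
    · rw [if_pos hk]
      gcongr
      have : (allowedCells a k ∩ allowedCells b k).card ≤ 1 := by
        rcases Finset.mem_union.1 hk with hk | hk
        · refine (Finset.card_le_card Finset.inter_subset_left).trans ?_
          rw [allowedCells, if_pos (by simpa using hk), Finset.card_singleton]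
        · refine (Finset.card_le_card Finset.inter_subset_right).trans ?_
          rw [allowedCells, if_pos (by simpa using hk), Finset.card_singleton]
      exact_mod_cast this
    · rw [if_neg hk]
      rw [hQdef, Finset.mem_union, not_or] at hk
      rw [allowedCells, allowedCells, if_neg (by simpa using hk.1), if_neg (by simpa using hk.2)]
      have h1 : (Finset.univ.filter fun c => ¬ InBlock a.1 c) ∩
          (Finset.univ.filter fun c => ¬ InBlock b.1 c)
          = (Finset.univ.filter (InBlock a.1) ∪ Finset.univ.filter (InBlock b.1))ᶜ := by
        ext c; simp
      have h2 : (Finset.univ.filter (InBlock a.1) ∪ Finset.univ.filter (InBlock b.1)).card = 50 := by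
        rw [Finset.card_union_of_disjoint, card_inBlock, card_inBlock]
        rw [Finset.disjoint_filter]
        exact fun c _ hc hc' => hβ (hc.unique hc')
      rw [h1, Finset.card_compl, Nat.cast_sub (Finset.card_le_univ _), h2, hcard]
      apply le_of_eq
      field_simp
      push_cast
      ring
  refine hle.trans ?_
  set q := 1 / (L : ℝ) ^ 2 with hq
  have h2q : 2 / (L : ℝ) ^ 2 = 2 * q := by rw [hq]; ring
  have h8q : 8 / (L : ℝ) ^ 2 = 8 * q := by rw [hq]; ring
  rw [h2q, h8q]
  have h3 : (1 - 2 * q) ^ (n - 4) ≤ ((1 - q) ^ 2) ^ (n - 4) := by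
    apply pow_le_pow_left₀ (by linarith)
    nlinarith
  have h4 : 1 ≤ (1 + 8 * q) * (1 - q) ^ 4 := by
    have h5 : 1 - 4 * q ≤ (1 - q) ^ 4 := by
      have := one_add_mul_le_pow (show (-2 : ℝ) ≤ -q by linarith) 4
      calc 1 - 4 * q = 1 + (4 : ℕ) * -q := by push_cast; ring
        _ ≤ (1 + -q) ^ 4 := this
        _ = _ := by ring
    have h6 : 1 ≤ (1 + 8 * q) * (1 - 4 * q) := by nlinarith
    exact h6.trans (by gcongr)
  have h7 : ((1 - q) ^ (n - 2)) ^ 2 = ((1 - q) ^ 2) ^ (n - 4) * (1 - q) ^ 4 := by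
    rw [← pow_mul, ← pow_mul, ← pow_add]
    congr 1
    omega
  calc (1 / (25 * (L : ℝ) ^ 2)) ^ 4 * (1 - 2 * q) ^ (n - 4)
      ≤ (1 / (25 * (L : ℝ) ^ 2)) ^ 4 * (((1 - q) ^ 2) ^ (n - 4) * 1) := by
        rw [mul_one]; gcongr
    _ ≤ (1 / (25 * (L : ℝ) ^ 2)) ^ 4 *
        (((1 - q) ^ 2) ^ (n - 4) * ((1 + 8 * q) * (1 - q) ^ 4)) := by gcongr
    _ = (1 + 8 * q) * ((1 / (25 * (L : ℝ) ^ 2)) ^ 2 * (1 - q) ^ (n - 2)) ^ 2 := by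
        rw [mul_pow _ ((1 - q) ^ (n - 2)), h7]; ring

end Isolated

open Classical in
/-- The pairs of vertices that are alone in their block and lie in its middle. -/
noncomputable def isolatedPairs {L n : ℕ} (f : Fin n → Fin (5 * L) × Fin (5 * L)) : Finset (KnEdge n) :=
  Finset.univ.filter fun e => ∃ a, a.2.1 < a.2.2 ∧ e.1 = s(a.2.1, a.2.2) ∧ f ∈ isolatedEvent a

/-- No edge is counted twice: the ordering recovers the pair from the edge, and the cell of its
vertices recovers the block. -/
theorem sum_indicator_isolatedEvent_le {L n : ℕ}
    (f : Fin n → Fin (5 * L) × Fin (5 * L)) :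
    ∑ a ∈ (Finset.univ : Finset (Fin L × Fin L)) ×ˢ incPairs (Finset.univ : Finset (Fin n)),
      Set.indicator (isolatedEvent a) (fun _ => (1 : ℝ)) f ≤ (isolatedPairs f).card := by
  classical
  simp only [Set.indicator_apply]
  rw [Finset.sum_boole]
  norm_cast
  rw [← Finset.card_image_of_injective (isolatedPairs f) Subtype.val_injective]
  refine Finset.card_le_card_of_injOn (fun a => s(a.2.1, a.2.2)) ?_ ?_
  · intro a ha
    obtain ⟨ha, hf⟩ := Finset.mem_filter.1 ha
    have hlt : a.2.1 < a.2.2 := (Finset.mem_filter.1 (Finset.mem_product.1 ha).2).2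
    exact Finset.mem_coe.2 (Finset.mem_image.2 ⟨⟨s(a.2.1, a.2.2), by simpa using hlt.ne⟩,
      Finset.mem_filter.2 ⟨Finset.mem_univ _, a, hlt, rfl, hf⟩, rfl⟩)
  · intro a ha b hb hab
    obtain ⟨ha, hfa⟩ := Finset.mem_filter.1 ha
    obtain ⟨hb, hfb⟩ := Finset.mem_filter.1 hb
    have hlta : a.2.1 < a.2.2 := (Finset.mem_filter.1 (Finset.mem_product.1 ha).2).2
    have hltb : b.2.1 < b.2.2 := (Finset.mem_filter.1 (Finset.mem_product.1 hb).2).2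
    have hpair : a.2 = b.2 := by
      rcases Sym2.eq_iff.1 hab with ⟨h1, h2⟩ | ⟨h1, h2⟩
      · exact Prod.ext h1 h2
      · rw [h1, h2] at hlta
        exact absurd hlta hltb.not_gt
    refine Prod.ext ?_ hpair
    have h1 := hfa a.2.1
    have h2 := hfb a.2.1
    rw [allowedCells, if_pos (Or.inl rfl), Finset.mem_singleton] at h1
    rw [allowedCells, if_pos (Or.inl (by rw [hpair])), Finset.mem_singleton] at h2
    exact (inBlock_blockCentre a.1).unique (by rw [← h1, h2]; exact inBlock_blockCentre b.1)

section IsolatedPairs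

variable {L : ℕ} [NeZero L] {n : ℕ} {x : Fin n → Plane}

theorem abs_coord_sub_le_dist (p q : Plane) (k : Fin 2) : |p k - q k| ≤ dist p q := by
  rw [EuclideanSpace.dist_eq, Fin.sum_univ_two]
  apply Real.le_sqrt_of_sq_le
  rw [Real.dist_eq, Real.dist_eq]
  fin_cases k
  · simp
    positivity
  · simp
    positivity

/-- Cells have side 1/(5L). Two points of one cell are at distance at most √2/(5L) ≤ 3/(10L), while
two full cells separate the middle of a block from its outside, which gives 4/(10L). -/
theorem dist_add_le_of_isolated {p q r : Plane} (hp : p ∈ halfOpenSquare)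
    (hq : q ∈ halfOpenSquare) (hr : r ∈ halfOpenSquare) {β : Fin L × Fin L}
    (h1 : cell (5 * L) (5 * L) p = blockCentre β) (h2 : cell (5 * L) (5 * L) q = blockCentre β)
    (h3 : ¬ InBlock β (cell (5 * L) (5 * L) r)) : dist p q + 1 / (10 * L) ≤ dist p r := by
  have hL : (0 : ℝ) < L := by exact_mod_cast NeZero.pos L
  have close : ∀ {t u : ℝ} {m : ℕ}, (m : ℝ) ≤ t * (5 * L : ℕ) ∧ t * (5 * L : ℕ) < m + 1 →
      (m : ℝ) ≤ u * (5 * L : ℕ) ∧ u * (5 * L : ℕ) < m + 1 → |t - u| ≤ 1 / (5 * L) := by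
    rintro t u m ⟨a1, a2⟩ ⟨b1, b2⟩
    push_cast at a1 a2 b1 b2
    rw [le_div_iff₀ (by positivity), ← abs_of_pos (show (0 : ℝ) < 5 * L by positivity), ← abs_mul,
      abs_le]
    constructor <;> linarith
  have far : ∀ {t u : ℝ} {m m' : ℕ}, (m : ℝ) ≤ t * (5 * L : ℕ) ∧ t * (5 * L : ℕ) < m + 1 →
      (m' : ℝ) ≤ u * (5 * L : ℕ) ∧ u * (5 * L : ℕ) < m' + 1 → (m' + 3 ≤ m ∨ m + 3 ≤ m') →
      2 / (5 * L) ≤ |t - u| := by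
    rintro t u m m' ⟨a1, a2⟩ ⟨b1, b2⟩ h
    push_cast at a1 a2 b1 b2
    rw [div_le_iff₀ (by positivity), ← abs_of_pos (show (0 : ℝ) < 5 * L by positivity), ← abs_mul,
      le_abs]
    rcases h with h | h
    · left
      have : (m' : ℝ) + 3 ≤ m := by exact_mod_cast h
      linarith
    · right
      have : (m : ℝ) + 3 ≤ m' := by exact_mod_cast h
      linarith
  have p1 := cell_fst_bounds (M := 5 * L) (N := 5 * L) hp
  have p2 := cell_snd_bounds (M := 5 * L) (N := 5 * L) hp
  have q1 := cell_fst_bounds (M := 5 * L) (N := 5 * L) hq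
  have q2 := cell_snd_bounds (M := 5 * L) (N := 5 * L) hq
  have r1 := cell_fst_bounds (M := 5 * L) (N := 5 * L) hr
  have r2 := cell_snd_bounds (M := 5 * L) (N := 5 * L) hr
  rw [h1] at p1 p2
  rw [h2] at q1 q2
  have hpq : dist p q ≤ 3 / (10 * L) := by
    rw [EuclideanSpace.dist_eq, Fin.sum_univ_two, Real.dist_eq, Real.dist_eq]
    apply Real.sqrt_le_iff.2 ⟨by positivity, ?_⟩
    have e1 := pow_le_pow_left₀ (abs_nonneg _) (close p1 q1) 2
    have e2 := pow_le_pow_left₀ (abs_nonneg _) (close p2 q2) 2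
    have e3 : (1 / (5 * L) : ℝ) ^ 2 + (1 / (5 * L)) ^ 2 ≤ (3 / (10 * L)) ^ 2 := by
      rw [div_pow, div_pow, mul_pow, mul_pow, ← add_div, div_le_div_iff₀ (by positivity)
        (by positivity)]
      nlinarith [show (0 : ℝ) < (L : ℝ) ^ 2 by positivity]
    linarith
  have hpr : 2 / (5 * L) ≤ dist p r := by
    rw [InBlock, not_and_or] at h3
    rcases h3 with h3 | h3
    · refine (far p1 r1 ?_).trans (abs_coord_sub_le_dist p r 0)
      simp only [blockCentre]
      omega
    · refine (far p2 r2 ?_).trans (abs_coord_sub_le_dist p r 1)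
      simp only [blockCentre]
      omega
  have : (2 / (5 * L) : ℝ) = 3 / (10 * L) + 1 / (10 * L) := by field_simp; norm_num
  linarith

theorem dist_add_le_of_mem_isolatedPairs (hx : ∀ i, x i ∈ halfOpenSquare) {e : KnEdge n}
    (he : e ∈ isolatedPairs fun i => cell (5 * L) (5 * L) (x i)) {u v c : Fin n}
    (huv : e.1 = s(u, v)) (hu : c ≠ u) (hv : c ≠ v) :
    dist (x u) (x v) + 1 / (10 * L) ≤ dist (x u) (x c) := by
  classical
  obtain ⟨a, -, hea, hf⟩ := (Finset.mem_filter.1 he).2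
  rw [huv] at hea
  have h0 : ∀ k, (k = u ∨ k = v) ↔ (k = a.2.1 ∨ k = a.2.2) := by
    intro k
    rw [← Sym2.mem_iff, hea, Sym2.mem_iff]
  have hin : ∀ k, (k = u ∨ k = v) → cell (5 * L) (5 * L) (x k) = blockCentre a.1 := by
    intro k hk
    have := hf k
    rw [allowedCells, if_pos ((h0 k).1 hk)] at this
    exact Finset.mem_singleton.1 this
  have hout : ¬ InBlock a.1 (cell (5 * L) (5 * L) (x c)) := by
    have := hf c
    rw [allowedCells, if_neg (fun h => by
      rcases (h0 c).2 h with h | h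
      · exact hu h
      · exact hv h)] at this
    exact (Finset.mem_filter.1 this).2
  exact dist_add_le_of_isolated (hx u) (hx v) (hx c) (hin u (Or.inl rfl)) (hin v (Or.inr rfl)) hout

/-- With high probability there is a linear number of isolated pairs. -/
theorem pi_uniformSquare_card_isolatedPairs_lt_le (hn : 8 ≤ n) (hnL : n < L ^ 2)
    (hLn : L ^ 2 ≤ 4 * n) : Measure.pi (fun _ : Fin n => uniformSquare)
      {x | ((isolatedPairs fun i => cell (5 * L) (5 * L) (x i)).card : ℝ) < n / 60000}
      ≤ ENNReal.ofReal (120032 / n) := by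
  have hL : (0 : ℝ) < L := by exact_mod_cast NeZero.pos L
  have hn0 : (8 : ℝ) ≤ n := by exact_mod_cast hn
  have hnL' : (n : ℝ) + 1 ≤ (L : ℝ) ^ 2 := by exact_mod_cast hnL
  have hLn' : (L : ℝ) ^ 2 ≤ 4 * n := by exact_mod_cast hLn
  set I := (Finset.univ : Finset (Fin L × Fin L)) ×ˢ incPairs (Finset.univ : Finset (Fin n))
    with hI
  have hlt : ∀ a ∈ I, a.2.1 < a.2.2 := fun a ha =>
    (Finset.mem_filter.1 (Finset.mem_product.1 ha).2).2
  set p : ℝ := (1 / (25 * (L : ℝ) ^ 2)) ^ 2 * (1 - 1 / (L : ℝ) ^ 2) ^ (n - 2) with hp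
  set m : ℝ := I.card * p with hm
  -- Since L² ≥ n + 1, one has 1 - 1/L² ≥ n/(n + 1) ≥ exp (-1/n); hence the other vertices all avoid
  -- the block with probability at least 1/e.
  have hv : Real.exp (-(1 / n)) ≤ 1 - 1 / (L : ℝ) ^ 2 := by
    have h1 : 1 / (L : ℝ) ^ 2 ≤ 1 / (n + 1) := by gcongr
    have h2 : Real.exp (-(1 / n)) ≤ 1 - 1 / ((n : ℝ) + 1) := by
      rw [Real.exp_neg]
      have h3 := Real.add_one_le_exp (1 / (n : ℝ))
      calc (Real.exp (1 / n))⁻¹ ≤ (1 / (n : ℝ) + 1)⁻¹ := by gcongr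
        _ = 1 - 1 / ((n : ℝ) + 1) := by field_simp; ring
    linarith
  have hv1 : 1 - 1 / (L : ℝ) ^ 2 ≤ 1 := by
    have : 0 < 1 / (L : ℝ) ^ 2 := by positivity
    linarith
  have hvn : 1 / 3 ≤ (1 - 1 / (L : ℝ) ^ 2) ^ (n - 2) := by
    calc (1 / 3 : ℝ) ≤ Real.exp (-1) := by
          rw [Real.exp_neg, one_div]
          have := Real.exp_one_lt_d9
          gcongr
          linarith
      _ = Real.exp (-(1 / n)) ^ n := by
          rw [← Real.exp_nat_mul]; congr 1; field_simp
      _ ≤ (1 - 1 / (L : ℝ) ^ 2) ^ n := by gcongr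
      _ ≤ _ := pow_le_pow_of_le_one ((Real.exp_pos _).le.trans hv) hv1 (by omega)
  -- The mean is at least L² · (n² - n)/2 · 1/(625 L⁴) · 1/3, and L² ≤ 4n.
  have hm_ge : (n : ℝ) / 30000 ≤ m := by
    have hcard : (I.card : ℝ) = (L : ℝ) ^ 2 * (((n : ℝ) ^ 2 - n) / 2) := by
      have := two_mul_card_incPairs (Finset.univ : Finset (Fin n))
      rw [Finset.card_univ, Fintype.card_fin] at this
      rw [hI, Finset.card_product, Finset.card_univ, Fintype.card_prod, Fintype.card_fin]
      push_cast
      rw [← this]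
      ring
    have h0 : 0 ≤ (n : ℝ) ^ 2 - n := by nlinarith
    calc (n : ℝ) / 30000 ≤ ((n : ℝ) ^ 2 - n) / (1250 * (4 * n)) * (1 / 3) := by
          rw [div_mul_div_comm, div_le_div_iff₀ (by norm_num) (by positivity)]
          nlinarith
      _ ≤ ((n : ℝ) ^ 2 - n) / (1250 * (L : ℝ) ^ 2) * (1 - 1 / (L : ℝ) ^ 2) ^ (n - 2) := by
          gcongr
      _ = m := by
          rw [hm, hcard, hp]
          field_simp
          ring
  have hm0 : 0 < m := lt_of_lt_of_le (by positivity) hm_ge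
  have hcheb := freq_abs_count_sub_ge_le I isolatedEvent (p := p) (ε := 8 / (L : ℝ) ^ 2)
    (τ := m / 2) (fun a ha => freq_isolatedEvent (hlt a ha))
    (fun a ha b hb hab => freq_isolatedEvent_inter_le (hlt a ha) (hlt b hb) hab (by omega))
    (by positivity) (by positivity) _ (fun _ => rfl)
  rw [← hm] at hcheb
  refine (measure_mono (t := {x | (fun i => cell (5 * L) (5 * L) (x i)) ∈ {f | m / 2 ≤
    |∑ a ∈ I, Set.indicator (isolatedEvent a) (fun _ => (1 : ℝ)) f - m|}}) ?_).trans ?_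
  · intro x hx
    simp only [Set.mem_ofPred_eq] at hx ⊢
    have h1 := sum_indicator_isolatedEvent_le fun i => cell (5 * L) (5 * L) (x i)
    rw [abs_sub_comm]
    refine le_trans ?_ (le_abs_self _)
    linarith
  · rw [pi_uniformSquare_cell_preimage]
    apply ENNReal.ofReal_le_ofReal
    refine hcheb.trans ?_
    have h1 : (m + 8 / (L : ℝ) ^ 2 * m ^ 2) / (m / 2) ^ 2 = 4 / m + 32 / (L : ℝ) ^ 2 := by
      field_simp
      ring
    have h2 : 4 / m ≤ 120000 / n := by
      rw [div_le_div_iff₀ hm0 (by positivity)]; linarith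
    have h3 : 32 / (L : ℝ) ^ 2 ≤ 32 / n := by gcongr; linarith
    calc _ = 4 / m + 32 / (L : ℝ) ^ 2 := h1
      _ ≤ 120000 / n + 32 / n := add_le_add h2 h3
      _ = _ := by rw [← add_div]; norm_num

end IsolatedPairs

/-- With high probability every rainbow spanning tree exceeds the length of some spanning tree by
a constant times `√n`. -/
theorem rainbow_tree_excess_whp :
    ∃ c : ℝ, 0 < c ∧ ∃ (H : (n : ℕ) → Set (Fin n → Plane)) (η δ : ℕ → ℝ),
      Tendsto η atTop (𝓝 0) ∧ Tendsto δ atTop (𝓝 0) ∧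
      (∀ᶠ n in atTop, Measure.pi (fun _ : Fin n => uniformSquare) (H n)
        ≤ ENNReal.ofReal (η n)) ∧
      ∀ᶠ n in atTop, ∀ x ∉ H n, freq {χ : KnEdge n → Fin (n - 1) |
        ∀ T : SimpleGraph (Fin n), T.IsTree → IsRainbow χ T →
          ∃ T' : SimpleGraph (Fin n), T'.IsTree ∧
            totalLength x T' + c * √n ≤ totalLength x T}ᶜ ≤ δ n := by
  classical
  refine ⟨1 / (40 * 240000 ^ 2), by positivity, fun n =>
    {x | ¬ ∀ i, x i ∈ halfOpenSquare} ∪ {x | ((isolatedPairs fun i =>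
      cell (5 * (Nat.sqrt n + 1)) (5 * (Nat.sqrt n + 1)) (x i)).card : ℝ) < n / 60000},
    fun n => 120032 / n, fun n => (4 * 240000 ^ 4) / n, tendsto_const_div_atTop_nhds_zero_nat _,
    tendsto_const_div_atTop_nhds_zero_nat _, ?_, ?_⟩
  · filter_upwards [eventually_ge_atTop 8] with n hn
    refine (measure_union_le _ _).trans ?_
    have h1 : Measure.pi (fun _ : Fin n => uniformSquare) {x | ¬ ∀ i, x i ∈ halfOpenSquare} = 0 :=
      ae_mem_halfOpenSquare
    rw [h1, zero_add]
    have h2 := Nat.sqrt_le' n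
    have h3 : 1 ≤ Nat.sqrt n := Nat.le_sqrt.2 (by omega)
    exact pi_uniformSquare_card_isolatedPairs_lt_le hn (Nat.lt_succ_sqrt' n) (by nlinarith)
  · filter_upwards [eventually_ge_atTop 240000] with n hn x hx
    rw [Set.mem_union, not_or] at hx
    have hxs : ∀ i, x i ∈ halfOpenSquare := not_not.1 hx.1
    set L := Nat.sqrt n + 1 with hLdef
    have hcard : (n : ℝ) / 60000 ≤ (isolatedPairs fun i => cell (5 * L) (5 * L) (x i)).card :=
      not_lt.1 hx.2
    -- With this h there are at least 2h isolated pairs, and h ≥ n / 240000 despite the rounding.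
    obtain ⟨h, hh⟩ : ∃ h, h = n / 120000 := ⟨_, rfl⟩
    have hn0 : (240000 : ℝ) ≤ n := by exact_mod_cast hn
    have hh1 : (n : ℝ) / 240000 ≤ h := by
      have : n ≤ 240000 * h := by omega
      rw [div_le_iff₀ (by norm_num)]
      have : (n : ℝ) ≤ 240000 * h := by exact_mod_cast this
      linarith
    have hh2 : ((2 * h : ℕ) : ℝ) ≤ n / 60000 := by
      have : 2 * h * 60000 ≤ n := by omega
      rw [le_div_iff₀ (by norm_num)]
      exact_mod_cast this
    have hle : 2 * h ≤ (isolatedPairs fun i => cell (5 * L) (5 * L) (x i)).card :=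
      Nat.cast_le.1 (hh2.trans hcard)
    obtain ⟨P, hPsub, hPcard⟩ := Finset.exists_subset_card_eq hle
    have : Nonempty (Fin (n - 1)) := ⟨⟨0, by omega⟩⟩
    have hfreq := freq_card_image_gt_le (κ := Fin (n - 1)) P hPcard (by omega)
      (by rw [Fintype.card_fin]; omega)
    rw [Fintype.card_fin] at hfreq
    set N : ℝ := ((n - 1 : ℕ) : ℝ) with hN
    have hNn : N ≤ n := by rw [hN]; exact_mod_cast Nat.sub_le _ _
    have hN0 : 0 < N := by rw [hN]; exact_mod_cast (by omega : 0 < n - 1)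
    have hh0 : (0 : ℝ) < h := lt_of_lt_of_le (by positivity) hh1
    have hlast : 4 * N ^ 3 / (h : ℝ) ^ 4 ≤ 4 * 240000 ^ 4 / n :=
      calc 4 * N ^ 3 / (h : ℝ) ^ 4 ≤ 4 * (n : ℝ) ^ 3 / (n / 240000) ^ 4 := by gcongr
        _ = _ := by field_simp
    refine le_trans (freq_mono ?_) (hfreq.trans hlast)
    · rw [Set.compl_subset_comm]
      intro χ hχ T hT hTχ
      have hχ' : ((P.image χ).card : ℝ) ≤ 2 * h - (h : ℝ) ^ 2 / (2 * N) := not_lt.1 hχ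
      have hL0 : (0 : ℝ) < L := by rw [hLdef]; positivity
      obtain ⟨T', hT', hlen⟩ := exists_shorter_tree_of_rainbow (x := x) (P := P)
        (g := 1 / (10 * L)) (by positivity)
        (fun e he a b hab c hca hcb =>
          dist_add_le_of_mem_isolatedPairs hxs (hPsub he) hab hca hcb) hT hTχ
      refine ⟨T', hT', le_trans ?_ hlen⟩
      rw [add_le_add_iff_left]
      have hsq : √(n : ℝ) * √n = n := Real.mul_self_sqrt (by positivity)
      have hsn : 0 < √(n : ℝ) := Real.sqrt_pos.2 (by linarith)
      have hLn : (L : ℝ) ≤ 2 * √n := by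
        have h1 : (Nat.sqrt n : ℝ) ≤ √(n : ℝ) := by
          apply Real.le_sqrt_of_sq_le
          exact_mod_cast Nat.sqrt_le' n
        have h2 : 1 ≤ √(n : ℝ) := by
          apply Real.le_sqrt_of_sq_le; linarith
        rw [hLdef]; push_cast; linarith
      rw [hPcard]
      push_cast
      -- The gain per exchange, 1/(10L) with L ≤ 2√n, times the number h²/(2N) of repeated colours.
      calc 1 / (40 * 240000 ^ 2) * √(n : ℝ)
          = 1 / (10 * (2 * √n)) * ((n / 240000) ^ 2 / (2 * n)) := by
            field_simp
            nlinarith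
        _ ≤ 1 / (10 * L) * ((h : ℝ) ^ 2 / (2 * N)) := by gcongr
        _ ≤ 1 / (10 * L) * (2 * h - (P.image χ).card) := by gcongr; linarith

/-! ### Conclusion -/

theorem isTree_rainbow_of_mem_treeEvent {n : ℕ} {κ : Type*} {x : Fin n → Plane}
    {χ : KnEdge n → κ} {L : ℝ} (h : χ ∈ treeEvent (fun e : KnEdge n => edgeLength x e.1) L) :
    ∃ T : SimpleGraph (Fin n), T.IsTree ∧ IsRainbow χ T ∧ totalLength x T ≤ L := by
  obtain ⟨F, hF, hχ, hlen⟩ := h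
  refine ⟨edgeGraph F, hF, ?_, ?_⟩
  · intro e he e' he' hee
    rw [Set.mem_ofPred_eq, edgeGraph_edgeSet] at he he'
    obtain ⟨f, hf, hfe⟩ := he
    obtain ⟨f', hf', hfe'⟩ := he'
    rw [← Subtype.ext hfe, ← Subtype.ext hfe'] at hee ⊢
    exact hχ hf hf' hee
  · rw [totalLength_eq_sum (E := F.map (Function.Embedding.subtype _)), Finset.sum_map]
    · exact hlen
    · rw [edgeGraph_edgeSet, Finset.coe_map]; rfl

theorem totalLength_nonneg {n : ℕ} (x : Fin n → Plane) (T : SimpleGraph (Fin n)) :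
    0 ≤ totalLength x T := by
  unfold totalLength
  refine Finset.sum_nonneg fun e _ => ?_
  induction e using Sym2.ind with
  | _ a b => exact (dist_nonneg : 0 ≤ dist (x a) (x b))

/-- There are finitely many graphs on `Fin n`, so minima over a nonempty class are attained. -/
theorem exists_isLeast_totalLength {n : ℕ} (x : Fin n → Plane) {Q : SimpleGraph (Fin n) → Prop}
    (h : ∃ T, Q T) : ∃ z, IsLeast {l | ∃ T, Q T ∧ totalLength x T = l} z := by
  obtain ⟨T, hT⟩ := h
  have hfin : {l | ∃ T, Q T ∧ totalLength x T = l}.Finite :=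
    (Set.toFinite {T | Q T}).image (totalLength x)
  exact hfin.isCompact.exists_isLeast ⟨_, T, hT, rfl⟩

theorem theorem1 :
    (∃ c C : ℝ, 0 < c ∧ 0 < C ∧ WithHighProbability fun n => {ω |
      ∃ z : ℝ, IsRainbowMSTLength ω z ∧
        c * Real.sqrt n ≤ z ∧ z ≤ C * Real.sqrt n}) ∧
    (∃ c C : ℝ, 0 < c ∧ 0 < C ∧ WithHighProbability fun n => {ω |
      ∃ z zStar : ℝ, IsRainbowMSTLength ω z ∧ IsMSTLength ω zStar ∧
        c * Real.sqrt n ≤ z - zStar ∧ z - zStar ≤ C * Real.sqrt n}) := by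
  obtain ⟨C, hC, H₁, η₁, δ₁, hη₁, hδ₁, hH₁, hE₁⟩ := exists_short_rainbow_tree_whp
  obtain ⟨c, hc, H₂, η₂, δ₂, hη₂, hδ₂, hH₂, hE₂⟩ := rainbow_tree_excess_whp
  -- A single event serves both statements: Z* ≥ 0 turns the lower bound for Z - Z* into one for Z,
  -- and the upper bound for Z into one for Z - Z*.
  have key : ∀ E : (n : ℕ) → Set (Outcome n), (∀ (n : ℕ) (ω : Outcome n) (z zStar : ℝ),
      IsRainbowMSTLength ω z → IsMSTLength ω zStar → 0 ≤ zStar → c * √n ≤ z - zStar →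
      z ≤ C * √n → ω ∈ E n) → WithHighProbability E := by
    intro E hE
    refine withHighProbability_of_freq (H := fun n => H₁ n ∪ H₂ n)
      (η := fun n => |η₁ n| + |η₂ n|) (δ := fun n => δ₁ n + δ₂ n) ?_ ?_ ?_ ?_
    · filter_upwards [hH₁, hH₂] with n h1 h2
      -- Absolute values of the error terms are needed because `ENNReal.ofReal` is additive only on
      -- nonnegative numbers.
      rw [ENNReal.ofReal_add (abs_nonneg _) (abs_nonneg _)]
      exact (measure_union_le _ _).trans (add_le_add
        (h1.trans (ENNReal.ofReal_le_ofReal (le_abs_self _)))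
        (h2.trans (ENNReal.ofReal_le_ofReal (le_abs_self _))))
    · filter_upwards [hE₁, hE₂] with n h1 h2 x hx
      rw [Set.mem_union, not_or] at hx
      refine (freq_mono ?_).trans ((freq_union_le _ _).trans
        (add_le_add (h1 x hx.1) (h2 x hx.2)))
      rw [← Set.compl_inter, Set.subset_compl_comm]
      rintro χ ⟨hχ₁, hχ₂⟩ hχ
      apply hχ
      obtain ⟨T, hT, hTχ, hTlen⟩ := isTree_rainbow_of_mem_treeEvent hχ₁
      obtain ⟨z, hz⟩ := exists_isLeast_totalLength x
        (Q := fun T => T.IsTree ∧ IsRainbow χ T) ⟨T, hT, hTχ⟩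
      obtain ⟨zStar, hzStar⟩ := exists_isLeast_totalLength x (Q := fun T => T.IsTree) ⟨T, hT⟩
      simp only [and_assoc] at hz
      refine hE n (x, χ) z zStar hz hzStar ?_ ?_ ?_
      · obtain ⟨T₀, -, h0⟩ := hzStar.1
        rw [← h0]
        exact totalLength_nonneg x T₀
      · obtain ⟨T₁, hT₁, hχT₁, h1⟩ := hz.1
        obtain ⟨T₂, hT₂, h2⟩ := hχ₂ T₁ hT₁ hχT₁
        have := hzStar.2 ⟨T₂, hT₂, rfl⟩
        linarith
      · exact (hz.2 ⟨T, hT, hTχ, rfl⟩).trans hTlen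
    · simpa using hη₁.abs.add hη₂.abs
    · simpa using hδ₁.add hδ₂
  refine ⟨⟨c, C, hc, hC, key _ ?_⟩, ⟨c, C, hc, hC, key _ ?_⟩⟩
  · intro n ω z zStar h1 h2 h3 h4 h5
    exact ⟨z, h1, by linarith, h5⟩
  · intro n ω z zStar h1 h2 h3 h4 h5
    exact ⟨z, zStar, h1, h2, h4, by linarith⟩
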